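/- Let $\kappa_0,\kappa_1,\kappa_t,\kappa,c\in\mathbb C$ with $c\neq 0,1$. Consider the sixth Painlevé equation in its Hamiltonian form $$\frac{d\lambda}{dt}=\frac{\partial H}{\partial p},\qquad \frac{dp}{dt}=-\frac{\partial H}{\partial\lambda},\qquad t\in\mathbb C\setminus\{0,1\},$$ $$H=\frac{1}{t(t-1)}\Big[\lambda(\lambda-1)(\lambda-t)p^2+\big\{\kappa_0(\lambda-1)(\lambda-t)+\kappa_1\lambda(\lambda-t)+(\kappa_t+1)\lambda(\lambda-1)\big\}p+\kappa(\lambda-t)\Big].$$ (For $\kappa=\tfrac14[(\kappa_0+\kappa_1+\kappa_t+1)^2-\kappa_\infty^2]$ this is equivalent to the sixth Painlevé equation with parameters $\alpha=\tfrac12\kappa_\infty^2$, $\beta=\tfrac12\kappa_0^2$, $\gamma=\tfrac12\kappa_1^2$, $\delta=\tfrac12\kappa_t^2$; every $\kappa\in\mathbb C$ is of this form.) In the coordinates $(\lambda,\mu,t)$ with $\mu=1/p$, the associated one-dimensional foliation extends holomorphically across $\mu=0$, being defined by the polynomial vector field $t(t-1)\mu\,(\dot\lambda,\dot\mu,1)$.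 The four-punctured sphere at infinity $$\Gamma_c=\{\mu=0,\ t=c,\ \lambda\in\mathbb P^1\setminus\{0,1,c,\infty\}\}$$ is a leaf of it (it is the vertical leaf $D_0(c)$ of the Okamoto compactification, with its four singular points removed). For every base point $P\in\Gamma_c$, lifting loops of $\Gamma_c$ to nearby leaves defines the holonomy representation $\rho:\pi_1(\Gamma_c,P)\to \mathrm{Diff}(\mathbb C^2,0)$ into the group of germs of analytic diffeomorphisms of the cross-section $\{\lambda=P\}$. Its image $G$, the holonomy group at infinity, is virtually commutative: it has a commutative normal subgroup of finite index. More precisely, $G$ is generated by three germs $h_0,h_1,h_c$, the holonomies along loops making one turn around $\lambda=0,1,c$ respectively. For any such three loops whose holonomies $h_0,h_1,h_c$ generate $G$, the elements of $G$ represented by words of even length in the letters $h_0,h_1,h_c$ form a commutative normal subgroup of $G$ of index at most $2$. -/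

import Mathlib

open Filter Topology

noncomputable section

namespace PainleveVI

/-! ### The foliation near the line at infinity -/

/-- The Hamiltonian of the sixth Painlevé system `dq/dt = ∂H/∂p`, `dp/dt = -∂H/∂q`. -/
def hamiltonian (κ₀ κ₁ κₜ κ q p t : ℂ) : ℂ :=
  1 / (t * (t - 1)) *
    (q * (q - 1) * (q - t) * p ^ 2
      + (κ₀ * (q - 1) * (q - t) + κ₁ * q * (q - t) + (κₜ + 1) * q * (q - 1)) * p
      + κ * (q - t))

/-- `E(t, q) = q (q - 1) (q - t)`. -/
def polyE (t q : ℂ) : ℂ := q * (q - 1) * (q - t)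

/-- `∂E/∂q`. -/
def polyE' (t q : ℂ) : ℂ := (q - 1) * (q - t) + q * (q - t) + q * (q - 1)

/-- `F(t, q) = κ₀ (q - 1) (q - t) + κ₁ q (q - t) + (κₜ + 1) q (q - 1)`. -/
def polyF (κ₀ κ₁ κₜ t q : ℂ) : ℂ :=
  κ₀ * (q - 1) * (q - t) + κ₁ * q * (q - t) + (κₜ + 1) * q * (q - 1)

/-- `∂F/∂q`. -/
def polyF' (κ₀ κ₁ κₜ t q : ℂ) : ℂ :=
  κ₀ * ((q - 1) + (q - t)) + κ₁ * (q + (q - t)) + (κₜ + 1) * (q + (q - 1))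

/-- The polynomial vector field, in the coordinates `(q, m, t)` with `m = 1 / p`, which defines
the foliation of the sixth Painlevé system near the line at infinity `m = 0`: its `q`-component. -/
def fieldQ (κ₀ κ₁ κₜ q m t : ℂ) : ℂ := 2 * polyE t q + polyF κ₀ κ₁ κₜ t q * m

/-- The `m`-component of the vector field. -/
def fieldM (κ₀ κ₁ κₜ κ q m t : ℂ) : ℂ :=
  (polyE' t q + polyF' κ₀ κ₁ κₜ t q * m + κ * m ^ 2) * m

/-- The `t`-component of the vector field. -/
def fieldT (m t : ℂ) : ℂ := t * (t - 1) * m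

/-- Where `m ≠ 0`, the polynomial vector field is `t (t - 1) m` times the Hamiltonian vector field
`(∂H/∂p, -∂H/∂q, 1)` written in the coordinates `(q, m, t)`, `m = 1 / p`, `dm = -m² dp`. So the
foliation by its integral curves extends that of the sixth Painlevé system across `m = 0`. -/
theorem field_eq (κ₀ κ₁ κₜ κ q m t : ℂ) (hm : m ≠ 0) (ht0 : t ≠ 0) (ht1 : t ≠ 1) :
    fieldQ κ₀ κ₁ κₜ q m t
        = t * (t - 1) * m * deriv (fun p => hamiltonian κ₀ κ₁ κₜ κ q p t) (1 / m) ∧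
      fieldM κ₀ κ₁ κₜ κ q m t
        = t * (t - 1) * m *
          (-m ^ 2 * -deriv (fun x => hamiltonian κ₀ κ₁ κₜ κ x (1 / m) t) q) ∧
      fieldT m t = t * (t - 1) * m * 1 := by
  have ht1' : t - 1 ≠ 0 := sub_ne_zero.mpr ht1
  refine ⟨?_, ?_, by simp [fieldT]⟩
  · have h : HasDerivAt (fun p => hamiltonian κ₀ κ₁ κₜ κ q p t)
        (1 / (t * (t - 1)) * (polyE t q * (2 * (1 / m)) + polyF κ₀ κ₁ κₜ t q)) (1 / m) := by
      have h1 := (((((hasDerivAt_id' (1 / m)).fun_pow 2).const_mul (polyE t q)).fun_add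
        ((hasDerivAt_id' (1 / m)).const_mul (polyF κ₀ κ₁ κₜ t q))).add_const
          (κ * (q - t))).const_mul (1 / (t * (t - 1)))
      exact h1.congr_deriv (by norm_num)
    rw [h.deriv, fieldQ]
    field_simp
  · have hx := hasDerivAt_id' q
    have hE : HasDerivAt (fun x => polyE t x) (polyE' t q) q :=
      ((hx.fun_mul (hx.sub_const 1)).fun_mul (hx.sub_const t)).congr_deriv
        (by simp only [polyE']; ring)
    have hF : HasDerivAt (fun x => polyF κ₀ κ₁ κₜ t x) (polyF' κ₀ κ₁ κₜ t q) q :=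
      (((((hx.sub_const 1).const_mul κ₀).fun_mul (hx.sub_const t)).fun_add
        ((hx.const_mul κ₁).fun_mul (hx.sub_const t))).fun_add
          ((hx.const_mul (κₜ + 1)).fun_mul (hx.sub_const 1))).congr_deriv
        (by simp only [polyF']; ring)
    have h : HasDerivAt (fun x => hamiltonian κ₀ κ₁ κₜ κ x (1 / m) t)
        (1 / (t * (t - 1)) *
          (polyE' t q * (1 / m) ^ 2 + polyF' κ₀ κ₁ κₜ t q * (1 / m) + κ)) q :=
      ((((hE.mul_const ((1 / m) ^ 2)).fun_add (hF.mul_const (1 / m))).fun_add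
        ((hx.sub_const t).const_mul κ)).const_mul (1 / (t * (t - 1)))).congr_deriv (by ring)
    rw [h.deriv, fieldM]
    field_simp

/-- The slope `(dm/dq, dt/dq)` of the foliation with respect to the coordinate `q`, at the point
with coordinates `q` and `y = (m, t)`. It is used only where `fieldQ` does not vanish. -/
def slope (κ₀ κ₁ κₜ κ q : ℂ) (y : ℂ × ℂ) : ℂ × ℂ :=
  (fieldM κ₀ κ₁ κₜ κ q y.1 y.2 / fieldQ κ₀ κ₁ κₜ q y.1 y.2,
    fieldT y.1 y.2 / fieldQ κ₀ κ₁ κₜ q y.1 y.2)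

/-- The vertical leaf at infinity `{m = 0, t = c}` without its four singular points
`q = 0, 1, c, ∞`, with coordinate `q`. -/
abbrev Leaf (c : ℂ) : Type := {q : ℂ // q ≠ 0 ∧ q ≠ 1 ∧ q ≠ c}

/-- `y = (m, t)` lifts the path `γ` to a leaf of the foliation in the direction of the planes
`q = const`: the point `(γ s, y s)` has `t ≠ 0, 1`, the foliation is regular and transverse to
`q = const` there, and near each parameter the lift runs in the graph of a holomorphic local
solution of `d(m, t)/dq = slope`. -/
def IsLift (κ₀ κ₁ κₜ κ : ℂ) {c : ℂ} {a b : Leaf c} (γ : Path a b)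
    (y : unitInterval → ℂ × ℂ) : Prop :=
  ∀ s₀ : unitInterval,
    (y s₀).2 ≠ 0 ∧ (y s₀).2 ≠ 1 ∧
    fieldQ κ₀ κ₁ κₜ (γ s₀ : ℂ) (y s₀).1 (y s₀).2 ≠ 0 ∧
    ∃ φ : ℂ → ℂ × ℂ,
      (∀ᶠ q in 𝓝 (γ s₀ : ℂ), HasDerivAt φ (slope κ₀ κ₁ κₜ κ q (φ q)) q) ∧
      ∀ᶠ s in 𝓝 s₀, y s = φ (γ s : ℂ)

/-! ### Germs of analytic diffeomorphisms -/

section Germs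

variable {V : Type*} [NormedAddCommGroup V] [NormedSpace ℂ V]

/-- Maps `V → V` that fix `x` and are analytic at `x`. -/
abbrev LocalSelfMap (x : V) : Type _ := {f : V → V // AnalyticAt ℂ f x ∧ f x = x}

/-- Two maps are identified when they agree near `x`. -/
def germSetoid (x : V) : Setoid (LocalSelfMap x) where
  r f g := f.1 =ᶠ[𝓝 x] g.1
  iseqv := ⟨fun _ => EventuallyEq.rfl, fun h => h.symm, fun h k => h.trans k⟩

/-- Germs at `x` of analytic maps `(V, x) → (V, x)`. -/
def SelfGerm (x : V) : Type _ := Quotient (germSetoid x)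

/-- The germ at `x` of a map that fixes `x` and is analytic there. -/
def germOf {x : V} (f : LocalSelfMap x) : SelfGerm x := Quotient.mk (germSetoid x) f

/-- Composition of local maps. -/
def LocalSelfMap.comp {x : V} (f g : LocalSelfMap x) : LocalSelfMap x :=
  ⟨f.1 ∘ g.1, AnalyticAt.comp (by rw [g.2.2]; exact f.2.1) g.2.1,
    by rw [Function.comp_apply, g.2.2, f.2.2]⟩

/-- Germs of analytic self-maps form a monoid under composition. -/
instance (x : V) : Monoid (SelfGerm x) where
  mul := Quotient.map₂ LocalSelfMap.comp (by
    intro f f' hf g g' hg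
    have ht : Tendsto g.1 (𝓝 x) (𝓝 x) := by
      have h := g.2.1.continuousAt.tendsto
      rwa [g.2.2] at h
    filter_upwards [ht.eventually hf, hg] with z hz hz'
    change f.1 (g.1 z) = f'.1 (g'.1 z)
    rw [hz, hz'])
  one := germOf ⟨id, analyticAt_id, rfl⟩
  mul_assoc := by rintro ⟨f⟩ ⟨g⟩ ⟨h⟩; rfl
  one_mul := by rintro ⟨f⟩; rfl
  mul_one := by rintro ⟨f⟩; rfl

/-- The group `Diff(V, x)` of germs at `x` of analytic diffeomorphisms fixing `x`: the analytic
germs that are invertible under composition. -/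
abbrev DiffGerm (x : V) : Type _ := (SelfGerm x)ˣ

end Germs

/-! ### Holonomy -/

/-- The germ `h` at `(m, t) = (0, c)` is the holonomy of the foliation along the loop `γ` in the
leaf at infinity, on the cross-section `q = P` with coordinates `(m, t)`: for `z` close to `(0, c)`
the loop `γ` lifts to a path in a leaf of the foliation which starts at `z` and ends at `h z`. -/
def IsHolonomy (κ₀ κ₁ κₜ κ : ℂ) {c : ℂ} {P : Leaf c} (γ : Path P P)
    (h : DiffGerm ((0, c) : ℂ × ℂ)) : Prop :=
  ∃ f : LocalSelfMap ((0, c) : ℂ × ℂ), germOf f = (h : SelfGerm ((0, c) : ℂ × ℂ)) ∧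
    ∀ᶠ z in 𝓝 ((0, c) : ℂ × ℂ), ∃ y : unitInterval → ℂ × ℂ,
      IsLift κ₀ κ₁ κₜ κ γ y ∧ y 0 = z ∧ y 1 = f.1 z

/-- `ρ` is the holonomy representation of the fundamental group of the leaf at infinity: it sends
the class of each loop to the holonomy along that loop, and to nothing else. (A product `a * b`
in `FundamentalGroup` runs first through `b`, as in a composition of germs.) The holonomy group
is the image `ρ.range`. -/
def IsHolonomyRepresentation (κ₀ κ₁ κₜ κ : ℂ) {c : ℂ} {P : Leaf c}
    (ρ : FundamentalGroup (Leaf c) P →* DiffGerm ((0, c) : ℂ × ℂ)) : Prop :=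
  ∀ (γ : Path P P) (h : DiffGerm ((0, c) : ℂ × ℂ)),
    IsHolonomy κ₀ κ₁ κₜ κ γ h ↔
      h = ρ (FundamentalGroup.fromPath (Path.Homotopic.Quotient.mk γ))

/-- `g` is the class of a loop making one turn around the puncture `a`: it runs along a path `δ` to
a point of a circle with centre `a` that encloses no other puncture, once counterclockwise around
this circle, and back along `δ`. -/
def IsSimpleTurn {c : ℂ} {P : Leaf c} (a : ℂ) (g : FundamentalGroup (Leaf c) P) : Prop :=
  ∃ (r : ℝ) (θ : ℝ) (Q : Leaf c) (δ : Path P Q) (σ : Path Q Q),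
    0 < r ∧ (∀ b ∈ ({0, 1, c} : Set ℂ), b ≠ a → r < dist b a) ∧
    (∀ s : unitInterval, (σ s : ℂ) =
      a + r * Complex.exp ((θ + 2 * Real.pi * (s : ℝ) : ℝ) * Complex.I)) ∧
    g = FundamentalGroup.fromPath (Path.Homotopic.Quotient.mk ((δ.trans σ).trans δ.symm))

/-- A group is virtually commutative if it has a commutative normal subgroup of finite index. -/
def VirtuallyCommutative (G : Type*) [Group G] : Prop :=
  ∃ N : Subgroup G, N.Normal ∧ (∀ a ∈ N, ∀ b ∈ N, a * b = b * a) ∧ N.FiniteIndex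

/-- `g` is represented by a word of even length in the letters `h₀, h₁, h₂`. -/
def IsEvenWord {G : Type*} [Monoid G] (h : Fin 3 → G) (g : G) : Prop :=
  ∃ w : List (Fin 3), Even w.length ∧ g = (w.map h).prod

end PainleveVI

end

open Filter Topology

noncomputable section

namespace PainleveVI

/-! The mechanism is that the holonomy around each of the four punctures `0, 1, c, ∞` of the leaf
has square one. The holonomy group is then a quotient of `⟨a, b, d | a² = b² = d² = (dba)² = 1⟩`,
the orbifold group of the sphere with four cone points of order two (the pillowcase), in which the
even words are the translations and therefore commute. This algebra is in
`exists_commutative_of_involutions` and `exists_subgroup_even_words`.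

The square is one because the foliation becomes regular on a double cover. Near a finite singular
point with local coordinate `x` and exponent `k` (one of `κ₀, κ₁, κₜ`), put `p = 1/m`, introduce a
time `τ` with `dt = ε t(t-1) dτ`, and set `Z = ε x p`, `G = ε²(x p² + k p)`. Then `Z² + kεZ = xG`,
and `(x, Z, G, t)` obeys a polynomial system that makes sense for `ε = 0` too, where it describes
the leaf at infinity. For the initial values `x = Z = 0`, `G = 1`, `t = c` and `ε = 0`, the function
`Z` has a simple zero, so `x = Z²/G = T² u(T)` with `u(0) ≠ 0`. Neighbouring solutions are
holomorphic in `T`, hence return after one turn of `T`, which is two turns of `x`. At infinity `x =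
1/q`, and `Z` is shifted by `ε` times a root of a quadratic equation. See `exists_isResolved`,
`IsResolved.exists_radius`, `IsResolved.isSolutionFamily`, `IsResolved.isSolutionFamily_infinity`
and `apply_add_eq_of_isSolutionFamily`.

Germs of solutions along the leaf form a flat bundle with discrete structure group, whose parallel
transport is the geometric holonomy (`foliation`, `isHolonomy_iff`). Instead of computing the
fundamental group of the leaf, one covers it by two contractible slit planes meeting in four strips.
The jumps between parallel frames of the two planes give elements `J 0, J 1, J 2`. They generate a
group containing every holonomy; a turn around a puncture is conjugate, inside this group, to some
`J i`; and `J 2 * J 1 * J 0` is conjugate to the monodromy around infinity (`Frame.hol_loop_mem`,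
`Frame.holHom_of_isSimpleTurn`, `Frame.J_product_mul_self`). -/

section

/-! ### Flat systems and parallel functions -/

/-- A flat principal bundle over `X` with discrete structure group `G`, trivialised as a set: on the
open set `U x` a parallel section is a right translate of `S x`. -/
structure FlatSystem (X G : Type*) [TopologicalSpace X] [Group G] where
  U : X → Set X
  isOpen_U : ∀ x, IsOpen (U x)
  mem_U : ∀ x, x ∈ U x
  S : X → X → G
  S_self : ∀ x, S x x = 1
  locConst : ∀ x y, ∀ b ∈ U x ∩ U y, ∀ᶠ b' in 𝓝 b, (S x b')⁻¹ * S y b' = (S x b)⁻¹ * S y b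

namespace FlatSystem

variable {X G : Type*} [TopologicalSpace X] [Group G] (B : FlatSystem X G)
variable {A A' : Type*} [TopologicalSpace A] [TopologicalSpace A']

/-- `g` is a parallel section of the flat system along `f`. -/
def IsParallel (f : A → X) (g : A → G) : Prop :=
  ∀ a₀, ∃ x k, f a₀ ∈ B.U x ∧ ∀ᶠ a in 𝓝 a₀, g a = B.S x (f a) * k

variable {B}

theorem IsParallel.comp {f : A → X} {g : A → G} (h : B.IsParallel f g) {u : A' → A}
    (hu : Continuous u) : B.IsParallel (f ∘ u) (g ∘ u) := by
  intro a
  obtain ⟨x, k, hx, hk⟩ := h (u a)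
  exact ⟨x, k, hx, hu.continuousAt.eventually hk⟩

theorem IsParallel.mul_const {f : A → X} {g : A → G} (h : B.IsParallel f g) (m : G) :
    B.IsParallel f (fun a => g a * m) := by
  intro a
  obtain ⟨x, k, hx, hk⟩ := h a
  exact ⟨x, k * m, hx, hk.mono fun b hb => by simp only [hb, mul_assoc]⟩

/-- Locally the two sections are `S x * k` and `S y * l`, so their quotient depends on the point
only through `(S x)⁻¹ * S y`, which is locally constant. -/
theorem IsParallel.eventually_inv_mul {f : A → X} {g g' : A → G} (hf : Continuous f)
    (h : B.IsParallel f g) (h' : B.IsParallel f g') (a₀ : A) :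
    ∀ᶠ a in 𝓝 a₀, (g a)⁻¹ * g' a = (g a₀)⁻¹ * g' a₀ := by
  obtain ⟨x, k, hx, hk⟩ := h a₀
  obtain ⟨y, l, hy, hl⟩ := h' a₀
  have hc := hf.continuousAt.eventually (B.locConst x y (f a₀) ⟨hx, hy⟩)
  have key : ∀ a, g a = B.S x (f a) * k → g' a = B.S y (f a) * l →
      (g a)⁻¹ * g' a = k⁻¹ * ((B.S x (f a))⁻¹ * B.S y (f a)) * l := by
    intro a h1 h2
    rw [h1, h2]
    group
  filter_upwards [hk, hl, hc] with a h1 h2 h3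
  rw [key a h1 h2, h3, ← key a₀ hk.self_of_nhds hl.self_of_nhds]

theorem IsParallel.inv_mul_eq [PreconnectedSpace A] {f : A → X} {g g' : A → G}
    (hf : Continuous f) (h : B.IsParallel f g) (h' : B.IsParallel f g') (a b : A) :
    (g a)⁻¹ * g' a = (g b)⁻¹ * g' b :=
  (IsLocallyConstant.iff_eventually_eq _).2 (fun x => h.eventually_inv_mul hf h' x)
    |>.apply_eq_of_preconnectedSpace a b

/-- Two parallel sections differ by a constant right factor, which cancels here. Transport from `b`
to `a` is thus independent of the section, and `hol` is well defined. -/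
theorem IsParallel.mul_inv_eq [PreconnectedSpace A] {f : A → X} {g g' : A → G}
    (hf : Continuous f) (h : B.IsParallel f g) (h' : B.IsParallel f g') (a b : A) :
    g a * (g b)⁻¹ = g' a * (g' b)⁻¹ := by
  have := h.inv_mul_eq hf h' a b
  rw [inv_mul_eq_iff_eq_mul] at this
  rw [this]
  group

theorem isParallel_const (x : X) (k : G) : B.IsParallel (fun _ : A => x) (fun _ => k) :=
  fun _ => ⟨x, k, B.mem_U x, Eventually.of_forall fun _ => by rw [B.S_self, one_mul]⟩

variable (B)

/-- The fibre bundle with discrete fibre `G` attached to a flat system. -/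
def core [TopologicalSpace G] [DiscreteTopology G] : FiberBundleCore X X G where
  baseSet := B.U
  isOpen_baseSet := B.isOpen_U
  indexAt := id
  mem_baseSet_at := B.mem_U
  coordChange i j b v := (B.S j b)⁻¹ * B.S i b * v
  coordChange_self i x _ v := by simp
  continuousOn_coordChange i j := by
    rintro ⟨b, v⟩ ⟨hb, -⟩
    refine ContinuousAt.continuousWithinAt ?_
    have h1 := B.locConst j i b ⟨hb.2, hb.1⟩
    have h2 : ∀ᶠ p : X × G in 𝓝 (b, v), p.2 = v :=
      continuousAt_snd.eventually ((isOpen_discrete {v}).mem_nhds (Set.mem_singleton v))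
    have h3 : ∀ᶠ p : X × G in 𝓝 (b, v),
        (B.S j b)⁻¹ * B.S i b * v = (B.S j p.1)⁻¹ * B.S i p.1 * p.2 := by
      filter_upwards [continuousAt_fst.eventually h1, h2] with p hp hp'
      rw [hp', hp]
    exact ContinuousAt.congr continuousAt_const h3
  coordChange_comp i j k x _ v := by simp [mul_assoc]

/-- With the discrete topology on the fibre the associated bundle is a covering of `X`; a parallel
section is a lift of `f`, which exists over a simply connected source. -/
theorem exists_isParallel [SimplyConnectedSpace A] [LocallyPathConnectedSpace A]
    {f : A → X} (hf : Continuous f) (a₀ : A) (k : G) :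
    ∃ g : A → G, B.IsParallel f g ∧ g a₀ = k := by
  let _ : TopologicalSpace G := ⊥
  have : DiscreteTopology G := ⟨rfl⟩
  have cov : IsCoveringMap (Bundle.TotalSpace.proj : B.core.TotalSpace → X) :=
    FiberBundle.isCoveringMap (F := G) (E := B.core.Fiber)
  obtain ⟨F, ⟨hF0, hF⟩, -⟩ :=
    cov.existsUnique_continuousMap_lifts ⟨f, hf⟩ a₀ (⟨f a₀, k⟩ : B.core.TotalSpace) rfl
  have hF' : ∀ a, (F a).proj = f a := fun a => congrFun hF a
  refine ⟨fun a => (F a).2, fun a₁ => ?_, ?_⟩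
  swap
  · change (F a₀).2 = k
    rw [hF0]
  let x := f a₁
  let T := B.core.localTriv x
  have hmem : F a₁ ∈ T.source := by
    rw [T.mem_source]
    have : (F a₁).proj ∈ B.U x := by rw [hF']; exact B.mem_U x
    exact this
  have hc : ContinuousAt (fun a => (T (F a)).2) a₁ :=
    continuousAt_snd.comp ((T.continuousAt hmem).comp F.continuous.continuousAt)
  have hev : ∀ᶠ a in 𝓝 a₁, (T (F a)).2 = (T (F a₁)).2 :=
    hc.eventually ((isOpen_discrete {(T (F a₁)).2}).mem_nhds (Set.mem_singleton _))
  refine ⟨x, (T (F a₁)).2, B.mem_U x, hev.mono fun a ha => ?_⟩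
  have h2 : (T (F a)).2 =
      (B.S x (F a).proj)⁻¹ * B.S (F a).proj (F a).proj * (show G from (F a).2) := rfl
  rw [← ha, h2, B.S_self, hF', mul_one, mul_inv_cancel_left]

/-! ### Holonomy along paths -/

instance : ContractibleSpace unitInterval :=
  (convex_Icc (0 : ℝ) 1).contractibleSpace ⟨0, by simp⟩

instance : LocallyPathConnectedSpace unitInterval :=
  (convex_Icc (0 : ℝ) 1).locallyPathConnectedSpace

/-- A parallel section along a path. -/
def along {a b : X} (γ : Path a b) : unitInterval → G :=
  (B.exists_isParallel (f := γ) γ.continuous 0 1).choose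

theorem along_spec {a b : X} (γ : Path a b) : B.IsParallel γ (B.along γ) :=
  (B.exists_isParallel (f := γ) γ.continuous 0 1).choose_spec.1

/-- The holonomy along a path. -/
def hol {a b : X} (γ : Path a b) : G := B.along γ 1 * (B.along γ 0)⁻¹

variable {B}

theorem IsParallel.hol_eq {a b : X} {γ : Path a b} {g : unitInterval → G}
    (h : B.IsParallel γ g) : B.hol γ = g 1 * (g 0)⁻¹ :=
  (B.along_spec γ).mul_inv_eq γ.continuous h 1 0

variable (B)

theorem hol_refl (a : X) : B.hol (Path.refl a) = 1 := by
  have h : B.IsParallel (Path.refl a) (fun _ => (1 : G)) := isParallel_const a 1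
  rw [h.hol_eq]
  simp

theorem hol_symm {a b : X} (γ : Path a b) : B.hol γ.symm = (B.hol γ)⁻¹ := by
  have h : B.IsParallel γ.symm (B.along γ ∘ unitInterval.symm) :=
    (B.along_spec γ).comp unitInterval.continuous_symm
  rw [h.hol_eq, hol]
  simp

theorem hol_trans {a b c : X} (γ : Path a b) (γ' : Path b c) :
    B.hol (γ.trans γ') = B.hol γ' * B.hol γ := by
  have h := B.along_spec (γ.trans γ')
  set g := B.along (γ.trans γ')
  -- `u` and `v` parametrise the two halves of the concatenated path; one section along the whole
  -- path restricts to both.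
  let u : unitInterval → unitInterval := fun s => ⟨s / 2, by
    constructor <;> [have := s.2.1; have := s.2.2] <;> linarith⟩
  let v : unitInterval → unitInterval := fun s => ⟨(s + 1) / 2, by
    constructor <;> [have := s.2.1; have := s.2.2] <;> linarith⟩
  have hu : Continuous u := by fun_prop
  have hv : Continuous v := by fun_prop
  have h1 : (γ.trans γ') ∘ u = γ := by
    funext s
    have hs : (s : ℝ) / 2 ≤ 1 / 2 := by have := s.2.2; linarith
    simp only [Function.comp_apply, Path.trans_apply, u, hs, dif_pos]
    congr 1
    ext
    push_cast
    ring
  have h2 : (γ.trans γ') ∘ v = γ' := by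
    funext s
    -- The midpoint belongs to the first branch of `Path.trans`, so `s = 0` has to be read through
    -- the end of the first half.
    by_cases hs : ((s : ℝ) + 1) / 2 ≤ 1 / 2
    · have hs0 : s = 0 := by
        have h0 := s.2.1
        refine Subtype.ext (le_antisymm ?_ h0)
        change (s : ℝ) ≤ 0
        linarith
      subst hs0
      have hv0 : v 0 = u 1 := by ext; simp [u, v]
      rw [Function.comp_apply, hv0, ← Function.comp_apply (f := γ.trans γ') (g := u), h1]
      simp
    · simp only [Function.comp_apply, Path.trans_apply, v, hs, dif_neg, not_false_eq_true]
      congr 1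
      ext
      simp
      ring
  have k1 := h.comp hu
  have k2 := h.comp hv
  rw [h1] at k1
  rw [h2] at k2
  rw [h.hol_eq, k1.hol_eq, k2.hol_eq]
  have e1 : u 0 = 0 := by ext; simp [u]
  have e2 : u 1 = v 0 := by ext; simp [u, v]
  have e3 : v 1 = 1 := by ext; simp [v]
  simp only [Function.comp_apply, e1, e2, e3]
  group

/-- A parallel section exists over the whole square of the homotopy. It is constant on the two sides
where the homotopy is fixed, so the other two sides have equal transport. -/
theorem hol_congr {a b : X} {γ γ' : Path a b} (h : γ.Homotopic γ') : B.hol γ = B.hol γ' := by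
  obtain ⟨H⟩ := h
  obtain ⟨g, hg, -⟩ := B.exists_isParallel (f := H) H.continuous (0, 0) 1
  have h0 : B.IsParallel γ (fun s => g (0, s)) := by
    have := hg.comp (u := fun s : unitInterval => ((0 : unitInterval), s)) (by fun_prop)
    rwa [show (H ∘ fun s : unitInterval => ((0 : unitInterval), s)) = γ from by
      funext s; simp] at this
  have h1 : B.IsParallel γ' (fun s => g (1, s)) := by
    have := hg.comp (u := fun s : unitInterval => ((1 : unitInterval), s)) (by fun_prop)
    rwa [show (H ∘ fun s : unitInterval => ((1 : unitInterval), s)) = γ' from by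
      funext s; simp] at this
  have l0 : B.IsParallel (fun _ : unitInterval => a) (fun s => g (s, 0)) := by
    have := hg.comp (u := fun s : unitInterval => (s, (0 : unitInterval))) (by fun_prop)
    rwa [show (H ∘ fun s : unitInterval => (s, (0 : unitInterval))) = fun _ => a from by
      funext s; simp] at this
  have l1 : B.IsParallel (fun _ : unitInterval => b) (fun s => g (s, 1)) := by
    have := hg.comp (u := fun s : unitInterval => (s, (1 : unitInterval))) (by fun_prop)
    rwa [show (H ∘ fun s : unitInterval => (s, (1 : unitInterval))) = fun _ => b from by
      funext s; simp] at this
  have c0 := l0.mul_inv_eq continuous_const (isParallel_const a 1) 0 1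
  have c1 := l1.mul_inv_eq continuous_const (isParallel_const b 1) 0 1
  simp only [inv_one, mul_one, mul_inv_eq_one] at c0 c1
  rw [h0.hol_eq, h1.hol_eq, c0, c1]

/-- The holonomy representation of the fundamental group. -/
def holHom (P : X) : FundamentalGroup X P →* G where
  toFun := Quotient.lift (fun γ : Path P P => B.hol γ) fun _ _ h => B.hol_congr h
  map_one' := B.hol_refl P
  map_mul' := by
    rintro ⟨p⟩ ⟨q⟩
    exact B.hol_trans q p

theorem holHom_fromPath {P : X} (γ : Path P P) :
    B.holHom P (FundamentalGroup.fromPath (Path.Homotopic.Quotient.mk γ)) = B.hol γ := rfl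

theorem mem_range_holHom {P : X} {g : G} :
    g ∈ (B.holHom P).range ↔ ∃ γ : Path P P, B.hol γ = g := by
  constructor
  · rintro ⟨⟨γ⟩, rfl⟩
    exact ⟨γ, rfl⟩
  · rintro ⟨γ, rfl⟩
    exact ⟨FundamentalGroup.fromPath (Path.Homotopic.Quotient.mk γ), rfl⟩

end FlatSystem

end

section

/-! ### Slit planes -/

/-- The plane without the horizontal rays from the points `b i` in the direction `ε = ±1`. -/
def slit {ι : Type*} (ε : ℝ) (b : ι → ℂ) : Set ℂ :=
  {z | ∀ i, z.im = (b i).im → ε * z.re < ε * (b i).re}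

section Slit

variable {ι : Type*} [Finite ι] {ε : ℝ} {b : ι → ℂ}

theorem isOpen_slit : IsOpen (slit ε b) := by
  have : slit ε b = ⋂ i, {z : ℂ | z.im = (b i).im → ε * z.re < ε * (b i).re} := by
    ext z
    simp [slit]
  rw [this]
  refine isOpen_iInter_of_finite fun i => ?_
  simp only [imp_iff_not_or, Set.ofPred_or]
  refine IsOpen.union ?_ ?_
  · exact isOpen_ne_fun Complex.continuous_im continuous_const
  · exact isOpen_lt (by fun_prop) (by fun_prop)

/-- Points are pushed horizontally, away from the removed rays, into a half-plane free of slits.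
Such a push never leaves the slit plane because the height is unchanged and `ε * re` decreases. The
half-plane is then contracted linearly to a point. -/
theorem contractibleSpace_slit (hε : ε = 1 ∨ ε = -1) : ContractibleSpace (slit ε b) := by
  obtain ⟨M, hM0, hM⟩ : ∃ M : ℝ, 0 < M ∧ ∀ i, ‖b i‖ < M := by
    obtain ⟨M, hM⟩ := (Set.finite_range fun i => ‖b i‖).bddAbove
    exact ⟨max M 0 + 1, by positivity, fun i => lt_of_le_of_lt (hM ⟨i, rfl⟩)
      (lt_of_le_of_lt (le_max_left M 0) (lt_add_one _))⟩
  have hεε : ε * ε = 1 := by rcases hε with h | h <;> simp [h]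
  have hre : ∀ z : ℂ, ε * z.re ≤ ‖z‖ ∧ -‖z‖ ≤ ε * z.re := by
    intro z
    have h1 := Complex.abs_re_le_norm z
    rw [abs_le] at h1
    rcases hε with h | h <;> constructor <;> simp only [h] <;> linarith
  have hhalf : ∀ z : ℂ, ε * z.re ≤ -M → z ∈ slit ε b := fun z hz i _ =>
    lt_of_le_of_lt hz (by linarith [(hre (b i)).2, hM i])
  have hpush : ∀ z ∈ slit ε b, ∀ s : ℝ, 0 ≤ s →
      z - ((ε * (s * (‖z‖ + M)) : ℝ) : ℂ) ∈ slit ε b := by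
    intro z hz s hs i hi
    have h2 : 0 ≤ s * (‖z‖ + M) := by positivity
    simp only [Complex.sub_re, Complex.ofReal_re, Complex.sub_im, Complex.ofReal_im, sub_zero]
      at hi ⊢
    have := hz i hi
    rw [mul_sub, ← mul_assoc, hεε]
    linarith
  have hfar : ∀ z : ℂ, ε * (z - ((ε * (‖z‖ + M) : ℝ) : ℂ)).re ≤ -M := by
    intro z
    simp only [Complex.sub_re, Complex.ofReal_re]
    rw [mul_sub, ← mul_assoc, hεε]
    linarith [(hre z).1]
  let r : C(slit ε b, slit ε b) :=
    ⟨fun z => ⟨z - ((ε * (‖(z : ℂ)‖ + M) : ℝ) : ℂ), hhalf _ (hfar z)⟩, by fun_prop⟩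
  have hend : ε * (((-(ε * M) : ℝ) : ℂ)).re ≤ -M := by
    rw [Complex.ofReal_re, mul_neg, ← mul_assoc, hεε, one_mul]
  rw [contractible_iff_id_nullhomotopic]
  refine ⟨⟨((-(ε * M) : ℝ) : ℂ), hhalf _ hend⟩, ContinuousMap.Homotopic.trans (g := r) ?_ ?_⟩
  · refine ⟨⟨⟨fun p => ⟨p.2 - ((ε * (p.1 * (‖(p.2 : ℂ)‖ + M)) : ℝ) : ℂ),
      hpush _ p.2.2 _ p.1.2.1⟩, by fun_prop⟩, ?_, ?_⟩⟩
    · intro z; ext; simp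
    · intro z; ext; simp [r]
  · refine ⟨⟨⟨fun p => ⟨((1 - (p.1 : ℝ) : ℝ) : ℂ) * (r p.2 : ℂ)
      + ((p.1 : ℝ) : ℂ) * ((-(ε * M) : ℝ) : ℂ), hhalf _ ?_⟩, by fun_prop⟩, ?_, ?_⟩⟩
    · rw [Complex.add_re, Complex.re_ofReal_mul, Complex.re_ofReal_mul]
      have h1 := hfar p.2
      have h2 := p.1.2.1
      have h3 := p.1.2.2
      change ε * ((1 - (p.1 : ℝ)) * ((p.2 : ℂ) - ((ε * (‖(p.2 : ℂ)‖ + M) : ℝ) : ℂ)).re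
        + (p.1 : ℝ) * _) ≤ -M
      nlinarith [mul_le_mul_of_nonneg_left h1 (sub_nonneg.2 h3),
        mul_le_mul_of_nonneg_left hend h2]
    · intro z; ext; simp
    · intro z; ext; simp

theorem locallyPathConnectedSpace_slit : LocallyPathConnectedSpace (slit ε b) :=
  isOpen_slit.locallyPathConnectedSpace

end Slit

/-! ### The complement of three points -/

/-- The three points `0, 1, c` are the `v * b i`, and the heights of the `b i` increase. -/
structure Slicing (c v : ℂ) (b : Fin 3 → ℂ) : Prop where
  ne_zero : v ≠ 0
  mem_iff : ∀ q : ℂ, q = 0 ∨ q = 1 ∨ q = c ↔ ∃ i, q = v * b i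
  strictMono : StrictMono fun i => (b i).im

/-- Each coincidence of two heights excludes at most one slope `τ` of the direction `v = 1 + τ i`,
so some `τ` avoids them all. The base point is kept off the three lines so that it lies in a strip,
where the left frame can be normalised. -/
theorem exists_slicing {c : ℂ} (hc0 : c ≠ 0) (hc1 : c ≠ 1) (P : Leaf c) :
    ∃ v b, Slicing c v b ∧ ∀ i, ((P : ℂ) / v).im ≠ (b i).im := by
  have key : ∀ d : ℂ, d ≠ 0 → {τ : ℝ | (d / (1 + τ * Complex.I)).im = 0}.Finite := by
    intro d hd
    refine Set.Subsingleton.finite ?_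
    have him : ∀ τ : ℝ, (d / (1 + τ * Complex.I)).im = 0 → d.im = τ * d.re := by
      intro τ h
      have hv : (1 + τ * Complex.I : ℂ) ≠ 0 := by
        intro h0
        have := congrArg Complex.re h0
        simp at this
      have h1 : d = ((d / (1 + τ * Complex.I)).re : ℂ) * (1 + τ * Complex.I) := by
        conv_lhs => rw [← div_mul_cancel₀ d hv]
        congr 1
        apply Complex.ext <;> simp [h]
      have h2 := congrArg Complex.re h1
      have h3 := congrArg Complex.im h1
      rw [Complex.re_ofReal_mul] at h2
      rw [Complex.im_ofReal_mul] at h3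
      simp at h2 h3
      rw [h3, h2]
      ring
    intro τ h τ' h'
    have e1 := him τ h
    have e2 := him τ' h'
    have hre : d.re ≠ 0 := by
      intro h0
      apply hd
      apply Complex.ext
      · simpa using h0
      · rw [e1, h0]; simp
    exact mul_right_cancel₀ hre (e1.symm.trans e2)
  -- The six differences are those between two of `0, 1, c` and those between `P` and each of `0, 1,
  -- c`.
  have hbad := ((((key _ (one_ne_zero (α := ℂ))).union (key _ hc0)).union
    (key _ (sub_ne_zero.2 hc1))).union (key _ P.2.1)).union
    ((key _ (sub_ne_zero.2 P.2.2.1)).union (key _ (sub_ne_zero.2 P.2.2.2)))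
  obtain ⟨τ, hτ⟩ := hbad.exists_notMem
  simp only [Set.mem_union, Set.mem_ofPred_eq, not_or] at hτ
  obtain ⟨⟨⟨⟨h1, hc⟩, hc1'⟩, hP⟩, hP1, hPc⟩ := hτ
  set v : ℂ := 1 + τ * Complex.I with hv
  have hv0 : v ≠ 0 := by
    intro h0
    have := congrArg Complex.re h0
    simp [hv] at this
  let b' : Fin 3 → ℂ := ![0, 1 / v, c / v]
  have hinj : Function.Injective fun i => (b' i).im := by
    rw [sub_div, Complex.sub_im, sub_eq_zero] at hc1'
    intro i j hij
    fin_cases i <;> fin_cases j <;> simp_all [b', eq_comm]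
  let σ := Tuple.sort fun i => (b' i).im
  refine ⟨v, b' ∘ σ, ⟨hv0, ?_, ?_⟩, ?_⟩
  · intro q
    have : (∃ i, q = v * (b' ∘ σ) i) ↔ ∃ i, q = v * b' i :=
      σ.surjective.exists (p := fun i => q = v * b' i) |>.symm
    rw [this, Fin.exists_fin_succ, Fin.exists_fin_succ, Fin.exists_fin_succ]
    simp [b', mul_div_cancel₀ _ hv0, mul_inv_cancel₀ hv0]
  · exact (Tuple.monotone_sort fun i => (b' i).im).strictMono_of_injective
      (hinj.comp σ.injective)
  · intro i
    rw [sub_div, Complex.sub_im, sub_eq_zero] at hP1 hPc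
    change _ ≠ (b' (σ i)).im
    generalize σ i = j
    fin_cases j <;> simp_all [b']

namespace Slicing

variable {c v : ℂ} {b : Fin 3 → ℂ} (hs : Slicing c v b)

theorem leaf_of_ne (hs : Slicing c v b) {z : ℂ} (hz : ∀ i, z ≠ b i) : v * z ≠ 0 ∧ v * z ≠ 1 ∧ v * z ≠ c := by
  have h := (hs.mem_iff (v * z)).not
  simp only [not_or] at h
  rw [h]
  rintro ⟨i, hi⟩
  exact hz i (mul_left_cancel₀ hs.ne_zero hi)

/-- The point of the leaf with rotated coordinate `z`. -/
def toLeaf (z : ℂ) (hz : ∀ i, z ≠ b i) : Leaf c := ⟨v * z, hs.leaf_of_ne hz⟩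

end Slicing

end

/-! ### Strips, and parallel frames over the two slit planes. -/

section

/-- The `k`-th of the strips cut out by the horizontal lines through the points `b i`. -/
def strip (b : Fin 3 → ℂ) (k : ℕ) : Set ℂ :=
  {z | ∀ i : Fin 3, ((i : ℕ) < k → (b i).im < z.im) ∧ (k ≤ i → z.im < (b i).im)}

theorem convex_strip (b : Fin 3 → ℂ) (k : ℕ) : Convex ℝ (strip b k) := by
  have : strip b k = ⋂ i : Fin 3, ({z : ℂ | (i : ℕ) < k → (b i).im < z.im} ∩
      {z : ℂ | k ≤ i → z.im < (b i).im}) := by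
    ext z
    simp [strip]
  rw [this]
  refine convex_iInter fun i => Convex.inter ?_ ?_
  · by_cases h : (i : ℕ) < k
    · simpa [h] using convex_halfSpace_im_gt _
    · simp [h, convex_univ]
  · by_cases h : k ≤ (i : ℕ)
    · simpa [h] using convex_halfSpace_im_lt _
    · simp [h, convex_univ]

theorem ne_of_mem_slit {ι : Type*} {ε : ℝ} {b : ι → ℂ} {z : ℂ} (hz : z ∈ slit ε b) (i : ι) :
    z ≠ b i := by
  rintro rfl
  exact lt_irrefl _ (hz i rfl)

theorem strip_subset_slit {ε : ℝ} {b : Fin 3 → ℂ} {k : ℕ} : strip b k ⊆ slit ε b := by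
  intro z hz i hi
  rcases lt_or_ge (i : ℕ) k with h | h
  · exact absurd hi ((hz i).1 h).ne'
  · exact absurd hi ((hz i).2 h).ne

namespace Slicing

variable {c v : ℂ} {b : Fin 3 → ℂ} (hs : Slicing c v b)

/-- The inclusion of a slit plane into the leaf. -/
def slitMap (ε : ℝ) (z : slit ε b) : Leaf c := hs.toLeaf z (ne_of_mem_slit z.2)

theorem continuous_slitMap (ε : ℝ) : Continuous (hs.slitMap ε) := by
  unfold slitMap toLeaf
  fun_prop

theorem exists_mem_strip (hs : Slicing c v b) {z : ℂ} (hz : ∀ i, z.im ≠ (b i).im) :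
    ∃ k ≤ 3, z ∈ strip b k := by
  have h01 : (b 0).im < (b 1).im := hs.strictMono (by decide)
  have h12 : (b 1).im < (b 2).im := hs.strictMono (by decide)
  have h0 := hz 0
  have h1 := hz 1
  have h2 := hz 2
  rcases h0.lt_or_gt with h0 | h0
  · exact ⟨0, by norm_num, fun i => by fin_cases i <;> simp <;> linarith⟩
  rcases h1.lt_or_gt with h1 | h1
  · exact ⟨1, by norm_num, fun i => by fin_cases i <;> simp <;> linarith⟩
  rcases h2.lt_or_gt with h2 | h2
  · exact ⟨2, by norm_num, fun i => by fin_cases i <;> simp <;> linarith⟩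
  · exact ⟨3, by norm_num, fun i => by fin_cases i <;> simp <;> linarith⟩

theorem div_ne (hs : Slicing c v b) (q : Leaf c) (i : Fin 3) : (q : ℂ) / v ≠ b i := by
  intro h
  have h1 : (q : ℂ) = v * b i := by rw [← h, mul_div_cancel₀ _ hs.ne_zero]
  rcases (hs.mem_iff q).2 ⟨i, h1⟩ with h | h | h
  · exact q.2.1 h
  · exact q.2.2.1 h
  · exact q.2.2.2 h

/-- A point missing from both planes lies on a ray going right and on a ray going left. The heights
of the punctures are distinct, so both rays start at the same puncture, and the point is that
puncture. -/
theorem mem_slit_or (hs : Slicing c v b) (q : Leaf c) :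
    (q : ℂ) / v ∈ slit 1 b ∨ (q : ℂ) / v ∈ slit (-1) b := by
  by_contra! h
  simp only [slit, Set.mem_ofPred_eq, not_forall, one_mul, neg_mul, neg_lt_neg_iff, not_lt] at h
  obtain ⟨⟨i, hi, hi'⟩, j, hj, hj'⟩ := h
  have hij : i = j := hs.strictMono.injective (hi.symm.trans hj)
  subst hij
  exact hs.div_ne q i (Complex.ext (le_antisymm hj' hi') hi)

theorem slitMap_div (q : Leaf c) {ε : ℝ} (h : (q : ℂ) / v ∈ slit ε b) :
    hs.slitMap ε ⟨(q : ℂ) / v, h⟩ = q :=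
  Subtype.ext (mul_div_cancel₀ _ hs.ne_zero)

end Slicing

/-- Parallel sections over two slit planes, and their transition constants on the strips. -/
structure Frame {c v : ℂ} {b : Fin 3 → ℂ} (hs : Slicing c v b) {G : Type*} [Group G]
    (B : FlatSystem (Leaf c) G) (P : Leaf c) where
  SL : slit 1 b → G
  SR : slit (-1) b → G
  parL : B.IsParallel (hs.slitMap 1) SL
  parR : B.IsParallel (hs.slitMap (-1)) SR
  C : ℕ → G
  C_zero : C 0 = 1
  C_spec : ∀ k, ∀ z (h : z ∈ strip b k),
    (SR ⟨z, strip_subset_slit h⟩)⁻¹ * SL ⟨z, strip_subset_slit h⟩ = C k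
  height : ∀ i, ((P : ℂ) / v).im ≠ (b i).im
  base : ∀ h, SL ⟨(P : ℂ) / v, h⟩ = 1

section Frame

variable {c v : ℂ} {b : Fin 3 → ℂ} (hs : Slicing c v b) {G : Type*} [Group G]
  (B : FlatSystem (Leaf c) G) (P : Leaf c)

/-- Each slit plane carries a parallel section because it is simply connected, and on each strip the
quotient of the two sections is constant because the strip is connected. -/
theorem nonempty_frame (hP : ∀ i, ((P : ℂ) / v).im ≠ (b i).im) : Nonempty (Frame hs B P) := by
  have := contractibleSpace_slit (b := b) (ε := 1) (Or.inl rfl)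
  have := contractibleSpace_slit (b := b) (ε := -1) (Or.inr rfl)
  have := locallyPathConnectedSpace_slit (b := b) (ε := 1)
  have := locallyPathConnectedSpace_slit (b := b) (ε := -1)
  obtain ⟨k₀, -, hk₀⟩ := hs.exists_mem_strip hP
  obtain ⟨SL, hL, hL0⟩ := B.exists_isParallel (hs.continuous_slitMap 1)
    ⟨(P : ℂ) / v, strip_subset_slit hk₀⟩ 1
  obtain ⟨SR, hR, -⟩ := B.exists_isParallel (hs.continuous_slitMap (-1))
    ⟨(P : ℂ) / v, strip_subset_slit hk₀⟩ 1
  have hC : ∀ k, ∃ C : G, ∀ z (h : z ∈ strip b k),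
      (SR ⟨z, strip_subset_slit h⟩)⁻¹ * SL ⟨z, strip_subset_slit h⟩ = C := by
    intro k
    by_cases hne : (strip b k).Nonempty
    · obtain ⟨w, hw⟩ := hne
      refine ⟨(SR ⟨w, strip_subset_slit hw⟩)⁻¹ * SL ⟨w, strip_subset_slit hw⟩, fun z hz => ?_⟩
      have hpc : PreconnectedSpace (strip b k) :=
        Subtype.preconnectedSpace (convex_strip b k).isPreconnected
      let iL : strip b k → slit 1 b := fun z => ⟨z, strip_subset_slit z.2⟩
      let iR : strip b k → slit (-1) b := fun z => ⟨z, strip_subset_slit z.2⟩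
      have hiL : Continuous iL := by fun_prop
      have hiR : Continuous iR := by fun_prop
      exact (hR.comp hiR).inv_mul_eq ((hs.continuous_slitMap _).comp hiR) (hL.comp hiL)
        ⟨z, hz⟩ ⟨w, hw⟩
    -- The strips are in fact never empty; a dummy value avoids proving it.
    · exact ⟨1, fun z hz => absurd ⟨z, hz⟩ hne⟩
  choose C hC using hC
  -- The right section is multiplied by the first transition constant, which makes the new constant
  -- on strip `0` equal to one.
  refine ⟨⟨SL, fun z => SR z * C 0, hL, hR.mul_const _, fun k => (C 0)⁻¹ * C k, by simp, ?_, hP,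
    fun _ => hL0⟩⟩
  intro k z hz
  rw [← hC k z hz]
  group

namespace Frame

variable {hs B P} (F : Frame hs B P)

/-- The holonomies around the three points, in the frame. -/
def J (k : ℕ) : G := (F.C (k + 1))⁻¹ * F.C k

/-- The group generated by the holonomies around the three points, in the frame. -/
def group : Subgroup G := Subgroup.closure (Set.range fun i : Fin 3 => F.J i)

open scoped Classical in
/-- The frame as a function on the leaf. -/
def sigma (q : Leaf c) : G :=
  if h : (q : ℂ) / v ∈ slit 1 b then F.SL ⟨_, h⟩
  else if h : (q : ℂ) / v ∈ slit (-1) b then F.SR ⟨_, h⟩ else 1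

theorem J_mem (i : Fin 3) : F.J i ∈ F.group := Subgroup.subset_closure ⟨i, rfl⟩

theorem C_mem : ∀ k ≤ 3, F.C k ∈ F.group := by
  intro k
  induction k with
  | zero => intro _; rw [F.C_zero]; exact one_mem _
  | succ k ih =>
    intro hk
    have h1 := F.J_mem ⟨k, by omega⟩
    have h2 : F.C (k + 1) = F.C k * (F.J k)⁻¹ := by simp [J]
    rw [h2]
    exact mul_mem (ih (by omega)) (inv_mem h1)

theorem sigma_left (q : Leaf c) (h : (q : ℂ) / v ∈ slit 1 b) : F.sigma q = F.SL ⟨_, h⟩ := by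
  rw [sigma, dif_pos h]

/-- On the overlap `sigma` follows the left frame, which differs from the right one by some `C k`, a
product of inverses of the `J i`. -/
theorem sigma_right (q : Leaf c) (h : (q : ℂ) / v ∈ slit (-1) b) :
    (F.SR ⟨_, h⟩)⁻¹ * F.sigma q ∈ F.group := by
  by_cases h1 : (q : ℂ) / v ∈ slit 1 b
  · obtain ⟨k, hk3, hk⟩ := hs.exists_mem_strip (z := (q : ℂ) / v) (fun i hi => by
      have e1 := h1 i hi
      have e2 := h i hi
      linarith)
    rw [F.sigma_left q h1, F.C_spec k _ hk]
    exact F.C_mem k hk3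
  · rw [sigma, dif_neg h1, dif_pos h, inv_mul_cancel]
    exact one_mem _

theorem sigma_base : F.sigma P = 1 := by
  obtain ⟨k, -, hk⟩ := hs.exists_mem_strip F.height
  rw [F.sigma_left P (strip_subset_slit hk), F.base]

/-- Modulo `F.group` the two frames coincide, so `sigma` behaves as a parallel section as soon as
one passes to cosets; `S` stands for either frame. -/
theorem eventually_coset {A : Type*} [TopologicalSpace A] {f : A → Leaf c} (hf : Continuous f)
    {g : A → G} (hg : B.IsParallel f g) {ε : ℝ} {S : slit ε b → G}
    (hS : B.IsParallel (hs.slitMap ε) S)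
    (hSσ : ∀ (q : Leaf c) (h : (q : ℂ) / v ∈ slit ε b), (S ⟨_, h⟩)⁻¹ * F.sigma q ∈ F.group)
    {a₀ : A} (ha₀ : (f a₀ : ℂ) / v ∈ slit ε b) :
    ∀ᶠ a in 𝓝 a₀, (((g a)⁻¹ * F.sigma (f a) : G) : G ⧸ F.group)
      = ((g a₀)⁻¹ * F.sigma (f a₀) : G) := by
  let A₀ : Set A := {a | (f a : ℂ) / v ∈ slit ε b}
  have hA₀ : IsOpen A₀ := isOpen_slit.preimage (by fun_prop)
  let m : A₀ → slit ε b := fun a => ⟨(f a : ℂ) / v, a.2⟩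
  have hm : Continuous m := by fun_prop
  have h1 : B.IsParallel (f ∘ (Subtype.val : A₀ → A)) (S ∘ m) := by
    have := hS.comp hm
    rwa [show hs.slitMap ε ∘ m = f ∘ Subtype.val from funext fun a => hs.slitMap_div _ a.2] at this
  have h2 := (hg.comp (u := (Subtype.val : A₀ → A)) continuous_subtype_val).eventually_inv_mul
    (hf.comp continuous_subtype_val) h1 ⟨a₀, ha₀⟩
  rw [← hA₀.isOpenEmbedding_subtypeVal.map_nhds_eq ⟨a₀, ha₀⟩, eventually_map]
  have key : ∀ a : A₀, (((g a)⁻¹ * F.sigma (f a) : G) : G ⧸ F.group)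
      = ((g a)⁻¹ * S (m a) : G) := by
    intro a
    rw [eq_comm, QuotientGroup.eq]
    have := hSσ (f a) a.2
    convert! this using 1
    simp [m, mul_assoc]
  filter_upwards [h2] with a ha
  rw [key a, key ⟨a₀, ha₀⟩]
  exact congrArg _ ha

/-- The coset of `g⁻¹ * sigma` is locally constant near every point, since the two slit planes cover
the leaf. This replaces van Kampen's theorem. -/
theorem coset {A : Type*} [TopologicalSpace A] [PreconnectedSpace A] {f : A → Leaf c}
    (hf : Continuous f) {g : A → G} (hg : B.IsParallel f g) (x y : A) :
    ((g x)⁻¹ * F.sigma (f x))⁻¹ * ((g y)⁻¹ * F.sigma (f y)) ∈ F.group := by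
  rw [← QuotientGroup.eq]
  refine ((IsLocallyConstant.iff_eventually_eq
    (fun a => (((g a)⁻¹ * F.sigma (f a) : G) : G ⧸ F.group))).2 fun a₀ => ?_)
    |>.apply_eq_of_preconnectedSpace x y
  rcases hs.mem_slit_or (f a₀) with h | h
  · refine F.eventually_coset hf hg F.parL (fun q h => ?_) h
    rw [F.sigma_left q h, inv_mul_cancel]
    exact one_mem _
  · exact F.eventually_coset hf hg F.parR F.sigma_right h

theorem hol_mem {Q : Leaf c} (δ : Path P Q) : (B.hol δ)⁻¹ * F.sigma Q ∈ F.group := by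
  have h := F.coset δ.continuous (B.along_spec δ) 0 1
  rw [δ.source, δ.target, F.sigma_base] at h
  convert! h using 1
  simp [FlatSystem.hol, mul_assoc]

/-- This is the generation statement: no holonomy escapes the group of the three jumps, because
`sigma` takes the same value at both ends of a loop. -/
theorem hol_loop_mem (γ : Path P P) : B.hol γ ∈ F.group := by
  have := F.hol_mem γ
  rwa [F.sigma_base, mul_one, inv_mem_iff] at this

end Frame

end Frame

end

section

/-! ### Circles -/

/-- The parametrised circle with centre `o` and radius `R`. -/
def circ (o : ℂ) (R θ : ℝ) : ℂ := o + R * Complex.exp (θ * Complex.I)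

theorem circ_re (o : ℂ) (R θ : ℝ) : (circ o R θ).re = o.re + R * Real.cos θ := by
  simp [circ, Complex.exp_ofReal_mul_I_re]

theorem circ_im (o : ℂ) (R θ : ℝ) : (circ o R θ).im = o.im + R * Real.sin θ := by
  simp [circ, Complex.exp_ofReal_mul_I_im]

theorem continuous_circ (o : ℂ) (R : ℝ) : Continuous (circ o R) := by
  unfold circ
  fun_prop

theorem circ_add_two_pi (o : ℂ) (R θ : ℝ) : circ o R (θ + 2 * Real.pi) = circ o R θ := by
  apply Complex.ext <;> simp [circ_re, circ_im]

/-- The circle crosses the slit planes in the standard way, from strip `i` below to strip `j`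
above. -/
structure Crosses (b : Fin 3 → ℂ) (o : ℂ) (R : ℝ) (i j : ℕ) : Prop where
  ne : ∀ θ k, circ o R θ ≠ b k
  right : ∀ θ ∈ Set.Icc (-(Real.pi / 2)) (Real.pi / 2), circ o R θ ∈ slit (-1) b
  left : ∀ θ ∈ Set.Icc (Real.pi / 2) (3 * Real.pi / 2), circ o R θ ∈ slit 1 b
  bottom : circ o R (-(Real.pi / 2)) ∈ strip b i
  top : circ o R (Real.pi / 2) ∈ strip b j

section

variable {c v : ℂ} {b : Fin 3 → ℂ} {hs : Slicing c v b}

/-- The radius is below the gaps between heights, so the circle meets only the horizontal line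
through its own centre, and does so at the angles `0` and `π`. -/
theorem crosses_small (hs : Slicing c v b) {i : Fin 3} {R : ℝ} (hR : 0 < R)
    (hgap : ∀ j, j ≠ i → R < |(b j).im - (b i).im|) : Crosses b (b i) R i (i + 1) := by
  have him : ∀ θ j, (circ (b i) R θ).im = (b j).im → j = i ∧ Real.sin θ = 0 := by
    intro θ j h
    rw [circ_im] at h
    have hj : j = i := by
      by_contra hne
      have h1 := hgap j hne
      rw [← h, add_sub_cancel_left, abs_mul, abs_of_pos hR] at h1
      nlinarith [Real.abs_sin_le_one θ]
    subst hj
    exact ⟨rfl, by nlinarith⟩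
  have hone : ∀ θ, Real.sin θ = 0 → Real.cos θ ^ 2 = 1 := by
    intro θ h
    have := Real.sin_sq_add_cos_sq θ
    rw [h] at this
    linarith
  have hmono : ∀ {j k : Fin 3}, j < k → (b j).im < (b k).im := fun h => hs.strictMono h
  refine ⟨?_, ?_, ?_, ?_, ?_⟩
  · intro θ k h
    obtain ⟨rfl, h2⟩ := him θ k (congrArg _ h)
    have h3 := congrArg Complex.re h
    rw [circ_re] at h3
    have h4 := hone θ h2
    have : Real.cos θ = 0 := by nlinarith
    rw [this] at h4
    norm_num at h4
  · intro θ hθ k hk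
    obtain ⟨rfl, h2⟩ := him θ k hk
    have h4 := hone θ h2
    have h5 := Real.cos_nonneg_of_mem_Icc hθ
    have h6 : Real.cos θ = 1 := by nlinarith
    rw [circ_re, h6]
    linarith
  · intro θ hθ k hk
    obtain ⟨rfl, h2⟩ := him θ k hk
    have h4 := hone θ h2
    have h5 : Real.cos θ ≤ 0 := Real.cos_nonpos_of_pi_div_two_le_of_le hθ.1 (by linarith [hθ.2])
    have h6 : Real.cos θ = -1 := by nlinarith
    rw [circ_re, h6]
    linarith
  · intro j
    rw [circ_im, Real.sin_neg, Real.sin_pi_div_two]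
    refine ⟨fun h => ?_, fun h => ?_⟩
    · have h1 : j < i := h
      have h2 := hgap j h1.ne
      rw [abs_of_neg (by linarith [hmono h1])] at h2
      linarith
    · rcases (Fin.le_def.2 h : i ≤ j).eq_or_lt with h1 | h1
      · subst h1; linarith
      · linarith [hmono h1]
  · intro j
    rw [circ_im, Real.sin_pi_div_two]
    refine ⟨fun h => ?_, fun h => ?_⟩
    · rcases (Fin.le_def.2 (Nat.lt_succ_iff.1 h) : j ≤ i).eq_or_lt with h1 | h1
      · subst h1; linarith
      · linarith [hmono h1]
    · have h1 : i < j := h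
      have h2 := hgap j h1.ne'
      rw [abs_of_pos (by linarith [hmono h1])] at h2
      linarith

/-- At the height of `b j` a point of the circle has larger `|re|` than `b j`, since its norm is
larger. The sign of the cosine tells which slit plane it lies in. -/
theorem crosses_large {R : ℝ} (hb : ∀ j, ‖b j‖ < R) : Crosses b 0 R 0 3 := by
  have hR : 0 < R := (norm_nonneg _).trans_lt (hb 0)
  have hre : ∀ θ j, (circ 0 R θ).im = (b j).im → |(b j).re| < |R * Real.cos θ| := by
    intro θ j h
    rw [← sq_lt_sq]
    rw [circ_im, Complex.zero_im, zero_add] at h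
    have h1 := hb j
    have h2 : ‖b j‖ ^ 2 < R ^ 2 := by
      have := norm_nonneg (b j)
      nlinarith
    rw [Complex.sq_norm, Complex.normSq_apply, ← h] at h2
    nlinarith [Real.sin_sq_add_cos_sq θ]
  have himb : ∀ j, |(b j).im| < R := fun j => (Complex.abs_im_le_norm _).trans_lt (hb j)
  refine ⟨?_, ?_, ?_, ?_, ?_⟩
  · intro θ k h
    have h1 := hb k
    rw [← h, circ, zero_add, norm_mul, Complex.norm_exp_ofReal_mul_I, Complex.norm_real,
      Real.norm_of_nonneg hR.le, mul_one] at h1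
    exact lt_irrefl _ h1
  · intro θ hθ k hk
    have h1 := hre θ k hk
    have h5 := Real.cos_nonneg_of_mem_Icc hθ
    rw [abs_of_nonneg (by positivity : 0 ≤ R * Real.cos θ)] at h1
    rw [circ_re, Complex.zero_re]
    linarith [le_abs_self (b k).re]
  · intro θ hθ k hk
    have h1 := hre θ k hk
    have h5 : Real.cos θ ≤ 0 := Real.cos_nonpos_of_pi_div_two_le_of_le hθ.1 (by linarith [hθ.2])
    rw [abs_of_nonpos (by nlinarith : R * Real.cos θ ≤ 0)] at h1
    rw [circ_re, Complex.zero_re]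
    linarith [neg_abs_le (b k).re]
  · intro j
    rw [circ_im, Real.sin_neg, Real.sin_pi_div_two, Complex.zero_im]
    refine ⟨fun h => absurd h (by omega), fun _ => ?_⟩
    linarith [neg_abs_le (b j).im, himb j]
  · intro j
    rw [circ_im, Real.sin_pi_div_two, Complex.zero_im]
    refine ⟨fun _ => ?_, fun h => absurd h (by omega)⟩
    linarith [le_abs_self (b j).im, himb j]

namespace Frame

variable {G : Type*} [Group G] {B : FlatSystem (Leaf c) G} {P : Leaf c} (F : Frame hs B P)

/-- Along the right half circle `h` is compared with the right frame, along the left half with the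
left frame. The two comparisons meet in strip `j` at the top and in strip `i` at the bottom, so the
defect `μ` of `h` after a turn is expressed by the transition constants there. -/
theorem circle {o : ℂ} {R : ℝ} {i j : ℕ} (hX : Crosses b o R i j) {h : ℝ → G}
    (hpar : B.IsParallel (fun θ => hs.toLeaf (circ o R θ) (hX.ne θ)) h) {μ : G}
    (hμ : h (3 * Real.pi / 2) = h (-(Real.pi / 2)) * μ) :
    ∃ k, (F.C j)⁻¹ * F.C i = k * μ * k⁻¹ ∧
      h (Real.pi / 2) = F.SL ⟨circ o R (Real.pi / 2), strip_subset_slit hX.top⟩ * k := by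
  have hpi := Real.pi_pos
  have hcont : Continuous fun θ => hs.toLeaf (circ o R θ) (hX.ne θ) := by
    unfold Slicing.toLeaf
    have := continuous_circ o R
    fun_prop
  have hcL : PreconnectedSpace (Set.Icc (Real.pi / 2) (3 * Real.pi / 2)) :=
    Subtype.preconnectedSpace isPreconnected_Icc
  have hcR : PreconnectedSpace (Set.Icc (-(Real.pi / 2)) (Real.pi / 2)) :=
    Subtype.preconnectedSpace isPreconnected_Icc
  let mL : Set.Icc (Real.pi / 2) (3 * Real.pi / 2) → slit 1 b :=
    fun θ => ⟨circ o R θ, hX.left θ θ.2⟩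
  let mR : Set.Icc (-(Real.pi / 2)) (Real.pi / 2) → slit (-1) b :=
    fun θ => ⟨circ o R θ, hX.right θ θ.2⟩
  have hmL : Continuous mL :=
    ((continuous_circ o R).comp continuous_subtype_val).subtype_mk _
  have hmR : Continuous mR :=
    ((continuous_circ o R).comp continuous_subtype_val).subtype_mk _
  have eL := (F.parL.comp hmL).inv_mul_eq ((hs.continuous_slitMap 1).comp hmL)
    (hpar.comp (u := (Subtype.val : Set.Icc (Real.pi / 2) (3 * Real.pi / 2) → ℝ))
      continuous_subtype_val)
    ⟨Real.pi / 2, by constructor <;> linarith⟩ ⟨3 * Real.pi / 2, by constructor <;> linarith⟩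
  have eR := (F.parR.comp hmR).inv_mul_eq ((hs.continuous_slitMap (-1)).comp hmR)
    (hpar.comp (u := (Subtype.val : Set.Icc (-(Real.pi / 2)) (Real.pi / 2) → ℝ))
      continuous_subtype_val)
    ⟨Real.pi / 2, by constructor <;> linarith⟩ ⟨-(Real.pi / 2), by constructor <;> linarith⟩
  have hbot : circ o R (3 * Real.pi / 2) = circ o R (-(Real.pi / 2)) := by
    rw [← circ_add_two_pi o R (-(Real.pi / 2))]
    congr 1
    ring
  have sT := F.C_spec j _ hX.top
  have sB := F.C_spec i _ hX.bottom
  simp only [Function.comp_apply, mL, mR, hbot, hμ] at eL eR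
  set tL := F.SL ⟨circ o R (Real.pi / 2), strip_subset_slit hX.top⟩
  set tR := F.SR ⟨circ o R (Real.pi / 2), strip_subset_slit hX.top⟩
  set bL := F.SL ⟨circ o R (-(Real.pi / 2)), strip_subset_slit hX.bottom⟩
  set bR := F.SR ⟨circ o R (-(Real.pi / 2)), strip_subset_slit hX.bottom⟩
  refine ⟨tL⁻¹ * h (Real.pi / 2), ?_, by group⟩
  rw [← sT, ← sB]
  -- `e1` transports along the right arc, `e2` along the left arc followed by the turn; `tL, tR, bL,
  -- bR` are the frame values at top and bottom.
  have e1 : h (Real.pi / 2) = tR * (bR⁻¹ * h (-(Real.pi / 2))) := by rw [← eR]; group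
  have e2 : bL = h (-(Real.pi / 2)) * μ * (tL⁻¹ * h (Real.pi / 2))⁻¹ := by rw [eL]; group
  rw [e2, e1]
  group

end Frame

end

/-! ### Logarithmic coordinates near the punctures -/

/-- The half-plane `{ζ}` whose image under `ζ ↦ p + exp ζ` is the largest punctured disc around
`p` which contains no other of the points `0, 1, c`. -/
def discDomain (c p : ℂ) : Set ℂ :=
  {ζ | ∀ x ∈ ({0, 1, c} : Set ℂ), x ≠ p → Real.exp ζ.re < dist x p}

/-- A half-plane whose image under `exp` is a neighbourhood of infinity without `1` and `c`. -/
def outerDomain (c : ℂ) : Set ℂ := {ζ | 1 + ‖c‖ < Real.exp ζ.re}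

theorem convex_discDomain (c p : ℂ) : Convex ℝ (discDomain c p) := by
  intro x hx y hy s t hs ht hst a ha hap
  have h1 := hx a ha hap
  have h2 := hy a ha hap
  refine lt_of_le_of_lt (Real.exp_le_exp.2 (?_ : _ ≤ max x.re y.re)) ?_
  · simp only [Complex.add_re, Complex.real_smul, Complex.re_ofReal_mul]
    calc s * x.re + t * y.re ≤ s * max x.re y.re + t * max x.re y.re := by
          gcongr
          exacts [le_max_left _ _, le_max_right _ _]
      _ = max x.re y.re := by rw [← add_mul, hst, one_mul]
  · rcases max_choice x.re y.re with h | h <;> rw [h] <;> assumption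

theorem convex_outerDomain (c : ℂ) : Convex ℝ (outerDomain c) := by
  intro x hx y hy s t hs ht hst
  simp only [outerDomain, Set.mem_ofPred_eq] at hx hy ⊢
  refine lt_of_lt_of_le ?_ (Real.exp_le_exp.2 (?_ : min x.re y.re ≤ _))
  · rcases min_choice x.re y.re with h | h <;> rw [h] <;> assumption
  · simp only [Complex.add_re, Complex.real_smul, Complex.re_ofReal_mul]
    calc min x.re y.re = s * min x.re y.re + t * min x.re y.re := by rw [← add_mul, hst, one_mul]
      _ ≤ s * x.re + t * y.re := by
          gcongr
          exacts [min_le_left _ _, min_le_right _ _]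

/-- The universal covering of a punctured disc around `p`. -/
def discMap {c p : ℂ} (hp : p ∈ ({0, 1, c} : Set ℂ)) (ζ : discDomain c p) : Leaf c :=
  ⟨p + Complex.exp ζ, by
    have key : ∀ x ∈ ({0, 1, c} : Set ℂ), p + Complex.exp ζ ≠ x := by
      intro x hx h
      by_cases hxp : x = p
      · subst hxp
        simp at h
      · have h1 := ζ.2 x hx hxp
        rw [← h, dist_eq_norm, add_sub_cancel_left, Complex.norm_exp] at h1
        exact lt_irrefl _ h1
    exact ⟨key 0 (by simp), key 1 (by simp), key c (by simp)⟩⟩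

/-- The universal covering of a punctured disc around infinity. -/
def outerMap {c : ℂ} (ζ : outerDomain c) : Leaf c :=
  ⟨Complex.exp ζ, Complex.exp_ne_zero _, by
    have h : 1 + ‖c‖ < ‖Complex.exp ζ‖ := by rw [Complex.norm_exp]; exact ζ.2
    constructor
    · intro h1
      rw [h1, norm_one] at h
      linarith [norm_nonneg c]
    · intro h1
      rw [h1] at h
      linarith⟩

theorem continuous_discMap {c p : ℂ} (hp : p ∈ ({0, 1, c} : Set ℂ)) :
    Continuous (discMap hp) := by
  unfold discMap
  fun_prop

theorem continuous_outerMap {c : ℂ} : Continuous (outerMap (c := c)) := by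
  unfold outerMap
  fun_prop

/-- Parallel sections near the puncture `p` are invariant under two turns. -/
def DiscInvolutive {c p : ℂ} {G : Type*} [Group G] (B : FlatSystem (Leaf c) G)
    (hp : p ∈ ({0, 1, c} : Set ℂ)) : Prop :=
  ∀ g : discDomain c p → G, B.IsParallel (discMap hp) g →
    ∀ ζ ζ' : discDomain c p, (ζ' : ℂ) = ζ + 4 * Real.pi * Complex.I → g ζ' = g ζ

/-- Parallel sections near infinity are invariant under two turns. -/
def OuterInvolutive {c : ℂ} {G : Type*} [Group G] (B : FlatSystem (Leaf c) G) : Prop :=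
  ∀ g : outerDomain c → G, B.IsParallel outerMap g →
    ∀ ζ ζ' : outerDomain c, (ζ' : ℂ) = ζ + 4 * Real.pi * Complex.I → g ζ' = g ζ

/-- The section and its translate by `τ` are parallel along the same map, hence differ by a constant
right factor. This `μ` is the monodromy. -/
theorem FlatSystem.IsParallel.exists_deck {X G : Type*} [TopologicalSpace X] [Group G]
    {B : FlatSystem X G} {D : Set ℂ} (hD : IsPreconnected D) {τ : ℂ} (hτ : ∀ ζ ∈ D, ζ + τ ∈ D)
    {f : D → X} (hf : Continuous f) (hfτ : ∀ ζ : D, f ⟨ζ + τ, hτ ζ ζ.2⟩ = f ζ) {g : D → G}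
    (hg : B.IsParallel f g) : ∃ μ, ∀ ζ ζ' : D, (ζ' : ℂ) = ζ + τ → g ζ' = g ζ * μ := by
  have : PreconnectedSpace D := Subtype.preconnectedSpace hD
  rcases isEmpty_or_nonempty D with h | ⟨⟨ζ₀⟩⟩
  · exact ⟨1, fun ζ => h.elim ζ⟩
  let m : D → D := fun ζ => ⟨ζ + τ, hτ ζ ζ.2⟩
  have hm : Continuous m := by fun_prop
  have h1 : B.IsParallel f (g ∘ m) := by
    have := hg.comp hm
    rwa [show f ∘ m = f from funext hfτ] at this
  refine ⟨(g ζ₀)⁻¹ * g (m ζ₀), fun ζ ζ' h => ?_⟩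
  have h2 := hg.inv_mul_eq hf h1 ζ₀ ζ
  simp only [Function.comp_apply] at h2
  rw [h2, show ζ' = m ζ from Subtype.ext h]
  simp

theorem discDomain_add {c p : ℂ} (n : ℤ) (ζ : ℂ) (h : ζ ∈ discDomain c p) :
    ζ + n * (2 * Real.pi * Complex.I) ∈ discDomain c p := by
  intro x hx hxp
  have : (ζ + n * (2 * Real.pi * Complex.I)).re = ζ.re := by simp
  rw [this]
  exact h x hx hxp

theorem outerDomain_add {c : ℂ} (n : ℤ) (ζ : ℂ) (h : ζ ∈ outerDomain c) :
    ζ + n * (2 * Real.pi * Complex.I) ∈ outerDomain c := by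
  have : (ζ + n * (2 * Real.pi * Complex.I)).re = ζ.re := by simp
  rw [outerDomain, Set.mem_ofPred_eq, this]
  exact h

theorem DiscInvolutive.exists_deck {c p : ℂ} {G : Type*} [Group G] {B : FlatSystem (Leaf c) G}
    {hp : p ∈ ({0, 1, c} : Set ℂ)} (H : DiscInvolutive B hp) {g : discDomain c p → G}
    (hg : B.IsParallel (discMap hp) g) (ζ₀ : discDomain c p) :
    ∃ μ, μ * μ = 1 ∧ ∀ ζ ζ' : discDomain c p, (ζ' : ℂ) = ζ + 2 * Real.pi * Complex.I →
      g ζ' = g ζ * μ := by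
  have hτ : ∀ ζ ∈ discDomain c p, ζ + 2 * Real.pi * Complex.I ∈ discDomain c p := fun ζ h => by
    simpa using discDomain_add 1 ζ h
  obtain ⟨μ, hμ⟩ := hg.exists_deck (convex_discDomain c p).isPreconnected hτ
    (continuous_discMap hp) fun ζ => Subtype.ext (by
      simp only [discMap, Complex.exp_add, Complex.exp_two_pi_mul_I, mul_one])
  refine ⟨μ, ?_, hμ⟩
  have h1 := hμ ζ₀ ⟨_, hτ _ ζ₀.2⟩ rfl
  have h2 := hμ ⟨_, hτ _ ζ₀.2⟩ ⟨_, hτ _ (hτ _ ζ₀.2)⟩ rfl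
  have h3 := H g hg ζ₀ ⟨_, hτ _ (hτ _ ζ₀.2)⟩ (by push_cast; ring)
  rw [h3, h1, mul_assoc] at h2
  exact left_eq_mul.1 h2

theorem OuterInvolutive.exists_deck {c : ℂ} {G : Type*} [Group G] {B : FlatSystem (Leaf c) G}
    (H : OuterInvolutive B) {g : outerDomain c → G}
    (hg : B.IsParallel outerMap g) (ζ₀ : outerDomain c) :
    ∃ μ, μ * μ = 1 ∧ ∀ ζ ζ' : outerDomain c, (ζ' : ℂ) = ζ + 2 * Real.pi * Complex.I →
      g ζ' = g ζ * μ := by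
  have hτ : ∀ ζ ∈ outerDomain c, ζ + 2 * Real.pi * Complex.I ∈ outerDomain c := fun ζ h => by
    simpa using outerDomain_add 1 ζ h
  obtain ⟨μ, hμ⟩ := hg.exists_deck (convex_outerDomain c).isPreconnected hτ
    continuous_outerMap fun ζ => Subtype.ext (by
      simp only [outerMap, Complex.exp_add, Complex.exp_two_pi_mul_I, mul_one])
  refine ⟨μ, ?_, hμ⟩
  have h1 := hμ ζ₀ ⟨_, hτ _ ζ₀.2⟩ rfl
  have h2 := hμ ⟨_, hτ _ ζ₀.2⟩ ⟨_, hτ _ (hτ _ ζ₀.2)⟩ rfl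
  have h3 := H g hg ζ₀ ⟨_, hτ _ (hτ _ ζ₀.2)⟩ (by push_cast; ring)
  rw [h3, h1, mul_assoc] at h2
  exact left_eq_mul.1 h2

end

section

/-! ### Groups generated by four involutions with product one -/

/-- Conjugates of three involutions whose product is an involution: the products of two of them lie
in a commutative subgroup. -/
theorem exists_commutative_of_involutions {G : Type*} [Group G] {a b d : G}
    (ha : a * a = 1) (hb : b * b = 1) (hd : d * d = 1) (hdba : (d * b * a) * (d * b * a) = 1) :
    ∃ N : Subgroup G, (∀ x ∈ N, ∀ y ∈ N, x * y = y * x) ∧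
      ∀ x ∈ Subgroup.closure {a, b, d}, ∀ y ∈ Subgroup.closure {a, b, d},
        ∀ s ∈ ({a, b, d} : Set G), ∀ t ∈ ({a, b, d} : Set G),
        (x * s * x⁻¹) * (y * t * y⁻¹) ∈ N := by
  have ia : a⁻¹ = a := inv_eq_of_mul_eq_one_left ha
  have ib : b⁻¹ = b := inv_eq_of_mul_eq_one_left hb
  have id : d⁻¹ = d := inv_eq_of_mul_eq_one_left hd
  -- An involutive product of involutions equals the same product read backwards.
  have hrev : a * b * d = d * b * a := by
    have := inv_eq_of_mul_eq_one_left hdba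
    rw [mul_inv_rev, mul_inv_rev, ia, ib, id, ← mul_assoc] at this
    exact this
  have ca : ∀ x, a * (a * x) = x := fun x => by rw [← mul_assoc, ha, one_mul]
  have cb : ∀ x, b * (b * x) = x := fun x => by rw [← mul_assoc, hb, one_mul]
  have cd : ∀ x, d * (d * x) = x := fun x => by rw [← mul_assoc, hd, one_mul]
  -- `T = a b` and `U = b d` play the role of the two basic translations of the pillowcase group.
  have hTU : (a * b) * (b * d) = (b * d) * (a * b) := by
    have e1 := congrArg (fun x => d * x * d) hrev
    simp only [mul_assoc, cd, hd, mul_one] at e1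
    simp only [mul_assoc, cb]
    rw [e1, cb]
  let N := Subgroup.closure ({a * b, b * d} : Set G)
  have hT_mem : a * b ∈ N := Subgroup.subset_closure (by simp)
  have hU_mem : b * d ∈ N := Subgroup.subset_closure (by simp)
  have hcomm : ∀ x ∈ N, ∀ y ∈ N, x * y = y * x := by
    have hc : ∀ x ∈ ({a * b, b * d} : Set G), ∀ y ∈ ({a * b, b * d} : Set G), x * y = y * x := by
      rintro x (rfl | rfl) y (rfl | rfl)
      exacts [rfl, hTU, hTU.symm, rfl]
    intro x hx y hy
    have h1 : N ≤ Subgroup.centralizer N :=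
      Subgroup.closure_le_centralizer_centralizer _ |>.trans (Subgroup.centralizer_le (by
        rw [SetLike.coe_subset_coe, Subgroup.closure_le]
        exact fun z hz => Subgroup.mem_centralizer_iff.2 fun w hw => hc w hw z hz))
    exact (Subgroup.mem_centralizer_iff.1 (h1 hx) y hy).symm
  -- Conjugation by `a` inverts `a b` and `b d`; since inversion is a homomorphism on a commutative
  -- group, it inverts all of `N`.
  have hconj : ∀ x ∈ N, a * (x * a) = x⁻¹ := by
    intro x hx
    induction hx using Subgroup.closure_induction with
    | mem x hx =>
      rcases hx with rfl | rfl
      · rw [mul_assoc a, ca, mul_inv_rev, ia, ib]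
      · rw [← mul_assoc, ← mul_assoc, hrev, mul_assoc, ha, mul_one, mul_inv_rev, ib, id]
    | one => simp [ha]
    | mul x y hx hy ihx ihy =>
      rw [mul_inv_rev, hcomm _ (inv_mem hy) _ (inv_mem hx), ← ihx, ← ihy]
      simp only [mul_assoc, ca]
    | inv x hx ih =>
      have := congrArg (fun y => y⁻¹) ih
      simp only [mul_inv_rev, ia, mul_assoc] at this
      exact this
  have hodd : ∀ s ∈ ({a, b, d} : Set G), a * s ∈ N := by
    rintro s (rfl | rfl | rfl)
    · rw [ha]; exact one_mem _
    · exact hT_mem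
    · have := mul_mem hT_mem hU_mem
      rwa [mul_assoc, cb] at this
  -- The group is the union of `N` and `a N`, as for translations and point reflections.
  have hsplit : ∀ x ∈ Subgroup.closure ({a, b, d} : Set G), x ∈ N ∨ a * x ∈ N := by
    have hoo : ∀ x y, a * x ∈ N → a * y ∈ N → x * y ∈ N := by
      intro x y hx hy
      have := mul_mem (inv_mem hx) hy
      rw [← hconj _ hx] at this
      simpa only [mul_assoc, ca] using this
    have hev : ∀ x y, x ∈ N → a * y ∈ N → a * (x * y) ∈ N := by
      intro x y hx hy
      have := mul_mem (inv_mem hx) hy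
      rw [← hconj _ hx] at this
      simpa only [mul_assoc, ca] using this
    intro x hx
    induction hx using Subgroup.closure_induction with
    | mem x hx => exact Or.inr (hodd x hx)
    | one => exact Or.inl (one_mem _)
    | mul x y _ _ ihx ihy =>
      rcases ihx with hx | hx <;> rcases ihy with hy | hy
      · exact Or.inl (mul_mem hx hy)
      · exact Or.inr (hev x y hx hy)
      · refine Or.inr ?_
        rw [← mul_assoc]
        exact mul_mem hx hy
      · exact Or.inl (hoo x y hx hy)
    | inv x _ ih =>
      rcases ih with hx | hx
      · exact Or.inl (inv_mem hx)
      · refine Or.inr ?_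
        have := hconj _ hx
        simp only [mul_assoc, ca] at this
        have h2 : a * x⁻¹ = a * x := by
          have h3 : x * a = (a * x)⁻¹ := this
          rw [mul_inv_rev, ia] at h3
          rw [← mul_right_cancel h3]
        rw [h2]
        exact hx
  -- Every conjugate of a generator is a reflection, that is, lies in `a N`; the product of two
  -- reflections is a translation.
  have hco : ∀ x ∈ Subgroup.closure ({a, b, d} : Set G), ∀ s ∈ ({a, b, d} : Set G),
      a * (x * s * x⁻¹) ∈ N := by
    intro x hx s hs
    have hs' := hodd s hs
    rcases hsplit x hx with h | h
    · have := mul_mem (mul_mem (inv_mem h) hs') (inv_mem h)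
      nth_rewrite 1 [← hconj _ h] at this
      simpa only [mul_assoc, ca] using this
    · have h5 : x⁻¹ = (a * x)⁻¹ * a := by simp
      have h6 := hconj _ (mul_mem hs' (inv_mem h))
      have h7 := mul_mem h (inv_mem (mul_mem hs' (inv_mem h)))
      rw [← h6] at h7
      rw [h5]
      simpa only [mul_assoc, ca] using h7
  refine ⟨N, hcomm, fun x hx y hy s hs t ht => ?_⟩
  have h1 := hco x hx s hs
  have h2 := mul_mem (inv_mem h1) (hco y hy t ht)
  rw [← hconj _ h1] at h2
  simpa only [mul_assoc, ca] using h2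

/-- In a group generated by three involutions, pairwise products of which commute, the even words
form a commutative normal subgroup of index at most two. -/
theorem exists_subgroup_even_words {G : Type*} [Group G] {R N : Subgroup G} {h : Fin 3 → G}
    (hR : Subgroup.closure (Set.range h) = R) (hsq : ∀ i, h i * h i = 1)
    (hcomm : ∀ x ∈ N, ∀ y ∈ N, x * y = y * x) (hN : ∀ i j, h i * h j ∈ N) :
    ∃ N' : Subgroup R, (∀ g : R, g ∈ N' ↔ IsEvenWord h (g : G)) ∧
      N'.Normal ∧ (∀ a ∈ N', ∀ b ∈ N', a * b = b * a) ∧ N'.index ≠ 0 ∧ N'.index ≤ 2 := by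
  have hinv : ∀ w : List (Fin 3), ((w.map h).prod)⁻¹ = (w.reverse.map h).prod := by
    intro w
    induction w with
    | nil => simp
    | cons i w ih =>
      simp only [List.map_cons, List.prod_cons, mul_inv_rev, List.reverse_cons, List.map_append,
        List.prod_append, ih, List.map_nil, List.prod_nil, mul_one]
      rw [inv_eq_of_mul_eq_one_left (hsq i)]
  have hword : ∀ g ∈ R, ∃ w : List (Fin 3), g = (w.map h).prod := by
    intro g hg
    rw [← hR] at hg
    induction hg using Subgroup.closure_induction with
    | mem x hx =>
      obtain ⟨i, rfl⟩ := hx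
      exact ⟨[i], by simp⟩
    | one => exact ⟨[], by simp⟩
    | mul x y _ _ ihx ihy =>
      obtain ⟨w, rfl⟩ := ihx
      obtain ⟨w', rfl⟩ := ihy
      exact ⟨w ++ w', by simp⟩
    | inv x _ ih =>
      obtain ⟨w, rfl⟩ := ih
      exact ⟨w.reverse, hinv w⟩
  -- The letters of an even word are grouped in consecutive pairs, each pair lying in `N`.
  have hmem : ∀ n : ℕ, ∀ w : List (Fin 3), w.length = n + n → (w.map h).prod ∈ N := by
    intro n
    induction n with
    | zero =>
      intro w hw
      rw [List.eq_nil_of_length_eq_zero hw]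
      simp
    | succ n ih =>
      intro w hw
      match w, hw with
      | [i], hw => simp at hw; omega
      | i :: j :: w, hw =>
        simp only [List.length_cons] at hw
        have h1 := mul_mem (hN i j) (ih w (by omega))
        simpa only [List.map_cons, List.prod_cons, mul_assoc] using h1
  let N' : Subgroup R :=
    { carrier := {g | IsEvenWord h (g : G)}
      one_mem' := ⟨[], by simp, by simp⟩
      mul_mem' := by
        rintro x y ⟨w, hw, hx⟩ ⟨w', hw', hy⟩
        refine ⟨w ++ w', by simpa using hw.add hw', ?_⟩
        rw [Subgroup.coe_mul, hx, hy]
        simp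
      inv_mem' := by
        rintro x ⟨w, hw, hx⟩
        refine ⟨w.reverse, by simpa using hw, ?_⟩
        rw [Subgroup.coe_inv, hx, hinv] }
  have hiff : ∀ g : R, g ∈ N' ↔ IsEvenWord h (g : G) := fun g => Iff.rfl
  have hcommN' : ∀ a ∈ N', ∀ b ∈ N', a * b = b * a := by
    rintro a ⟨w, ⟨n, hn⟩, ha⟩ b ⟨w', ⟨n', hn'⟩, hb⟩
    refine Subtype.ext ?_
    rw [Subgroup.coe_mul, Subgroup.coe_mul, ha, hb]
    exact hcomm _ (hmem n w hn) _ (hmem n' w' hn')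
  -- An element may be represented by both even and odd words, so index one is possible. If some
  -- element is not even, the product of two non-even elements is represented by an even word.
  have hindex : N'.index = 1 ∨ N'.index = 2 := by
    by_cases hall : ∀ g : R, g ∈ N'
    · left
      rw [Subgroup.index_eq_one]
      exact (Subgroup.eq_top_iff' N').2 hall
    · right
      push Not at hall
      obtain ⟨a, ha⟩ := hall
      obtain ⟨u, hu⟩ := hword a a.2
      have hu' : ¬ Even u.length := fun h => ha ⟨u, h, hu⟩
      refine Subgroup.index_eq_two_iff.2 ⟨a, fun x => ?_⟩
      by_cases hx : x ∈ N'
      · exact Or.inr ⟨hx, fun h => ha ((mul_mem_cancel_left hx).1 h)⟩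
      · refine Or.inl ⟨?_, hx⟩
        obtain ⟨w, hw⟩ := hword x x.2
        have hw' : ¬ Even w.length := fun h => hx ⟨w, h, hw⟩
        refine ⟨w ++ u, ?_, ?_⟩
        · rw [List.length_append, Nat.even_add]
          tauto
        · rw [Subgroup.coe_mul, hw, hu]
          simp
  refine ⟨N', hiff, ⟨fun n hn g => ?_⟩, hcommN', ?_, ?_⟩
  · obtain ⟨w, hw, hx⟩ := hn
    obtain ⟨u, hu⟩ := hword g g.2
    refine ⟨u ++ w ++ u.reverse, ?_, ?_⟩
    · simp only [List.length_append, List.length_reverse]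
      rw [Nat.even_iff] at hw ⊢
      omega
    · rw [Subgroup.coe_mul, Subgroup.coe_mul, Subgroup.coe_inv, hx, hu, hinv]
      simp [mul_assoc]
  · rcases hindex with h | h <;> rw [h] <;> norm_num
  · rcases hindex with h | h <;> rw [h]
    norm_num

end

/-! ### Monodromy at the punctures and generation of the holonomy group. -/

section

section

variable {c v : ℂ} {b : Fin 3 → ℂ} {hs : Slicing c v b}

theorem Slicing.mem (hs : Slicing c v b) (i : Fin 3) : v * b i ∈ ({0, 1, c} : Set ℂ) := by
  simpa using (hs.mem_iff (v * b i)).2 ⟨i, rfl⟩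

theorem Slicing.eq_of_mem (hs : Slicing c v b) {x : ℂ} (hx : x ∈ ({0, 1, c} : Set ℂ)) :
    ∃ i, x = v * b i :=
  (hs.mem_iff x).1 (by simpa using hx)

theorem exp_log_mul_circ (hs : Slicing c v b) {o : ℂ} {R : ℝ} (hR : 0 < R) (θ : ℝ) :
    v * o + Complex.exp (Complex.log (v * R) + θ * Complex.I) = v * circ o R θ := by
  rw [Complex.exp_add, Complex.exp_log
    (mul_ne_zero hs.ne_zero (Complex.ofReal_ne_zero.2 hR.ne')), circ]
  ring

theorem exp_re_log_mul_circ (hs : Slicing c v b) {R : ℝ} (hR : 0 < R) (θ : ℝ) :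
    Real.exp (Complex.log (v * R) + θ * Complex.I).re = ‖v‖ * R := by
  rw [← Complex.norm_exp, Complex.exp_add, Complex.exp_log
    (mul_ne_zero hs.ne_zero (Complex.ofReal_ne_zero.2 hR.ne'))]
  rw [norm_mul, norm_mul, Complex.norm_exp_ofReal_mul_I, Complex.norm_real,
    Real.norm_of_nonneg hR.le, mul_one]

theorem exists_small_radius (hs : Slicing c v b) (i : Fin 3) :
    ∃ R : ℝ, 0 < R ∧ (∀ j, j ≠ i → R < |(b j).im - (b i).im|) ∧
      ∀ x ∈ ({0, 1, c} : Set ℂ), x ≠ v * b i → ‖v‖ * R < dist x (v * b i) := by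
  have h1 : ∀ᶠ R : ℝ in 𝓝[>] 0, ∀ j, j ≠ i → R < |(b j).im - (b i).im| := by
    rw [eventually_all]
    intro j
    by_cases hj : j = i
    · exact Eventually.of_forall fun R h => absurd hj h
    · have : 0 < |(b j).im - (b i).im| :=
        abs_pos.2 (sub_ne_zero.2 fun h => hj (hs.strictMono.injective h))
      filter_upwards [Ioo_mem_nhdsGT this] with R hR _ using hR.2
  obtain ⟨R, hR, hR0⟩ := (h1.and self_mem_nhdsWithin).exists
  refine ⟨R, hR0, hR, fun x hx hxi => ?_⟩
  obtain ⟨j, rfl⟩ := hs.eq_of_mem hx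
  have hj : j ≠ i := fun h => hxi (by rw [h])
  rw [dist_eq_norm, ← mul_sub, norm_mul]
  refine mul_lt_mul_of_pos_left ?_ (norm_pos_iff.2 hs.ne_zero)
  refine (hR j hj).trans_le ?_
  rw [← Complex.sub_im]
  exact Complex.abs_im_le_norm _

end

namespace Frame

variable {c v : ℂ} {b : Fin 3 → ℂ} {hs : Slicing c v b} {G : Type*} [Group G]
  {B : FlatSystem (Leaf c) G} {P : Leaf c} (F : Frame hs B P)

/-- Near the `i`-th point, a parallel section in logarithmic coordinates has monodromy conjugate
to `F.J i`, and it agrees with the frame up to the conjugating element. -/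
theorem exists_disc_section (i : Fin 3) (H : DiscInvolutive B (hs.mem i)) :
    ∃ (R : ℝ) (hX : Crosses b (b i) R i (i + 1)) (g : discDomain c (v * b i) → G) (μ k : G),
      0 < R ∧ (∀ x ∈ ({0, 1, c} : Set ℂ), x ≠ v * b i → ‖v‖ * R < dist x (v * b i)) ∧
      B.IsParallel (discMap (hs.mem i)) g ∧ μ * μ = 1 ∧
      (∀ ζ ζ' : discDomain c (v * b i), (ζ' : ℂ) = ζ + 2 * Real.pi * Complex.I →
        g ζ' = g ζ * μ) ∧ F.J i = k * μ * k⁻¹ ∧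
      ∀ ζ : discDomain c (v * b i),
        (ζ : ℂ) = Complex.log (v * R) + ((Real.pi / 2 : ℝ) : ℂ) * Complex.I →
        g ζ = F.SL ⟨circ (b i) R (Real.pi / 2), strip_subset_slit hX.top⟩ * k := by
  obtain ⟨R, hR, hgap, hdist⟩ := exists_small_radius hs i
  have hX := crosses_small hs hR hgap
  have hmem : ∀ θ : ℝ, Complex.log (v * R) + θ * Complex.I ∈ discDomain c (v * b i) := by
    intro θ x hx hxi
    rw [exp_re_log_mul_circ hs hR]
    exact hdist x hx hxi
  -- `exp` maps this vertical line onto a circle of radius `‖v‖ * R`; the term `log (v * R)` absorbs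
  -- the rotation of the coordinate by `v`.
  let u : ℝ → discDomain c (v * b i) := fun θ => ⟨Complex.log (v * R) + θ * Complex.I, hmem θ⟩
  have hu : Continuous u := by fun_prop
  have hc : ContractibleSpace (discDomain c (v * b i)) :=
    (convex_discDomain _ _).contractibleSpace ⟨_, hmem 0⟩
  have hl : LocallyPathConnectedSpace (discDomain c (v * b i)) :=
    (convex_discDomain _ _).locallyPathConnectedSpace
  obtain ⟨g, hg, -⟩ := B.exists_isParallel (continuous_discMap (hs.mem i)) (u 0) 1
  obtain ⟨μ, hμ1, hμ⟩ := H.exists_deck hg (u 0)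
  have hpar : B.IsParallel (fun θ => hs.toLeaf (circ (b i) R θ) (hX.ne θ)) (g ∘ u) := by
    have := hg.comp hu
    rwa [show discMap (hs.mem i) ∘ u = fun θ => hs.toLeaf (circ (b i) R θ) (hX.ne θ) from
      funext fun θ => Subtype.ext (exp_log_mul_circ hs hR θ)] at this
  obtain ⟨k, hk, hk'⟩ := F.circle hX hpar (μ := μ) (hμ _ _ (by
    simp only [u]
    push_cast
    ring))
  refine ⟨R, hX, g, μ, k, hR, hdist, hg, hμ1, hμ, hk, fun ζ hζ => ?_⟩
  rw [← hk', show ζ = u (Real.pi / 2) from Subtype.ext hζ]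
  rfl

theorem J_mul_self (i : Fin 3) (H : DiscInvolutive B (hs.mem i)) : F.J i * F.J i = 1 := by
  obtain ⟨R, hX, g, μ, k, -, -, -, hμ, -, hJ, -⟩ := F.exists_disc_section i H
  rw [hJ, show k * μ * k⁻¹ * (k * μ * k⁻¹) = k * (μ * μ) * k⁻¹ by group, hμ]
  group

/-- The product telescopes to `(C 3)⁻¹ * C 0`, which is the jump between the outermost strips and
hence conjugate to the monodromy along a circle enclosing all three punctures. -/
theorem J_product_mul_self (H : OuterInvolutive B) :
    (F.J 2 * F.J 1 * F.J 0) * (F.J 2 * F.J 1 * F.J 0) = 1 := by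
  obtain ⟨M, hM⟩ := (Set.finite_range fun i => ‖b i‖).bddAbove
  -- Large enough to enclose all `b j`, and to make the radius `‖v‖ * R` of the circle in the leaf
  -- exceed `1 + ‖c‖`.
  let R : ℝ := max (M + 1) ((2 + ‖c‖) / ‖v‖)
  have hbR : ∀ j, ‖b j‖ < R := fun j =>
    (hM ⟨j, rfl⟩).trans_lt ((lt_add_one M).trans_le (le_max_left _ _))
  have hR : 0 < R := (norm_nonneg _).trans_lt (hbR 0)
  have hX := crosses_large hbR
  have hmem : ∀ θ : ℝ, Complex.log (v * R) + θ * Complex.I ∈ outerDomain c := by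
    intro θ
    rw [outerDomain, Set.mem_ofPred_eq, exp_re_log_mul_circ hs hR]
    have hv : 0 < ‖v‖ := norm_pos_iff.2 hs.ne_zero
    have h1 : (2 + ‖c‖) / ‖v‖ ≤ R := le_max_right _ _
    rw [div_le_iff₀ hv] at h1
    linarith
  let u : ℝ → outerDomain c := fun θ => ⟨Complex.log (v * R) + θ * Complex.I, hmem θ⟩
  have hu : Continuous u := by fun_prop
  have hc : ContractibleSpace (outerDomain c) :=
    (convex_outerDomain _).contractibleSpace ⟨_, hmem 0⟩
  have hl : LocallyPathConnectedSpace (outerDomain c) :=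
    (convex_outerDomain _).locallyPathConnectedSpace
  obtain ⟨g, hg, -⟩ := B.exists_isParallel continuous_outerMap (u 0) 1
  obtain ⟨μ, hμ1, hμ⟩ := H.exists_deck hg (u 0)
  have hpar : B.IsParallel (fun θ => hs.toLeaf (circ 0 R θ) (hX.ne θ)) (g ∘ u) := by
    have := hg.comp hu
    rwa [show outerMap ∘ u = fun θ => hs.toLeaf (circ 0 R θ) (hX.ne θ) from
      funext fun θ => Subtype.ext (by
        have := exp_log_mul_circ hs (o := 0) hR θ
        rwa [mul_zero, zero_add] at this)] at this
  obtain ⟨k, hk, -⟩ := F.circle hX hpar (μ := μ) (hμ _ _ (by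
    simp only [u]
    push_cast
    ring))
  have hJ : F.J 2 * F.J 1 * F.J 0 = k * μ * k⁻¹ := by
    rw [← hk]
    simp only [J]
    group
  rw [hJ, show k * μ * k⁻¹ * (k * μ * k⁻¹) = k * (μ * μ) * k⁻¹ by group, hμ1]
  group

/-- The tail of the lasso is taken inside the left slit plane. Transport along it is the left frame
itself, which is `1` at `P`, so no conjugating factor is left over. -/
theorem exists_simpleTurn (i : Fin 3) (H : DiscInvolutive B (hs.mem i)) :
    ∃ g : FundamentalGroup (Leaf c) P, IsSimpleTurn (v * b i) g ∧ B.holHom P g = F.J i := by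
  obtain ⟨R, hX, g, μ, k, hR, hdist, hg, -, hμ, hJ, hk⟩ := F.exists_disc_section i H
  have hmem : ∀ θ : ℝ, Complex.log (v * R) + θ * Complex.I ∈ discDomain c (v * b i) := by
    intro θ x hx hxi
    rw [exp_re_log_mul_circ hs hR]
    exact hdist x hx hxi
  let u : ℝ → discDomain c (v * b i) := fun θ => ⟨Complex.log (v * R) + θ * Complex.I, hmem θ⟩
  have hu : Continuous u := by fun_prop
  let Q : Leaf c := hs.slitMap 1 ⟨circ (b i) R (Real.pi / 2), strip_subset_slit hX.top⟩
  have hval : ∀ θ : ℝ, (discMap (hs.mem i) (u θ) : ℂ) = v * circ (b i) R θ :=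
    fun θ => exp_log_mul_circ hs hR θ
  let m : unitInterval → ℝ := fun s => Real.pi / 2 + 2 * Real.pi * s
  have hm : Continuous m := by fun_prop
  have hm1 : m 1 = Real.pi / 2 + 2 * Real.pi := by simp [m]
  have hm0 : m 0 = Real.pi / 2 := by simp [m]
  let σ : Path Q Q :=
    { toFun := fun s => discMap (hs.mem i) (u (m s))
      continuous_toFun := (continuous_discMap _).comp (hu.comp hm)
      source' := Subtype.ext (by rw [hval, hm0]; rfl)
      target' := Subtype.ext (by rw [hval, hm1, circ_add_two_pi]; rfl) }
  have hσp : B.IsParallel σ (g ∘ u ∘ m) := hg.comp (hu.comp hm)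
  have hσ : B.hol σ = g (u (m 1)) * (g (u (m 0)))⁻¹ := hσp.hol_eq
  obtain ⟨k₀, -, hk₀⟩ := hs.exists_mem_strip F.height
  have hcs := contractibleSpace_slit (b := b) (ε := 1) (Or.inl rfl)
  let δ' : Path (⟨(P : ℂ) / v, strip_subset_slit hk₀⟩ : slit 1 b)
      ⟨circ (b i) R (Real.pi / 2), strip_subset_slit hX.top⟩ :=
    PathConnectedSpace.somePath _ _
  let δ : Path P Q := (δ'.map (hs.continuous_slitMap 1)).cast (hs.slitMap_div P _).symm rfl
  have hδ : B.hol δ = F.SL ⟨circ (b i) R (Real.pi / 2), strip_subset_slit hX.top⟩ := by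
    have h1 : B.IsParallel δ (F.SL ∘ δ') := F.parL.comp δ'.continuous
    rw [h1.hol_eq]
    simp only [Function.comp_apply, δ'.source, δ'.target, F.base, inv_one, mul_one]
  refine ⟨FundamentalGroup.fromPath (Path.Homotopic.Quotient.mk ((δ.trans σ).trans δ.symm)),
    -- The turn starts at the top of the circle in the rotated coordinate; multiplication by `v`
    -- scales the radius by `‖v‖` and adds `arg v` to the angle.
    ⟨‖v‖ * R, Complex.arg v + Real.pi / 2, Q, δ, σ, mul_pos (norm_pos_iff.2 hs.ne_zero) hR, hdist,
      fun s => ?_, rfl⟩, ?_⟩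
  · change (discMap (hs.mem i) (u (m s)) : ℂ) = _
    rw [hval, circ]
    have hpolar := Complex.norm_mul_exp_arg_mul_I v
    rw [show ((Complex.arg v + Real.pi / 2 + 2 * Real.pi * (s : ℝ) : ℝ) : ℂ) * Complex.I
      = Complex.arg v * Complex.I + (m s : ℝ) * Complex.I by simp [m]; ring, Complex.exp_add,
      Complex.ofReal_mul]
    linear_combination (-(R : ℂ) * Complex.exp ((m s : ℝ) * Complex.I)) * hpolar
  · rw [B.holHom_fromPath, B.hol_trans, B.hol_trans, B.hol_symm, hσ, hδ,
      hμ (u (m 0)) (u (m 1)) (by simp only [u, hm0, hm1]; push_cast; ring),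
      hk (u (m 0)) (by simp only [u, hm0]), hJ]
    group

/-- The tail and the radius are arbitrary here, so the conjugator cannot be computed; `hol_mem` and
`coset` still place it in `F.group`. This is enough, because products of two conjugates by elements
of that group stay in the commutative subgroup. -/
theorem holHom_of_isSimpleTurn (i : Fin 3) (H : DiscInvolutive B (hs.mem i))
    {g : FundamentalGroup (Leaf c) P} (hg : IsSimpleTurn (v * b i) g) :
    ∃ α ∈ F.group, B.holHom P g = α * F.J i * α⁻¹ := by
  obtain ⟨R, hX, s, μ, k, hR, hdist, hpar, -, hμ, hJ, hk⟩ := F.exists_disc_section i H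
  obtain ⟨r, θ, Q, δ, σ, hr, hrd, hσ, rfl⟩ := hg
  let w : unitInterval → ℂ := fun t =>
    (Real.log r : ℂ) + ((θ + 2 * Real.pi * (t : ℝ) : ℝ) : ℂ) * Complex.I
  have hwre : ∀ t, Real.exp (w t).re = r := fun t => by
    simp only [w, Complex.add_re, Complex.ofReal_re, Complex.re_ofReal_mul, Complex.I_re, mul_zero,
      add_zero, Real.exp_log hr]
  let u : unitInterval → discDomain c (v * b i) :=
    fun t => ⟨w t, fun x hx hxi => (hwre t).symm ▸ hrd x hx hxi⟩
  have hu : Continuous u := by fun_prop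
  have hdσ : ∀ t, discMap (hs.mem i) (u t) = σ t := fun t => Subtype.ext (by
    rw [hσ]
    simp only [discMap, u, w]
    rw [Complex.exp_add, ← Complex.ofReal_exp, Real.exp_log hr])
  have hσh : B.hol σ = s (u 1) * (s (u 0))⁻¹ := by
    have h1 := hpar.comp hu
    rw [show discMap (hs.mem i) ∘ u = σ from funext hdσ] at h1
    exact h1.hol_eq
  have hmem : Complex.log (v * R) + ((Real.pi / 2 : ℝ) : ℂ) * Complex.I
      ∈ discDomain c (v * b i) := by
    intro x hx hxi
    rw [exp_re_log_mul_circ hs hR]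
    exact hdist x hx hxi
  let ζ : discDomain c (v * b i) := ⟨_, hmem⟩
  have hpc : PreconnectedSpace (discDomain c (v * b i)) :=
    Subtype.preconnectedSpace (convex_discDomain _ _).isPreconnected
  have hco := F.coset (continuous_discMap (hs.mem i)) hpar ζ (u 0)
  have hζ : (s ζ)⁻¹ * F.sigma (discMap (hs.mem i) ζ) = k⁻¹ := by
    have hz : (discMap (hs.mem i) ζ : ℂ) / v = circ (b i) R (Real.pi / 2) := by
      rw [div_eq_iff hs.ne_zero]
      exact (exp_log_mul_circ hs hR _).trans (mul_comm _ _)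
    have hsl : (discMap (hs.mem i) ζ : ℂ) / v ∈ slit 1 b := by
      rw [hz]
      exact strip_subset_slit hX.top
    rw [F.sigma_left _ hsl, hk ζ rfl]
    simp only [hz]
    group
  rw [hζ, inv_inv, hdσ 0, σ.source] at hco
  have hβ := F.hol_mem δ
  set α := k * ((s (u 0))⁻¹ * F.sigma Q) with hα
  set β := (B.hol δ)⁻¹ * F.sigma Q with hβ'
  refine ⟨β * α⁻¹, mul_mem hβ (inv_mem hco), ?_⟩
  have hs0 : s (u 0) = F.sigma Q * α⁻¹ * k := by rw [hα]; group
  have hδ : B.hol δ = F.sigma Q * β⁻¹ := by rw [hβ']; group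
  rw [B.holHom_fromPath, B.hol_trans, B.hol_trans, B.hol_symm, hσh,
    hμ (u 0) (u 1) (by simp only [u, w]; push_cast; simp; ring), hJ, hs0, hδ]
  group

end Frame

/-- A flat system on the plane without three points, whose parallel sections are invariant under
two turns around each of these points and around infinity, has virtually commutative holonomy. -/
theorem FlatSystem.holonomy_virtuallyCommutative {c : ℂ} (hc0 : c ≠ 0) (hc1 : c ≠ 1) (P : Leaf c)
    {G : Type*} [Group G] (B : FlatSystem (Leaf c) G)
    (hd : ∀ p (hp : p ∈ ({0, 1, c} : Set ℂ)), DiscInvolutive B hp) (ho : OuterInvolutive B) :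
    VirtuallyCommutative (B.holHom P).range ∧
    (∃ g₀ g₁ g_c : FundamentalGroup (Leaf c) P,
      IsSimpleTurn 0 g₀ ∧ IsSimpleTurn 1 g₁ ∧ IsSimpleTurn c g_c ∧
        Subgroup.closure {B.holHom P g₀, B.holHom P g₁, B.holHom P g_c} = (B.holHom P).range) ∧
    ∀ g₀ g₁ g_c : FundamentalGroup (Leaf c) P,
      IsSimpleTurn 0 g₀ → IsSimpleTurn 1 g₁ → IsSimpleTurn c g_c →
      Subgroup.closure {B.holHom P g₀, B.holHom P g₁, B.holHom P g_c} = (B.holHom P).range →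
      ∃ N : Subgroup (B.holHom P).range,
        (∀ g : (B.holHom P).range, g ∈ N ↔
          IsEvenWord ![B.holHom P g₀, B.holHom P g₁, B.holHom P g_c] (g : G)) ∧
        N.Normal ∧ (∀ a ∈ N, ∀ b ∈ N, a * b = b * a) ∧ N.index ≠ 0 ∧ N.index ≤ 2 := by
  obtain ⟨v, b, hs, hP⟩ := exists_slicing hc0 hc1 P
  obtain ⟨F⟩ := nonempty_frame hs B P hP
  have hJsq : ∀ i : Fin 3, F.J i * F.J i = 1 := fun i => F.J_mul_self i (hd _ _)
  obtain ⟨N, hN, hNJ⟩ := exists_commutative_of_involutions (hJsq 0) (hJsq 1) (hJsq 2)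
    (F.J_product_mul_self ho)
  have hset : Set.range (fun i : Fin 3 => F.J i) =
      {F.J (0 : Fin 3), F.J (1 : Fin 3), F.J (2 : Fin 3)} := by
    ext x
    simp only [Set.mem_range, Fin.exists_fin_succ, Set.mem_insert_iff, Set.mem_singleton_iff,
      eq_comm (b := x)]
    simp
  have hJset : ∀ i : Fin 3, F.J i ∈
      ({F.J (0 : Fin 3), F.J (1 : Fin 3), F.J (2 : Fin 3)} : Set G) := fun i => by
    rw [← hset]
    exact ⟨i, rfl⟩
  rw [← hset] at hNJ
  rw [← hset] at hJset
  have main : ∀ g₀ g₁ g_c : FundamentalGroup (Leaf c) P,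
      IsSimpleTurn 0 g₀ → IsSimpleTurn 1 g₁ → IsSimpleTurn c g_c →
      Subgroup.closure {B.holHom P g₀, B.holHom P g₁, B.holHom P g_c} = (B.holHom P).range →
      ∃ N : Subgroup (B.holHom P).range,
        (∀ g : (B.holHom P).range, g ∈ N ↔
          IsEvenWord ![B.holHom P g₀, B.holHom P g₁, B.holHom P g_c] (g : G)) ∧
        N.Normal ∧ (∀ a ∈ N, ∀ b ∈ N, a * b = b * a) ∧ N.index ≠ 0 ∧ N.index ≤ 2 := by
    intro g₀ g₁ g_c h₀ h₁ h_c hgen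
    have hconj : ∀ i : Fin 3, ∃ α ∈ F.group, ∃ j : Fin 3,
        ![B.holHom P g₀, B.holHom P g₁, B.holHom P g_c] i = α * F.J j * α⁻¹ := by
      -- The punctures are numbered by height, so the index of the jump belonging to `p` is unknown;
      -- it is not needed.
      have aux : ∀ (p : ℂ) (hp : p ∈ ({0, 1, c} : Set ℂ)) (g : FundamentalGroup (Leaf c) P),
          IsSimpleTurn p g → ∃ α ∈ F.group, ∃ j : Fin 3,
            B.holHom P g = α * F.J j * α⁻¹ := by
        intro p hp g hg
        obtain ⟨j, rfl⟩ := hs.eq_of_mem hp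
        obtain ⟨α, hα, h⟩ := F.holHom_of_isSimpleTurn j (hd _ _) hg
        exact ⟨α, hα, j, h⟩
      intro i
      fin_cases i
      · exact aux 0 (by simp) g₀ h₀
      · exact aux 1 (by simp) g₁ h₁
      · exact aux c (by simp) g_c h_c
    refine exists_subgroup_even_words (N := N) ?_ (fun i => ?_) hN (fun i j => ?_)
    · rw [← hgen]
      congr 1
      ext x
      simp only [Set.mem_range, Fin.exists_fin_succ, Set.mem_insert_iff, Set.mem_singleton_iff,
        eq_comm (b := x)]
      simp
    · obtain ⟨α, -, j, h⟩ := hconj i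
      rw [h, show α * F.J j * α⁻¹ * (α * F.J j * α⁻¹) = α * (F.J j * F.J j) * α⁻¹ by group,
        hJsq]
      group
    · obtain ⟨α, hα, k, h⟩ := hconj i
      obtain ⟨β, hβ, l, h'⟩ := hconj j
      rw [h, h']
      exact hNJ α hα β hβ _ (hJset k) _ (hJset l)
  have hex : ∃ g₀ g₁ g_c : FundamentalGroup (Leaf c) P,
      IsSimpleTurn 0 g₀ ∧ IsSimpleTurn 1 g₁ ∧ IsSimpleTurn c g_c ∧
        Subgroup.closure {B.holHom P g₀, B.holHom P g₁, B.holHom P g_c}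
          = (B.holHom P).range := by
    choose t ht ht' using fun i => F.exists_simpleTurn i (hd _ (hs.mem i))
    obtain ⟨i₀, e₀⟩ := hs.eq_of_mem (x := 0) (by simp)
    obtain ⟨i₁, e₁⟩ := hs.eq_of_mem (x := 1) (by simp)
    obtain ⟨i_c, e_c⟩ := hs.eq_of_mem (x := c) (by simp)
    refine ⟨t i₀, t i₁, t i_c, e₀.symm ▸ ht i₀, e₁.symm ▸ ht i₁, ?_, le_antisymm ?_ ?_⟩
    · have := ht i_c
      rwa [← e_c] at this
    · rw [Subgroup.closure_le]
      rintro x (rfl | rfl | rfl) <;> exact ⟨_, rfl⟩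
    · intro x hx
      obtain ⟨γ, rfl⟩ := B.mem_range_holHom.1 hx
      -- The chosen turns have holonomies exactly `J 0, J 1, J 2`, and these already generate every
      -- loop holonomy.
      refine (Subgroup.closure_mono ?_) (F.hol_loop_mem γ)
      rintro _ ⟨i, rfl⟩
      simp only [ht']
      have hi : i = i₀ ∨ i = i₁ ∨ i = i_c := by
        have h01 : i₀ ≠ i₁ := fun h => zero_ne_one (e₀.trans (h ▸ e₁.symm))
        have h0c : i₀ ≠ i_c := fun h => hc0 (e_c.trans (h ▸ e₀.symm))
        have h1c : i₁ ≠ i_c := fun h => hc1 (e_c.trans (h ▸ e₁.symm))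
        omega
      rcases hi with rfl | rfl | rfl <;> simp
  refine ⟨?_, hex, main⟩
  obtain ⟨g₀, g₁, g_c, h₀, h₁, h_c, hgen⟩ := hex
  obtain ⟨N', -, hnormal, hcomm, hindex, -⟩ := main g₀ g₁ g_c h₀ h₁ h_c hgen
  exact ⟨N', hnormal, hcomm, ⟨hindex⟩⟩

end

section

/-! ### The analytic inverse function theorem -/

theorem exists_analyticAt_local_inverse {E F : Type*} [NormedAddCommGroup E] [NormedSpace ℂ E]
    [CompleteSpace E] [NormedAddCommGroup F] [NormedSpace ℂ F] [CompleteSpace F] {f : E → F}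
    {a : E} (hf : AnalyticAt ℂ f a) {f' : E ≃L[ℂ] F} (hf' : HasFDerivAt f (f' : E →L[ℂ] F) a) :
    ∃ g : F → E, AnalyticAt ℂ g (f a) ∧ g (f a) = a ∧ (∀ᶠ x in 𝓝 a, g (f x) = x) ∧
      ∀ᶠ y in 𝓝 (f a), f (g y) = y := by
  have hc : ContDiffAt ℂ ⊤ f a := hf.contDiffAt
  have hs := hc.hasStrictFDerivAt' hf' (by simp)
  exact ⟨hc.localInverse hf' (by simp), (hc.to_localInverse hf' (by simp)).analyticAt,
    hc.localInverse_apply_image hf' (by simp), hs.eventually_left_inverse,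
    hs.eventually_right_inverse⟩

/-! ### Flows of polynomial vector fields -/

section Flow

open MeasureTheory

/-- Integration from `0`, on continuous functions on the unit interval. -/
def primitive : C(unitInterval, ℂ) →L[ℂ] C(unitInterval, ℂ) :=
  LinearMap.mkContinuous
    { toFun := fun f =>
        ⟨fun s => ∫ u in (0 : ℝ)..s, f (Set.projIcc 0 1 zero_le_one u), by
          have hc : Continuous fun u : ℝ => f (Set.projIcc 0 1 zero_le_one u) := by fun_prop
          exact (intervalIntegral.continuous_primitive (fun a b => hc.intervalIntegrable a b) 0).comp
            continuous_subtype_val⟩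
      map_add' := fun f g => by
        ext s
        have hc : ∀ f : C(unitInterval, ℂ),
            Continuous fun u : ℝ => f (Set.projIcc 0 1 zero_le_one u) := fun f => by fun_prop
        exact intervalIntegral.integral_add ((hc f).intervalIntegrable _ _)
          ((hc g).intervalIntegrable _ _)
      map_smul' := fun a f => by
        ext s
        exact intervalIntegral.integral_smul (𝕜 := ℂ) a
          (fun u => f (Set.projIcc 0 1 zero_le_one u)) } 1 fun f => by
    rw [one_mul, ContinuousMap.norm_le _ (norm_nonneg f)]
    intro s
    have h := intervalIntegral.norm_integral_le_of_norm_le_const (a := 0) (b := (s : ℝ))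
      (f := fun u => f (Set.projIcc 0 1 zero_le_one u)) (C := ‖f‖) fun u _ => f.norm_coe_le_norm _
    refine h.trans ?_
    rw [sub_zero, abs_of_nonneg s.2.1]
    exact mul_le_of_le_one_right (norm_nonneg f) s.2.2

theorem primitive_apply (f : C(unitInterval, ℂ)) (s : unitInterval) :
    primitive f s = ∫ u in (0 : ℝ)..s, f (Set.projIcc 0 1 zero_le_one u) := rfl

variable {n : ℕ}

/-- A polynomial vector field acting on vectors of continuous functions. -/
def superposition (V : Fin n → MvPolynomial (Fin n) ℂ) (f : Fin n → C(unitInterval, ℂ)) :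
    Fin n → C(unitInterval, ℂ) := fun i => MvPolynomial.aeval f (V i)

theorem superposition_apply (V : Fin n → MvPolynomial (Fin n) ℂ)
    (f : Fin n → C(unitInterval, ℂ)) (i : Fin n) (s : unitInterval) :
    superposition V f i s = MvPolynomial.eval (fun j => f j s) (V i) := by
  have h := MvPolynomial.comp_aeval_apply (f := f) (ContinuousMap.evalAlgHom ℂ ℂ s) (V i)
  rw [MvPolynomial.aeval_eq_eval] at h
  exact h

theorem analyticAt_superposition (V : Fin n → MvPolynomial (Fin n) ℂ)
    (f : Fin n → C(unitInterval, ℂ)) : AnalyticAt ℂ (superposition V) f :=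
  analyticAt_pi_iff.2 fun i => AnalyticAt.aeval_mvPolynomial
    (fun j => (ContinuousLinearMap.proj (R := ℂ)
      (φ := fun _ : Fin n => C(unitInterval, ℂ)) j).analyticAt f) (V i)

/-- Vectors of constant functions. -/
def constVec : (Fin n → ℂ) →L[ℂ] (Fin n → C(unitInterval, ℂ)) :=
  ContinuousLinearMap.pi fun i =>
    (ContinuousLinearMap.toSpanSingleton ℂ (1 : C(unitInterval, ℂ))).comp
      (ContinuousLinearMap.proj i)

/-- Componentwise integration from `0`. -/
def primitiveVec : (Fin n → C(unitInterval, ℂ)) →L[ℂ] (Fin n → C(unitInterval, ℂ)) :=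
  ContinuousLinearMap.pi fun i => primitive.comp (ContinuousLinearMap.proj i)

theorem constVec_apply (y : Fin n → ℂ) (i : Fin n) (s : unitInterval) :
    constVec y i s = y i := by
  simp [constVec]

/-- The equation `x = C y + τ W x` has, for small `τ`, a unique small solution, which depends
analytically on `y` and `τ`. -/
theorem exists_analytic_fixedPoint {X Y : Type*} [NormedAddCommGroup X] [NormedSpace ℂ X]
    [CompleteSpace X] [NormedAddCommGroup Y] [NormedSpace ℂ Y] [CompleteSpace Y] (C : Y →L[ℂ] X)
    {W : X → X} (y₀ : Y) (hW : AnalyticAt ℂ W (C y₀)) :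
    ∃ sol : Y × ℂ → X, AnalyticAt ℂ sol (y₀, 0) ∧ sol (y₀, 0) = C y₀ ∧
      (∀ᶠ p in 𝓝 (y₀, (0 : ℂ)), sol p = C p.1 + p.2 • W (sol p)) ∧
      ∀ᶠ x in 𝓝 ((y₀, (0 : ℂ)), C y₀), x.2 = C x.1.1 + x.1.2 • W x.2 → sol x.1 = x.2 := by
  -- The equation says that the second component of `Φ` vanishes. At `τ = 0` the derivative of `Φ`
  -- is triangular with identities on the diagonal, so `Φ` has an analytic local inverse.
  let Φ : (Y × ℂ) × X → (Y × ℂ) × X := fun x => (x.1, x.2 - C x.1.1 - x.1.2 • W x.2)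
  have hW2 : AnalyticAt ℂ (fun x : (Y × ℂ) × X => W x.2) ((y₀, 0), C y₀) :=
    AnalyticAt.comp (g := W) (f := fun x : (Y × ℂ) × X => x.2) hW analyticAt_snd
  have hτ : AnalyticAt ℂ (fun x : (Y × ℂ) × X => x.1.2) ((y₀, 0), C y₀) :=
    analyticAt_snd.comp analyticAt_fst
  have hC : AnalyticAt ℂ (fun x : (Y × ℂ) × X => C x.1.1) ((y₀, 0), C y₀) :=
    (C.analyticAt _).comp (analyticAt_fst.comp analyticAt_fst)
  have hΦ : AnalyticAt ℂ Φ ((y₀, 0), C y₀) :=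
    analyticAt_fst.prod ((analyticAt_snd.sub hC).sub (hτ.smul hW2))
  let L : (Y × ℂ) →L[ℂ] X :=
    -(C.comp (ContinuousLinearMap.fst ℂ Y ℂ)) -
      (ContinuousLinearMap.snd ℂ Y ℂ).smulRight (W (C y₀))
  have hd : HasFDerivAt Φ (((ContinuousLinearEquiv.refl ℂ (Y × ℂ)).skewProd
      (ContinuousLinearEquiv.refl ℂ X) L : ((Y × ℂ) × X) ≃L[ℂ] ((Y × ℂ) × X)) :
      ((Y × ℂ) × X) →L[ℂ] ((Y × ℂ) × X)) ((y₀, 0), C y₀) := by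
    have hx : HasFDerivAt (fun x : (Y × ℂ) × X => x.2)
      (ContinuousLinearMap.snd ℂ (Y × ℂ) X) ((y₀, 0), C y₀) := hasFDerivAt_snd
    have hp : HasFDerivAt (fun x : (Y × ℂ) × X => x.1)
      (ContinuousLinearMap.fst ℂ (Y × ℂ) X) ((y₀, 0), C y₀) := hasFDerivAt_fst
    have h2 := hp.snd.smul hW2.differentiableAt.hasFDerivAt
    have h3 := hp.prodMk ((hx.sub (C.hasFDerivAt.comp _ hp.fst)).sub h2)
    refine h3.congr_fderiv ?_
    refine ContinuousLinearMap.ext fun x => Prod.ext rfl ?_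
    simp [L]
    abel
  obtain ⟨ψ, hψ, hψ0, hleft, hright⟩ := exists_analyticAt_local_inverse hΦ hd
  have hΦ0 : Φ ((y₀, 0), C y₀) = ((y₀, 0), 0) := by simp [Φ]
  rw [hΦ0] at hψ hψ0 hright
  have hinc : AnalyticAt ℂ (fun p : Y × ℂ => (p, (0 : X))) (y₀, 0) :=
    analyticAt_id.prod analyticAt_const
  refine ⟨fun p => (ψ (p, 0)).2,
    analyticAt_snd.comp (AnalyticAt.comp (g := ψ) (f := fun p => (p, 0)) hψ hinc),
    congrArg Prod.snd hψ0, ?_, ?_⟩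
  · filter_upwards [hinc.continuousAt.eventually hright] with p hp
    have h1 : (ψ (p, 0)).1 = p := congrArg Prod.fst hp
    have h2 := congrArg Prod.snd hp
    simp only [Φ, h1] at h2
    rwa [sub_sub, sub_eq_zero] at h2
  · filter_upwards [hleft] with x hx hx2
    have : Φ x = (x.1, 0) := by
      simp only [Φ]
      rw [sub_sub, sub_eq_zero.2 hx2]
    rw [this] at hx
    rw [hx]

/-- Rescaling time by `τ` turns the initial value problem into `x = y + τ ∫ V(x)` on the fixed
interval `[0, 1]`. A polynomial acts analytically on continuous functions, so the solution depends
analytically on `(y, τ)`, and the flow is its value at `s = 1`. -/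
theorem exists_polynomial_flow (V : Fin n → MvPolynomial (Fin n) ℂ) (y₀ : Fin n → ℂ) :
    ∃ fl : (Fin n → ℂ) × ℂ → Fin n → ℂ, AnalyticAt ℂ fl (y₀, 0) ∧
      (∀ᶠ y in 𝓝 y₀, fl (y, 0) = y) ∧
      ∀ᶠ p in 𝓝 (y₀, (0 : ℂ)), HasDerivAt (fun τ => fl (p.1, τ))
        (fun i => MvPolynomial.eval (fl p) (V i)) p.2 := by
  obtain ⟨sol, hsol, hsol0, heq, huniq⟩ := exists_analytic_fixedPoint constVec
    (W := fun f => primitiveVec (superposition V f)) y₀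
    ((primitiveVec.analyticAt _).comp (analyticAt_superposition V _))
  let ev : (Fin n → C(unitInterval, ℂ)) →L[ℂ] (Fin n → ℂ) :=
    ContinuousLinearMap.pi fun i =>
      (ContinuousMap.evalCLM ℂ (1 : unitInterval)).comp (ContinuousLinearMap.proj i)
  have hfl : AnalyticAt ℂ (fun p => ev (sol p)) (y₀, 0) := (ev.analyticAt _).comp hsol
  -- the integral equation, pointwise
  have hpt : ∀ᶠ p in 𝓝 (y₀, (0 : ℂ)), ∀ (i : Fin n) (s : unitInterval), sol p i s = p.1 i + p.2 *
      ∫ u in (0 : ℝ)..s, superposition V (sol p) i (Set.projIcc 0 1 zero_le_one u) := by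
    filter_upwards [heq] with p hp i s
    have := congrArg (fun f : Fin n → C(unitInterval, ℂ) => f i s) hp
    simpa [constVec_apply, primitiveVec, primitive_apply] using this
  -- the solution for `s τ` is the reparametrised solution for `τ`
  have hscale : ∀ᶠ p in 𝓝 (y₀, (0 : ℂ)), ∀ (s : unitInterval) (i : Fin n),
      sol (p.1, (s : ℂ) * p.2) i 1 = sol p i s := by
    obtain ⟨ε, hε, hball⟩ := Metric.eventually_nhds_iff_ball.1 huniq
    have h1 : ∀ᶠ p in 𝓝 (y₀, (0 : ℂ)), dist (sol p) (constVec y₀) < ε := by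
      have := hsol.continuousAt.eventually (Metric.ball_mem_nhds _ hε)
      rwa [hsol0] at this
    filter_upwards [h1, Metric.ball_mem_nhds _ hε, hpt] with p hp1 hp2 hp3 s i
    rw [Metric.mem_ball, Prod.dist_eq, max_lt_iff] at hp2
    let m : C(unitInterval, unitInterval) := ⟨fun r => s * r, by fun_prop⟩
    let f' : Fin n → C(unitInterval, ℂ) := fun j => (sol p j).comp m
    have key : sol (p.1, (s : ℂ) * p.2) = f' := by
      refine hball ((p.1, (s : ℂ) * p.2), f') ?_ ?_
      · rw [Metric.mem_ball, Prod.dist_eq, Prod.dist_eq, max_lt_iff, max_lt_iff]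
        refine ⟨⟨hp2.1, ?_⟩, ?_⟩
        · refine lt_of_le_of_lt ?_ hp2.2
          rw [dist_zero_right, dist_zero_right, norm_mul, Complex.norm_real,
            Real.norm_of_nonneg s.2.1]
          exact mul_le_of_le_one_left (norm_nonneg _) s.2.2
        · refine lt_of_le_of_lt ?_ hp1
          refine (dist_pi_le_iff dist_nonneg).2 fun j =>
            (ContinuousMap.dist_le dist_nonneg).2 fun r => ?_
          have e1 : dist (sol p j (s * r)) (constVec y₀ j (s * r)) ≤
              dist (sol p j) (constVec y₀ j) := ContinuousMap.dist_apply_le_dist _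
          rw [constVec_apply] at e1 ⊢
          exact e1.trans (dist_le_pi_dist (sol p) (constVec y₀) j)
      · funext j
        ext r
        have hint : (s : ℝ) • ∫ u in (0 : ℝ)..r, superposition V (sol p) j
              (Set.projIcc 0 1 zero_le_one ((s : ℝ) * u)) =
            ∫ u in (0 : ℝ)..(s : ℝ) * r, superposition V (sol p) j
              (Set.projIcc 0 1 zero_le_one u) := by
          have := intervalIntegral.smul_integral_comp_mul_left (a := 0) (b := (r : ℝ))
            (fun u => superposition V (sol p) j (Set.projIcc 0 1 zero_le_one u)) (s : ℝ)
          rwa [mul_zero] at this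
        have hcongr : ∫ u in (0 : ℝ)..r, superposition V (sol p) j
              (Set.projIcc 0 1 zero_le_one ((s : ℝ) * u)) =
            ∫ u in (0 : ℝ)..r, superposition V f' j (Set.projIcc 0 1 zero_le_one u) := by
          refine intervalIntegral.integral_congr fun u hu => ?_
          rw [Set.uIcc_of_le r.2.1] at hu
          have hu1 : u ∈ Set.Icc (0 : ℝ) 1 := ⟨hu.1, hu.2.trans r.2.2⟩
          have hsu : (s : ℝ) * u ∈ Set.Icc (0 : ℝ) 1 :=
            ⟨mul_nonneg s.2.1 hu1.1, mul_le_one₀ s.2.2 hu1.1 hu1.2⟩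
          simp only [superposition_apply, f', ContinuousMap.comp_apply, m, ContinuousMap.coe_mk]
          rw [Set.projIcc_of_mem _ hu1, Set.projIcc_of_mem _ hsu]
          rfl
        have h3 := hp3 j (s * r)
        have e2 : ((s * r : unitInterval) : ℝ) = (s : ℝ) * r := rfl
        rw [e2, ← hint, hcongr] at h3
        change sol p j (s * r) = constVec p.1 j r + ((s : ℂ) * p.2) *
          primitive (superposition V f' j) r
        rw [h3, constVec_apply, primitive_apply, Complex.real_smul]
        ring
    rw [key]
    simp [f', m]
  have han := hfl.eventually_analyticAt
  obtain ⟨ε, hε, hball⟩ := Metric.eventually_nhds_iff_ball.1 (hpt.and (hscale.and han))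
  -- Analyticity already supplies a complex derivative in time; differentiating the integral
  -- equation along the real ray `s ↦ s τ₀` identifies it.
  have claim : ∀ (y : Fin n → ℂ) (τ₀ : ℂ), (y, τ₀) ∈ Metric.ball (y₀, (0 : ℂ)) ε → τ₀ ≠ 0 →
      ∀ s₀ : unitInterval, HasDerivAt (fun τ => ev (sol (y, τ)))
        (fun i => MvPolynomial.eval (ev (sol (y, (s₀ : ℂ) * τ₀))) (V i)) ((s₀ : ℂ) * τ₀) := by
    intro y τ₀ hq hτ₀ s₀
    obtain ⟨h1, h2, -⟩ := hball _ hq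
    have hmem : (y, (s₀ : ℂ) * τ₀) ∈ Metric.ball (y₀, (0 : ℂ)) ε := by
      rw [Metric.mem_ball, Prod.dist_eq, max_lt_iff] at hq ⊢
      refine ⟨hq.1, lt_of_le_of_lt ?_ hq.2⟩
      rw [dist_zero_right, dist_zero_right, norm_mul, Complex.norm_real,
        Real.norm_of_nonneg s₀.2.1]
      exact mul_le_of_le_one_left (norm_nonneg _) s₀.2.2
    have hdiff : DifferentiableAt ℂ (fun τ => ev (sol (y, τ))) ((s₀ : ℂ) * τ₀) := by
      have h3 := (hball _ hmem).2.2.differentiableAt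
      exact DifferentiableAt.comp (g := fun p => ev (sol p)) ((s₀ : ℂ) * τ₀) h3
        ((differentiableAt_const y).prodMk differentiableAt_id)
    have hd := hdiff.hasDerivAt
    set d := deriv (fun τ => ev (sol (y, τ))) ((s₀ : ℂ) * τ₀)
    rw [hasDerivAt_pi] at hd ⊢
    intro i
    have hlin : HasDerivAt (fun s : ℝ => (s : ℂ) * τ₀) τ₀ (s₀ : ℝ) := by
      simpa using (hasDerivAt_id (s₀ : ℝ)).ofReal_comp.mul_const τ₀
    have c1 := (HasDerivAt.scomp (s₀ : ℝ) (hd i) hlin).hasDerivWithinAt (s := Set.Icc 0 1)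
    have hcont : Continuous fun u : ℝ =>
        superposition V (sol (y, τ₀)) i (Set.projIcc 0 1 zero_le_one u) := by fun_prop
    have c2 := (((hcont.integral_hasStrictDerivAt 0 (s₀ : ℝ)).hasDerivAt.const_mul
      τ₀).const_add (y i)).hasDerivWithinAt (s := Set.Icc 0 1)
    have c3 := c2.congr_of_mem (f₁ := (fun τ => ev (sol (y, τ)) i) ∘ fun s : ℝ => (s : ℂ) * τ₀)
      (fun s hs => by
        have e1 := h2 ⟨s, hs⟩ i
        have e2 := h1 i ⟨s, hs⟩
        simp only at e1 e2
        rw [← e2, ← e1]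
        rfl) s₀.2
    have hu := (uniqueDiffOn_Icc (zero_lt_one (α := ℝ)) _ s₀.2).eq_deriv _ c1 c3
    rw [smul_eq_mul] at hu
    have hu' := mul_left_cancel₀ hτ₀ hu
    rw [superposition_apply, Set.projIcc_val] at hu'
    have e3 : (fun j => sol (y, τ₀) j s₀) = ev (sol (y, (s₀ : ℂ) * τ₀)) :=
      funext fun j => (h2 s₀ j).symm
    rw [e3] at hu'
    rw [← hu']
    exact hd i
  refine ⟨fun p => ev (sol p), hfl, ?_, ?_⟩
  · have hcy : Tendsto (fun y : Fin n → ℂ => (y, (0 : ℂ))) (𝓝 y₀) (𝓝 (y₀, 0)) :=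
      (Continuous.prodMk_left 0).tendsto y₀
    filter_upwards [hcy.eventually hpt] with y hy
    funext i
    have := hy i 1
    simp at this
    exact this
  · filter_upwards [Metric.ball_mem_nhds _ hε] with p hp
    by_cases h0 : p.2 = 0
    -- Time zero lies on no ray of its own: it is treated as the initial point `s = 0` of the ray
    -- through `ε / 2`.
    · have hmem : (p.1, ((ε / 2 : ℝ) : ℂ)) ∈ Metric.ball (y₀, (0 : ℂ)) ε := by
        rw [Metric.mem_ball, Prod.dist_eq, max_lt_iff] at hp ⊢
        refine ⟨hp.1, ?_⟩
        rw [dist_zero_right, Complex.norm_real, Real.norm_of_nonneg (by positivity)]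
        linarith
      have := claim p.1 _ hmem (Complex.ofReal_ne_zero.2 (by positivity)) 0
      have e : p = (p.1, 0) := Prod.ext rfl h0
      rw [e]
      simpa using this
    · have := claim p.1 p.2 hp h0 1
      simpa using this

end Flow

end

section

/-! ### Germs -/

section Germs

variable {V : Type*} [NormedAddCommGroup V] [NormedSpace ℂ V] {x : V}

theorem germOf_eq_iff {f g : LocalSelfMap x} : germOf f = germOf g ↔ f.1 =ᶠ[𝓝 x] g.1 :=
  Quotient.eq (r := germSetoid x)

theorem exists_germOf_eq (g : SelfGerm x) : ∃ f, germOf f = g := Quotient.exists_rep g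

theorem germOf_mul (f g : LocalSelfMap x) : germOf f * germOf g = germOf (f.comp g) := rfl

theorem tendsto_localSelfMap (f : LocalSelfMap x) : Tendsto f.1 (𝓝 x) (𝓝 x) := by
  have h := f.2.1.continuousAt.tendsto
  rwa [f.2.2] at h

theorem exists_diffGerm_of_hasFDerivAt [CompleteSpace V] (f : LocalSelfMap x) {e : V ≃L[ℂ] V}
    (hf : HasFDerivAt f.1 (e : V →L[ℂ] V) x) : ∃ g : DiffGerm x, (g : SelfGerm x) = germOf f := by
  obtain ⟨g, hg, hg0, hl, hr⟩ := exists_analyticAt_local_inverse f.2.1 hf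
  rw [f.2.2] at hg hg0 hr
  exact ⟨⟨germOf f, germOf ⟨g, hg, hg0⟩, germOf_eq_iff.2 hr, germOf_eq_iff.2 hl⟩, rfl⟩

end Germs

/-! ### Local uniqueness for ordinary differential equations -/

section Uniqueness

variable {W : Type*} [NormedAddCommGroup W] [NormedSpace ℂ W]

/-- Both solutions are restricted to the real segment from `b` to `q`, where Lipschitz uniqueness
applies. The Lipschitz constant and the radius do not depend on the parameter in `Z`; `Z = Unit`
covers a single solution. -/
theorem eventually_eq_of_hasDerivAt {Z : Type*} [TopologicalSpace Z] {F : ℂ → W → W}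
    {φ ψ : ℂ × Z → W} {b : ℂ} {z₀ : Z}
    (hF : AnalyticAt ℂ (fun x : ℂ × W => F x.1 x.2) (b, φ (b, z₀)))
    (hφ : ContinuousAt φ (b, z₀)) (hψ : ContinuousAt ψ (b, z₀))
    (hφ' : ∀ᶠ p in 𝓝 (b, z₀), HasDerivAt (fun q => φ (q, p.2)) (F p.1 (φ p)) p.1)
    (hψ' : ∀ᶠ p in 𝓝 (b, z₀), HasDerivAt (fun q => ψ (q, p.2)) (F p.1 (ψ p)) p.1)
    (h : ∀ᶠ z in 𝓝 z₀, φ (b, z) = ψ (b, z)) : φ =ᶠ[𝓝 (b, z₀)] ψ := by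
  obtain ⟨K, s, hs, hK⟩ := hF.hasStrictFDerivAt.exists_lipschitzOnWith
  have h1 : ∀ᶠ p in 𝓝 (b, z₀), (p.1, φ p) ∈ s := (continuousAt_fst.prodMk hφ).eventually hs
  have h2 : ∀ᶠ p in 𝓝 (b, z₀), (p.1, ψ p) ∈ s := by
    have e := h.self_of_nhds
    refine (continuousAt_fst.prodMk hψ).eventually ?_
    change s ∈ 𝓝 (b, ψ (b, z₀))
    rw [← e]
    exact hs
  have h3 := ((h1.and h2).and (hφ'.and hψ'))
  rw [nhds_prod_eq] at h3
  obtain ⟨pa, hpa, pb, hpb, hab⟩ := eventually_prod_iff.1 h3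
  obtain ⟨ε, hε, hball⟩ := Metric.eventually_nhds_iff_ball.1 hpa
  rw [Filter.EventuallyEq, nhds_prod_eq]
  refine eventually_prod_iff.2 ⟨fun q => q ∈ Metric.ball b ε, Metric.ball_mem_nhds b hε,
    fun z => pb z ∧ φ (b, z) = ψ (b, z), hpb.and h, ?_⟩
  intro q hq z hz
  let ℓ : ℝ → ℂ := fun t => b + t * (q - b)
  have hℓ : ∀ t ∈ Set.Icc (0 : ℝ) 1, ℓ t ∈ Metric.ball b ε := by
    intro t ht
    rw [Metric.mem_ball, dist_eq_norm] at hq ⊢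
    simp only [ℓ, add_sub_cancel_left, norm_mul, Complex.norm_real, Real.norm_of_nonneg ht.1]
    exact lt_of_le_of_lt (mul_le_of_le_one_left (norm_nonneg _) ht.2) hq
  have hℓ' : ∀ t : ℝ, HasDerivAt ℓ (q - b) t := fun t => by
    have := ((hasDerivAt_id t).ofReal_comp.mul_const (q - b)).const_add b
    rw [Complex.ofReal_one, one_mul] at this
    exact this
  have hd : ∀ χ : ℂ × Z → W, (∀ t ∈ Set.Icc (0 : ℝ) 1,
      HasDerivAt (fun q => χ (q, z)) (F (ℓ t) (χ (ℓ t, z))) (ℓ t)) → ∀ t ∈ Set.Icc (0 : ℝ) 1,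
      HasDerivAt (fun t : ℝ => χ (ℓ t, z)) ((q - b) • F (ℓ t) (χ (ℓ t, z))) t :=
    fun χ hχ t ht => HasDerivAt.scomp t (hχ t ht) (hℓ' t)
  have d1 := hd φ fun t ht => (hab (hball _ (hℓ t ht)) hz.1).2.1
  have d2 := hd ψ fun t ht => (hab (hball _ (hℓ t ht)) hz.1).2.2
  have huniq := ODE_solution_unique_of_mem_Icc_right (E := W) (a := 0) (b := 1)
    (v := fun t y => (q - b) • F (ℓ t) y) (s := fun t => {y | (ℓ t, y) ∈ s})
    (K := ‖q - b‖₊ * K) (f := fun t : ℝ => φ (ℓ t, z)) (g := fun t : ℝ => ψ (ℓ t, z))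
    (fun t _ => by
      refine LipschitzOnWith.of_dist_le_mul fun y hy y' hy' => ?_
      rw [dist_smul₀, NNReal.coe_mul, mul_assoc]
      refine mul_le_mul_of_nonneg_left ?_ (norm_nonneg _)
      have := hK.dist_le_mul _ hy _ hy'
      rwa [Prod.dist_eq, dist_self, max_eq_right dist_nonneg] at this)
    (fun t ht => (d1 t ht).continuousAt.continuousWithinAt)
    (fun t ht => (d1 t (Set.Ico_subset_Icc_self ht)).hasDerivWithinAt)
    (fun t ht => (hab (hball _ (hℓ t (Set.Ico_subset_Icc_self ht))) hz.1).1.1)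
    (fun t ht => (d2 t ht).continuousAt.continuousWithinAt)
    (fun t ht => (d2 t (Set.Ico_subset_Icc_self ht)).hasDerivWithinAt)
    (fun t ht => (hab (hball _ (hℓ t (Set.Ico_subset_Icc_self ht))) hz.1).1.2)
    (by simpa [ℓ] using hz.2)
  have := huniq (Set.right_mem_Icc.2 zero_le_one)
  simpa [ℓ] using this

end Uniqueness

/-! ### Straightening the foliation along the leaf at infinity -/

variable (κ₀ κ₁ κₜ κ : ℂ)

theorem analyticAt_slope {q : ℂ} {y : ℂ × ℂ} (h : fieldQ κ₀ κ₁ κₜ q y.1 y.2 ≠ 0) :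
    AnalyticAt ℂ (fun x : ℂ × (ℂ × ℂ) => slope κ₀ κ₁ κₜ κ x.1 x.2) (q, y) := by
  have h0 : AnalyticAt ℂ (fun x : ℂ × (ℂ × ℂ) => x.1) (q, y) := analyticAt_fst
  have h1 : AnalyticAt ℂ (fun x : ℂ × (ℂ × ℂ) => x.2.1) (q, y) :=
    analyticAt_fst.comp analyticAt_snd
  have h2 : AnalyticAt ℂ (fun x : ℂ × (ℂ × ℂ) => x.2.2) (q, y) :=
    analyticAt_snd.comp analyticAt_snd
  have hQ : AnalyticAt ℂ (fun x : ℂ × (ℂ × ℂ) => fieldQ κ₀ κ₁ κₜ x.1 x.2.1 x.2.2) (q, y) := by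
    unfold fieldQ polyE polyF
    fun_prop
  unfold slope
  refine AnalyticAt.prod (AnalyticAt.div ?_ hQ h) (AnalyticAt.div ?_ hQ h)
  · unfold fieldM polyE' polyF'
    fun_prop
  · unfold fieldT
    fun_prop

/-- The polynomial vector field on `ℂ × (ℂ × ℂ)`. -/
def field (x : ℂ × (ℂ × ℂ)) : ℂ × (ℂ × ℂ) :=
  (fieldQ κ₀ κ₁ κₜ x.1 x.2.1 x.2.2, fieldM κ₀ κ₁ κₜ κ x.1 x.2.1 x.2.2, fieldT x.2.1 x.2.2)

theorem fieldQ_ne_zero {c q : ℂ} (h0 : q ≠ 0) (h1 : q ≠ 1) (hc : q ≠ c) :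
    fieldQ κ₀ κ₁ κₜ q 0 c ≠ 0 := by
  simp [fieldQ, polyE, h0, sub_ne_zero.2 h1, sub_ne_zero.2 hc]

theorem slope_zero (q t : ℂ) : slope κ₀ κ₁ κₜ κ q (0, t) = 0 := by
  simp [slope, fieldM, fieldT]

/-- `φ` is an analytic family of solutions of the foliation near `q = b`, parametrised by points
near `(0, c)`, whose germ on the cross-section `q = b` is `g`. -/
def IsChart {c : ℂ} (φ : ℂ × (ℂ × ℂ) → ℂ × ℂ) (b : ℂ) (g : DiffGerm ((0, c) : ℂ × ℂ)) : Prop :=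
  AnalyticAt ℂ φ (b, (0, c)) ∧
    (∀ᶠ p in 𝓝 (b, ((0, c) : ℂ × ℂ)),
      HasDerivAt (fun q => φ (q, p.2)) (slope κ₀ κ₁ κₜ κ p.1 (φ p)) p.1) ∧
    ∃ f : LocalSelfMap ((0, c) : ℂ × ℂ), germOf f = (g : SelfGerm ((0, c) : ℂ × ℂ)) ∧
      ∀ᶠ w in 𝓝 ((0, c) : ℂ × ℂ), φ (b, w) = f.1 w

variable {κ₀ κ₁ κₜ κ} {c : ℂ} {φ ψ : ℂ × (ℂ × ℂ) → ℂ × ℂ} {b : ℂ}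
  {g g' : DiffGerm ((0, c) : ℂ × ℂ)}

theorem IsChart.apply_base (h : IsChart κ₀ κ₁ κₜ κ φ b g) : φ (b, (0, c)) = (0, c) := by
  obtain ⟨-, -, f, -, hf⟩ := h
  rw [hf.self_of_nhds, f.2.2]

theorem IsChart.unique (h : IsChart κ₀ κ₁ κₜ κ φ b g) (h' : IsChart κ₀ κ₁ κₜ κ φ b g') :
    g = g' := by
  obtain ⟨-, -, f, hg, hf⟩ := h
  obtain ⟨-, -, f', hg', hf'⟩ := h'
  refine Units.ext ?_
  rw [← hg, ← hg', germOf_eq_iff]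
  filter_upwards [hf, hf'] with w h1 h2
  rw [← h1, h2]

/-- Changing the parametrisation of the solutions multiplies the germ on the right: this is the
right translation in the flat system. -/
theorem IsChart.mul (h : IsChart κ₀ κ₁ κₜ κ φ b g) {f : LocalSelfMap ((0, c) : ℂ × ℂ)}
    (hf : germOf f = (g' : SelfGerm ((0, c) : ℂ × ℂ))) :
    IsChart κ₀ κ₁ κₜ κ (fun p => φ (p.1, f.1 p.2)) b (g * g') := by
  obtain ⟨h1, h2, f', hg, hf'⟩ := h
  have ha : AnalyticAt ℂ (fun p : ℂ × (ℂ × ℂ) => (p.1, f.1 p.2)) (b, (0, c)) :=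
    analyticAt_fst.prod (AnalyticAt.comp (g := f.1) (f := fun p : ℂ × (ℂ × ℂ) => p.2)
      f.2.1 analyticAt_snd)
  have e : (b, f.1 (0, c)) = (b, (0, c)) := by rw [f.2.2]
  refine ⟨AnalyticAt.comp (g := φ) (f := fun p : ℂ × (ℂ × ℂ) => (p.1, f.1 p.2)) ?_ ha, ?_,
    f'.comp f, ?_, ?_⟩
  · rw [e]
    exact h1
  · have := ha.continuousAt.tendsto
    rw [e] at this
    exact this.eventually h2
  · rw [← germOf_mul, hg, hf, Units.val_mul]
  · exact (tendsto_localSelfMap f).eventually hf'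

theorem IsChart.eventually_eq (h : IsChart κ₀ κ₁ κₜ κ φ b g) (h' : IsChart κ₀ κ₁ κₜ κ ψ b g)
    (h0 : b ≠ 0) (h1 : b ≠ 1) (hc : b ≠ c) : φ =ᶠ[𝓝 (b, (0, c))] ψ := by
  have hb := h.apply_base
  obtain ⟨a1, a2, f, hg, hf⟩ := h
  obtain ⟨a1', a2', f', hg', hf'⟩ := h'
  refine eventually_eq_of_hasDerivAt (F := slope κ₀ κ₁ κₜ κ) ?_ a1.continuousAt a1'.continuousAt
    a2 a2' ?_
  · rw [hb]
    exact analyticAt_slope _ _ _ _ (fieldQ_ne_zero _ _ _ h0 h1 hc)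
  · filter_upwards [hf, hf', germOf_eq_iff.1 (hg.trans hg'.symm)] with w k1 k2 k3
    rw [k1, k2, k3]

theorem IsChart.congr (h : IsChart κ₀ κ₁ κₜ κ φ b g) (h' : φ =ᶠ[𝓝 (b, (0, c))] ψ) :
    IsChart κ₀ κ₁ κₜ κ ψ b g := by
  obtain ⟨a1, a2, f, hg, hf⟩ := h
  refine ⟨a1.congr h', ?_, f, hg, ?_⟩
  · filter_upwards [a2, h'.eventually_nhds] with p k1 k2
    have : (fun q => φ (q, p.2)) =ᶠ[𝓝 p.1] fun q => ψ (q, p.2) :=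
      (Continuous.prodMk_left p.2).continuousAt.eventually k2
    rw [← k2.self_of_nhds]
    exact k1.congr_of_eventuallyEq this.symm
  · have := (Continuous.prodMk_right (X := ℂ) (Y := ℂ × ℂ) b).continuousAt.eventually h'
    filter_upwards [hf, this] with w k1 k2
    rw [← k2, k1]

/-- Two charts differ by a locally constant germ. -/
theorem IsChart.eventually_inv_mul (h : IsChart κ₀ κ₁ κₜ κ φ b g)
    (h' : IsChart κ₀ κ₁ κₜ κ ψ b g') (h0 : b ≠ 0) (h1 : b ≠ 1) (hc : b ≠ c) :
    ∀ᶠ b' in 𝓝 b, ∀ k k', IsChart κ₀ κ₁ κₜ κ φ b' k → IsChart κ₀ κ₁ κₜ κ ψ b' k' →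
      k⁻¹ * k' = g⁻¹ * g' := by
  obtain ⟨H, hH⟩ := exists_germOf_eq ((g⁻¹ * g' : DiffGerm ((0, c) : ℂ × ℂ)) :
    SelfGerm ((0, c) : ℂ × ℂ))
  have k1 := h.mul hH
  rw [mul_inv_cancel_left] at k1
  have hcont : Tendsto (fun q : ℂ => (q, ((0, c) : ℂ × ℂ))) (𝓝 b) (𝓝 (b, (0, c))) :=
    (Continuous.prodMk_left (X := ℂ) ((0, c) : ℂ × ℂ)).tendsto b
  filter_upwards [hcont.eventually (k1.eventually_eq h' h0 h1 hc).eventually_nhds]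
    with b' hb' k k' hk hk'
  have := ((hk.mul hH).congr hb').unique hk'
  rw [← this, inv_mul_cancel_left]

/-- Time is eliminated in favour of `q`: since `fieldQ` does not vanish at the base point, `(τ, w) ↦
(q, w)` is a local analytic isomorphism. The statement on `Filter.map` lets identities known along
the family be transported to a neighbourhood in the `q`-plane. -/
theorem exists_isChart {Y : ℂ × (ℂ × ℂ) → ℂ × (ℂ × ℂ)} {lam : ℂ × (ℂ × ℂ) → ℂ} {T : ℂ}
    (hY : AnalyticAt ℂ Y (T, (0, c))) (h0 : b ≠ 0) (h1 : b ≠ 1) (hc : b ≠ c)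
    (hYb : Y (T, (0, c)) = (b, (0, c)))
    (hY' : ∀ᶠ p in 𝓝 (T, ((0, c) : ℂ × ℂ)), lam p ≠ 0 ∧
      HasDerivAt (fun τ => Y (τ, p.2)) (lam p • field κ₀ κ₁ κₜ κ (Y p)) p.1)
    {e : (ℂ × ℂ) ≃L[ℂ] (ℂ × ℂ)}
    (he : HasFDerivAt (fun w => (Y (T, w)).2) (e : (ℂ × ℂ) →L[ℂ] (ℂ × ℂ)) (0, c)) :
    ∃ φ g, IsChart (c := c) κ₀ κ₁ κₜ κ φ b g ∧
      (∀ᶠ p in 𝓝 (T, ((0, c) : ℂ × ℂ)), φ ((Y p).1, p.2) = (Y p).2) ∧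
      Filter.map (fun p => ((Y p).1, p.2)) (𝓝 (T, ((0, c) : ℂ × ℂ))) = 𝓝 (b, (0, c)) := by
  let Φ : ℂ × (ℂ × ℂ) → ℂ × (ℂ × ℂ) := fun p => ((Y p).1, p.2)
  have hΦ : AnalyticAt ℂ Φ (T, (0, c)) := (analyticAt_fst.comp hY).prod analyticAt_snd
  let D := fderiv ℂ Y (T, (0, c))
  have hD : HasFDerivAt Y D (T, (0, c)) := hY.differentiableAt.hasFDerivAt
  let L : (ℂ × (ℂ × ℂ)) →L[ℂ] ℂ × (ℂ × ℂ) :=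
    ((ContinuousLinearMap.fst ℂ ℂ (ℂ × ℂ)).comp D).prod (ContinuousLinearMap.snd ℂ ℂ (ℂ × ℂ))
  have hL : HasFDerivAt Φ L (T, (0, c)) := hD.fst.prodMk hasFDerivAt_snd
  have hD1 : D (1, 0) = lam (T, (0, c)) • field κ₀ κ₁ κₜ κ (b, (0, c)) := by
    have k1 := hY'.self_of_nhds.2
    rw [hYb] at k1
    have k2 : HasDerivAt (fun τ : ℂ => (τ, ((0, c) : ℂ × ℂ))) (1, 0) T :=
      (hasDerivAt_id T).prodMk (hasDerivAt_const T _)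
    exact (hD.comp_hasDerivAt T k2).unique k1
  have hne : fieldQ κ₀ κ₁ κₜ b 0 c ≠ 0 := fieldQ_ne_zero _ _ _ h0 h1 hc
  have hinj : Function.Injective (L : (ℂ × (ℂ × ℂ)) →ₗ[ℂ] ℂ × (ℂ × ℂ)) := by
    refine (injective_iff_map_eq_zero _).2 fun x hx => ?_
    have k2 : x.2 = 0 := congrArg Prod.snd hx
    have k1 : (D x).1 = 0 := congrArg Prod.fst hx
    have ex : x = x.1 • ((1, 0) : ℂ × (ℂ × ℂ)) := by
      refine Prod.ext ?_ ?_
      · simp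
      · simp [k2]
    rw [ex, map_smul, hD1] at k1
    simp only [Prod.smul_fst, smul_eq_mul, field, mul_eq_zero, hne, or_false,
      hY'.self_of_nhds.1] at k1
    exact Prod.ext k1 k2
  let e' := (LinearEquiv.ofInjectiveEndo _ hinj).toContinuousLinearEquiv
  have he' : HasFDerivAt Φ (e' : (ℂ × (ℂ × ℂ)) →L[ℂ] ℂ × (ℂ × ℂ)) (T, (0, c)) := by
    refine hL.congr_fderiv ?_
    exact ContinuousLinearMap.ext fun _ => rfl
  obtain ⟨τ, hτ, hτ0, hτl, hτr⟩ := exists_analyticAt_local_inverse hΦ he'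
  have hΦ0 : Φ (T, (0, c)) = (b, (0, c)) := by simp [Φ, hYb]
  rw [hΦ0] at hτ hτ0 hτr
  have hmap : Filter.map Φ (𝓝 (T, (0, c))) = 𝓝 (b, (0, c)) := by
    have hs := hΦ.hasStrictFDerivAt
    rw [he'.fderiv] at hs
    rw [← hΦ0]
    exact hs.map_nhds_eq_of_equiv
  have hφ : AnalyticAt ℂ (fun p => (Y (τ p)).2) (b, (0, c)) :=
    analyticAt_snd.comp (AnalyticAt.comp (g := Y) (f := τ) (by rw [hτ0]; exact hY) hτ)
  have hsol : ∀ᶠ p in 𝓝 (b, ((0, c) : ℂ × ℂ)), HasDerivAt (fun q => (Y (τ (q, p.2))).2)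
      (slope κ₀ κ₁ κₜ κ p.1 (Y (τ p)).2) p.1 := by
    have hτt : Tendsto τ (𝓝 (b, (0, c))) (𝓝 (T, (0, c))) := by
      have := hτ.continuousAt.tendsto
      rwa [hτ0] at this
    filter_upwards [hτr.eventually_nhds, hτ.eventually_analyticAt, hτt.eventually hY']
      with p k1 k2 k3
    have hl : Tendsto (fun q => (q, p.2)) (𝓝 p.1) (𝓝 p) :=
      (Continuous.prodMk_left (X := ℂ) p.2).tendsto p.1
    have k1' := hl.eventually k1
    have k4 : ∀ᶠ q in 𝓝 p.1, (τ (q, p.2)).2 = p.2 :=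
      k1'.mono fun q hq => by
        have := congrArg Prod.snd hq
        exact this
    have k5 : ∀ᶠ q in 𝓝 p.1, (Y (τ (q, p.2))).1 = q :=
      k1'.mono fun q hq => by
        have := congrArg Prod.fst hq
        exact this
    have k6 : ∀ᶠ q in 𝓝 p.1, Y ((τ (q, p.2)).1, p.2) = Y (τ (q, p.2)) :=
      k4.mono fun q hq => congrArg Y (Prod.ext rfl hq.symm)
    have k7 : DifferentiableAt ℂ (fun q => (τ (q, p.2)).1) p.1 := by
      have : DifferentiableAt ℂ (fun q => τ (q, p.2)) p.1 :=
        DifferentiableAt.comp (g := τ) p.1 k2.differentiableAt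
          (differentiableAt_id.prodMk (differentiableAt_const _))
      exact this.fst
    have e2 : (τ p).2 = p.2 := k4.self_of_nhds
    rw [e2] at k3
    set d := deriv (fun q => (τ (q, p.2)).1) p.1 with hd
    have k8 : HasDerivAt (fun q => Y (τ (q, p.2)))
        (d • lam (τ p) • field κ₀ κ₁ κₜ κ (Y (τ p))) p.1 :=
      (HasDerivAt.scomp p.1 (g₁ := fun t => Y (t, p.2)) k3.2
        k7.hasDerivAt).congr_of_eventuallyEq (EventuallyEq.symm k6)
    have k9 := HasDerivAt.unique (f := fun q => q)
      (HasDerivAt.congr_of_eventuallyEq k8.fst (EventuallyEq.symm k5)) (hasDerivAt_id p.1)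
    have k10 : HasDerivAt (fun q => (Y (τ (q, p.2))).2)
        (d • lam (τ p) • field κ₀ κ₁ κₜ κ (Y (τ p))).2 p.1 :=
      (ContinuousLinearMap.snd ℂ ℂ (ℂ × ℂ)).hasFDerivAt.comp_hasDerivAt p.1 k8
    simp only [Prod.smul_fst, Prod.smul_snd, field, smul_eq_mul] at k9 k10
    refine k10.congr_deriv ?_
    have e1 : (Y (τ p)).1 = p.1 := k5.self_of_nhds
    rw [e1] at k9 ⊢
    -- The first component of the reparametrised solution is `q`, with derivative one. Hence the
    -- factor `lam` of the time change disappears from the slope.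
    have k11 : d * lam (τ p) = (fieldQ κ₀ κ₁ κₜ p.1 (Y (τ p)).2.1 (Y (τ p)).2.2)⁻¹ := by
      refine eq_inv_of_mul_eq_one_left ?_
      rw [mul_assoc]
      exact k9
    rw [smul_smul, k11, slope, Prod.smul_mk, smul_eq_mul, smul_eq_mul, inv_mul_eq_div,
      inv_mul_eq_div]
  have hrel : ∀ᶠ p in 𝓝 (T, ((0, c) : ℂ × ℂ)), (Y (τ ((Y p).1, p.2))).2 = (Y p).2 := by
    filter_upwards [hτl] with p hp
    change (Y (τ (Φ p))).2 = _
    rw [hp]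
  have hb0 : (Y (τ (b, (0, c)))).2 = (0, c) := by rw [hτ0, hYb]
  have hinc : AnalyticAt ℂ (fun w : ℂ × ℂ => (b, w)) (0, c) := analyticAt_const.prod analyticAt_id
  let f : LocalSelfMap ((0, c) : ℂ × ℂ) := ⟨fun w => (Y (τ (b, w))).2,
    AnalyticAt.comp (g := fun p => (Y (τ p)).2) (f := fun w : ℂ × ℂ => (b, w)) hφ hinc, hb0⟩
  have hfe : HasFDerivAt f.1 (e : (ℂ × ℂ) →L[ℂ] (ℂ × ℂ)) (0, c) := by
    have hA := hφ.differentiableAt.hasFDerivAt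
    set A := fderiv ℂ (fun p => (Y (τ p)).2) (b, (0, c))
    -- The slope vanishes on `m = 0`, so adjusting the time at which the curve meets `q = b` does
    -- not alter the derivative transverse to the leaf.
    have hA1 : A (1, 0) = 0 := by
      have k1 := hsol.self_of_nhds
      rw [hb0, slope_zero] at k1
      have k2 : HasDerivAt (fun τ : ℂ => (τ, ((0, c) : ℂ × ℂ))) (1, 0) b :=
        (hasDerivAt_id b).prodMk (hasDerivAt_const b _)
      exact HasDerivAt.unique (f := fun q => (Y (τ (q, ((0, c) : ℂ × ℂ)))).2)
        (HasFDerivAt.comp_hasDerivAt (l := fun p => (Y (τ p)).2) b hA k2) k1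
    have hYw : HasFDerivAt (fun w : ℂ × ℂ => (Y (T, w)).1)
        ((ContinuousLinearMap.fst ℂ ℂ (ℂ × ℂ)).comp (D.comp
          (ContinuousLinearMap.inr ℂ ℂ (ℂ × ℂ)))) (0, c) :=
      (hD.comp (0, c) ((hasFDerivAt_const T _).prodMk (hasFDerivAt_id _))).fst
    have k3 : HasFDerivAt (fun w : ℂ × ℂ => (Y (τ ((Y (T, w)).1, w))).2) (A.comp
        (((ContinuousLinearMap.fst ℂ ℂ (ℂ × ℂ)).comp (D.comp
          (ContinuousLinearMap.inr ℂ ℂ (ℂ × ℂ)))).prod (ContinuousLinearMap.id ℂ _))) (0, c) := by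
      refine HasFDerivAt.comp (g := fun p => (Y (τ p)).2)
        (f := fun w : ℂ × ℂ => ((Y (T, w)).1, w)) _ ?_ (hYw.prodMk (hasFDerivAt_id _))
      rw [hYb]
      exact hA
    have k4 : (fun w : ℂ × ℂ => (Y (τ ((Y (T, w)).1, w))).2) =ᶠ[𝓝 (0, c)]
        fun w => (Y (T, w)).2 :=
      (Continuous.prodMk_right (X := ℂ) (Y := ℂ × ℂ) T).continuousAt.eventually hrel
    have k5 := k3.unique (he.congr_of_eventuallyEq k4)
    have k6 : HasFDerivAt f.1 (A.comp (ContinuousLinearMap.inr ℂ ℂ (ℂ × ℂ))) (0, c) :=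
      HasFDerivAt.comp (g := fun p => (Y (τ p)).2) (f := fun w : ℂ × ℂ => (b, w)) _ hA
        ((hasFDerivAt_const b _).prodMk (hasFDerivAt_id _))
    refine k6.congr_fderiv ?_
    rw [← k5]
    refine ContinuousLinearMap.ext fun x => ?_
    have : ((D (0, x)).1, x) = (D (0, x)).1 • ((1, 0) : ℂ × (ℂ × ℂ)) + (0, x) := by
      ext <;> simp
    change A (0, x) = A ((D (0, x)).1, x)
    rw [this, map_add, map_smul, hA1, smul_zero, zero_add]
  obtain ⟨g, hg⟩ := exists_diffGerm_of_hasFDerivAt f hfe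
  exact ⟨fun p => (Y (τ p)).2, g, ⟨hφ, hsol, f, hg.symm, Eventually.of_forall fun _ => rfl⟩, hrel,
    hmap⟩

end

section

variable (κ₀ κ₁ κₜ κ : ℂ) {c : ℂ}

/-! ### The flat system of the foliation -/

theorem exists_isChart_one {q₀ : ℂ} (h0 : q₀ ≠ 0) (h1 : q₀ ≠ 1) (hc : q₀ ≠ c) :
    ∃ φ, IsChart (c := c) κ₀ κ₁ κₜ κ φ q₀ 1 := by
  let q : MvPolynomial (Fin 3) ℂ := MvPolynomial.X 0
  let m : MvPolynomial (Fin 3) ℂ := MvPolynomial.X 1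
  let t : MvPolynomial (Fin 3) ℂ := MvPolynomial.X 2
  let C : ℂ → MvPolynomial (Fin 3) ℂ := fun a => MvPolynomial.C a
  let V : Fin 3 → MvPolynomial (Fin 3) ℂ :=
    ![C 2 * (q * (q - C 1) * (q - t)) + (C κ₀ * (q - C 1) * (q - t) + C κ₁ * q * (q - t) +
        (C κₜ + C 1) * q * (q - C 1)) * m,
      ((q - C 1) * (q - t) + q * (q - t) + q * (q - C 1) + (C κ₀ * ((q - C 1) + (q - t)) +
        C κ₁ * (q + (q - t)) + (C κₜ + C 1) * (q + (q - C 1))) * m + C κ * m ^ 2) * m,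
      t * (t - C 1) * m]
  obtain ⟨fl, hfl, hfl0, hfl'⟩ := exists_polynomial_flow V ![q₀, 0, c]
  let cv : (Fin 3 → ℂ) →L[ℂ] ℂ × (ℂ × ℂ) :=
    (ContinuousLinearMap.proj (R := ℂ) (φ := fun _ : Fin 3 => ℂ) 0).prod
      ((ContinuousLinearMap.proj (R := ℂ) (φ := fun _ : Fin 3 => ℂ) 1).prod
        (ContinuousLinearMap.proj (R := ℂ) (φ := fun _ : Fin 3 => ℂ) 2))
  let st : ℂ × (ℂ × ℂ) → (Fin 3 → ℂ) × ℂ := fun p => (![q₀, p.2.1, p.2.2], p.1)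
  have hst : ∀ p, AnalyticAt ℂ st p := fun p => by
    refine AnalyticAt.prod (analyticAt_pi_iff.2 fun i => ?_) analyticAt_fst
    fin_cases i
    · exact analyticAt_const
    · exact analyticAt_fst.comp analyticAt_snd
    · exact analyticAt_snd.comp analyticAt_snd
  let Y : ℂ × (ℂ × ℂ) → ℂ × (ℂ × ℂ) := fun p => cv (fl (st p))
  have hY : AnalyticAt ℂ Y (0, (0, c)) := by
    have : AnalyticAt ℂ (fun p => fl (st p)) (0, (0, c)) :=
      AnalyticAt.comp (g := fl) (f := st) hfl (hst _)
    exact AnalyticAt.comp (cv.analyticAt _) this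
  have hst0 : Tendsto st (𝓝 (0, ((0, c) : ℂ × ℂ))) (𝓝 (![q₀, 0, c], 0)) := (hst _).continuousAt
  have hY' : ∀ᶠ p in 𝓝 ((0 : ℂ), ((0, c) : ℂ × ℂ)), (fun _ => (1 : ℂ)) p ≠ 0 ∧
      HasDerivAt (fun τ => Y (τ, p.2))
        ((fun _ => (1 : ℂ)) p • field κ₀ κ₁ κₜ κ (Y p)) p.1 := by
    filter_upwards [hst0.eventually hfl'] with p hp
    refine ⟨one_ne_zero, ?_⟩
    rw [one_smul]
    have := (cv.hasFDerivAt (x := fl (st p))).comp_hasDerivAt p.1 hp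
    refine this.congr_deriv ?_
    simp [cv, V, field, fieldQ, fieldM, fieldT, polyE, polyF, polyE', polyF', Y, q, m, t, C]
  have hY0 : ∀ᶠ w in 𝓝 ((0, c) : ℂ × ℂ), Y (0, w) = (q₀, w) := by
    have hc : Continuous fun w : ℂ × ℂ => ![q₀, w.1, w.2] := by fun_prop
    filter_upwards [(hc.tendsto (0, c)).eventually hfl0] with w hw
    change cv (fl (![q₀, w.1, w.2], 0)) = _
    rw [hw]
    rfl
  have he : HasFDerivAt (fun w => (Y (0, w)).2)
      ((ContinuousLinearEquiv.refl ℂ (ℂ × ℂ) : (ℂ × ℂ) ≃L[ℂ] (ℂ × ℂ)) :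
        (ℂ × ℂ) →L[ℂ] (ℂ × ℂ)) (0, c) :=
    (hasFDerivAt_id _).congr_of_eventuallyEq (hY0.mono fun w hw => congrArg Prod.snd hw)
  obtain ⟨φ, g, hφ, hrel, -⟩ := exists_isChart hY h0 h1 hc hY0.self_of_nhds hY' he
  obtain ⟨a1, a2, f, -, -⟩ := hφ
  refine ⟨φ, a1, a2, ⟨id, analyticAt_id, rfl⟩, rfl, ?_⟩
  have hinc : Tendsto (fun w : ℂ × ℂ => ((0 : ℂ), w)) (𝓝 (0, c)) (𝓝 (0, (0, c))) :=
    (Continuous.prodMk_right (X := ℂ) (Y := ℂ × ℂ) 0).tendsto _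
  filter_upwards [hY0, hinc.eventually hrel] with w k1 k2
  simp only [k1] at k2
  exact k2

variable {κ₀ κ₁ κₜ κ} {φ : ℂ × (ℂ × ℂ) → ℂ × ℂ} {b : ℂ}

/-- The leaf itself is the constant solution, so nearby cross-sections keep the point `(0, c)`
fixed. The transverse derivative is the identity at `b`, and invertibility is an open condition. -/
theorem IsChart.eventually_exists (h : IsChart (c := c) κ₀ κ₁ κₜ κ φ b 1)
    (h0 : b ≠ 0) (h1 : b ≠ 1) (hc : b ≠ c) :
    ∀ᶠ b' in 𝓝 b, ∃ g, IsChart (c := c) κ₀ κ₁ κₜ κ φ b' g := by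
  have hb := h.apply_base
  obtain ⟨a1, a2, f, hf1, hf⟩ := h
  have hfid : ∀ᶠ w in 𝓝 ((0, c) : ℂ × ℂ), φ (b, w) = w := by
    have : f.1 =ᶠ[𝓝 (0, c)] id :=
      germOf_eq_iff (g := ⟨id, analyticAt_id, rfl⟩).1 hf1
    filter_upwards [hf, this] with w k1 k2
    rw [k1, k2, id]
  have hl : Tendsto (fun q : ℂ => (q, ((0, c) : ℂ × ℂ))) (𝓝 b) (𝓝 (b, (0, c))) :=
    (Continuous.prodMk_left (X := ℂ) ((0, c) : ℂ × ℂ)).tendsto b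
  have hbase : ∀ᶠ q in 𝓝 b, φ (q, (0, c)) = (0, c) := by
    have key : (fun p : ℂ × Unit => φ (p.1, (0, c))) =ᶠ[𝓝 (b, ())] fun _ => (0, c) := by
      have hl' : Tendsto (fun p : ℂ × Unit => (p.1, ((0, c) : ℂ × ℂ))) (𝓝 (b, ()))
          (𝓝 (b, (0, c))) := (Continuous.prodMk continuous_fst continuous_const).tendsto _
      refine eventually_eq_of_hasDerivAt (F := slope κ₀ κ₁ κₜ κ) ?_
        (ContinuousAt.comp (g := φ) (f := fun p : ℂ × Unit => (p.1, ((0, c) : ℂ × ℂ)))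
          a1.continuousAt hl') continuousAt_const (hl'.eventually a2) ?_ ?_
      · simp only [hb]
        exact analyticAt_slope _ _ _ _ (fieldQ_ne_zero _ _ _ h0 h1 hc)
      · refine Eventually.of_forall fun p => ?_
        rw [slope_zero]
        exact hasDerivAt_const _ _
      · exact Eventually.of_forall fun _ => hb
    exact (Continuous.prodMk_left (X := ℂ) ()).continuousAt.eventually key
  have hd : ∀ q, AnalyticAt ℂ φ (q, (0, c)) → HasFDerivAt (fun w => φ (q, w))
      ((fderiv ℂ φ (q, (0, c))).comp (ContinuousLinearMap.inr ℂ ℂ (ℂ × ℂ))) (0, c) :=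
    fun q hq => HasFDerivAt.comp (g := φ) (f := fun w : ℂ × ℂ => (q, w)) _
      hq.differentiableAt.hasFDerivAt ((hasFDerivAt_const q _).prodMk (hasFDerivAt_id _))
  have hid : (fderiv ℂ φ (b, (0, c))).comp (ContinuousLinearMap.inr ℂ ℂ (ℂ × ℂ)) =
      ((ContinuousLinearEquiv.refl ℂ (ℂ × ℂ) : (ℂ × ℂ) ≃L[ℂ] (ℂ × ℂ)) :
        (ℂ × ℂ) →L[ℂ] (ℂ × ℂ)) :=
    (hd b a1).unique ((hasFDerivAt_id _).congr_of_eventuallyEq hfid)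
  have hcont : ContinuousAt (fun q => (fderiv ℂ φ (q, (0, c))).comp
      (ContinuousLinearMap.inr ℂ ℂ (ℂ × ℂ))) b := by
    have k1 : ContinuousAt (fun q => fderiv ℂ φ (q, (0, c))) b :=
      ContinuousAt.comp (g := fderiv ℂ φ) (f := fun q : ℂ => (q, ((0, c) : ℂ × ℂ)))
        a1.fderiv.continuousAt hl
    exact k1.clm_comp continuousAt_const
  have hinv := hcont.eventually (p := fun x => x ∈ Set.range
    ((↑) : ((ℂ × ℂ) ≃L[ℂ] (ℂ × ℂ)) → (ℂ × ℂ) →L[ℂ] (ℂ × ℂ))) (by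
      simp only [hid]
      exact ContinuousLinearEquiv.nhds _)
  filter_upwards [hbase, hinv, hl.eventually a1.eventually_analyticAt,
    hl.eventually a2.eventually_nhds] with q k1 k2 k3 k4
  obtain ⟨e, he⟩ := k2
  let f' : LocalSelfMap ((0, c) : ℂ × ℂ) := ⟨fun w => φ (q, w),
    AnalyticAt.comp (g := φ) (f := fun w : ℂ × ℂ => (q, w)) k3
      (analyticAt_const.prod analyticAt_id), k1⟩
  have hf' : HasFDerivAt f'.1 (e : (ℂ × ℂ) →L[ℂ] (ℂ × ℂ)) (0, c) := by
    rw [he]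
    exact hd q k3
  obtain ⟨g, hg⟩ := exists_diffGerm_of_hasFDerivAt f' hf'
  exact ⟨g, k3, k4, f', hg.symm, Eventually.of_forall fun _ => rfl⟩

variable (κ₀ κ₁ κₜ κ)

/-- An analytic family of solutions near a point of the leaf, with identical initial values. -/
def baseChart (x : Leaf c) : ℂ × (ℂ × ℂ) → ℂ × ℂ :=
  (exists_isChart_one κ₀ κ₁ κₜ κ x.2.1 x.2.2.1 x.2.2.2).choose

theorem baseChart_spec (x : Leaf c) : IsChart (c := c) κ₀ κ₁ κₜ κ (baseChart κ₀ κ₁ κₜ κ x) x 1 :=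
  (exists_isChart_one κ₀ κ₁ κₜ κ x.2.1 x.2.2.1 x.2.2.2).choose_spec

/-- The neighbourhood of `x` on which the germs of `baseChart x` exist. -/
def baseDomain (x : Leaf c) : Set (Leaf c) :=
  interior {b : Leaf c | ∃ g, IsChart (c := c) κ₀ κ₁ κₜ κ (baseChart κ₀ κ₁ κₜ κ x) b g}

open Classical in
/-- The germ of `baseChart x` on the cross-section through `b`. -/
def baseGerm (x b : Leaf c) : DiffGerm ((0, c) : ℂ × ℂ) :=
  if h : ∃ g, IsChart (c := c) κ₀ κ₁ κₜ κ (baseChart κ₀ κ₁ κₜ κ x) b g then h.choose else 1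

theorem mem_baseDomain (x : Leaf c) : x ∈ baseDomain κ₀ κ₁ κₜ κ x := by
  rw [baseDomain, mem_interior_iff_mem_nhds]
  exact continuous_subtype_val.continuousAt.eventually
    ((baseChart_spec κ₀ κ₁ κₜ κ x).eventually_exists x.2.1 x.2.2.1 x.2.2.2)

theorem baseGerm_spec {x b : Leaf c} (h : b ∈ baseDomain κ₀ κ₁ κₜ κ x) :
    IsChart κ₀ κ₁ κₜ κ (baseChart κ₀ κ₁ κₜ κ x) b (baseGerm κ₀ κ₁ κₜ κ x b) := by
  have h' : ∃ g, IsChart (c := c) κ₀ κ₁ κₜ κ (baseChart κ₀ κ₁ κₜ κ x) b g :=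
    interior_subset (s := {b : Leaf c | ∃ g, IsChart (c := c) κ₀ κ₁ κₜ κ
      (baseChart κ₀ κ₁ κₜ κ x) b g}) h
  rw [baseGerm, dif_pos h']
  exact h'.choose_spec

theorem eventually_mem_baseDomain {x b : Leaf c} (h : b ∈ baseDomain κ₀ κ₁ κₜ κ x) :
    ∀ᶠ b' in 𝓝 b, b' ∈ baseDomain κ₀ κ₁ κₜ κ x := isOpen_interior.mem_nhds h

/-- The flat system of germs of solutions of the foliation along the leaf at infinity. -/
def foliation : FlatSystem (Leaf c) (DiffGerm ((0, c) : ℂ × ℂ)) where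
  U := baseDomain κ₀ κ₁ κₜ κ
  isOpen_U _ := isOpen_interior
  mem_U := mem_baseDomain κ₀ κ₁ κₜ κ
  S := baseGerm κ₀ κ₁ κₜ κ
  S_self x := (baseGerm_spec κ₀ κ₁ κₜ κ (mem_baseDomain κ₀ κ₁ κₜ κ x)).unique
    (baseChart_spec κ₀ κ₁ κₜ κ x)
  locConst x y b hb := by
    filter_upwards [continuous_subtype_val.continuousAt.eventually
      ((baseGerm_spec κ₀ κ₁ κₜ κ hb.1).eventually_inv_mul (baseGerm_spec κ₀ κ₁ κₜ κ hb.2)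
        b.2.1 b.2.2.1 b.2.2.2), eventually_mem_baseDomain κ₀ κ₁ κₜ κ hb.1,
      eventually_mem_baseDomain κ₀ κ₁ κₜ κ hb.2] with b' k1 k2 k3
    exact k1 _ _ (baseGerm_spec κ₀ κ₁ κₜ κ k2) (baseGerm_spec κ₀ κ₁ κₜ κ k3)

variable {κ₀ κ₁ κₜ κ}

/-- This frees parallelism from the chosen `baseChart`s: any analytic family of solutions whatever
may be used to check it. -/
theorem isParallel_foliation_iff {A : Type*} [TopologicalSpace A] {f : A → Leaf c}
    (hf : Continuous f) {g : A → DiffGerm ((0, c) : ℂ × ℂ)} :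
    (foliation κ₀ κ₁ κₜ κ).IsParallel f g ↔
      ∀ a₀, ∃ φ, ∀ᶠ a in 𝓝 a₀, IsChart κ₀ κ₁ κₜ κ φ (f a) (g a) := by
  constructor
  · intro h a₀
    obtain ⟨x, k, hx, hk⟩ := h a₀
    obtain ⟨K, hK⟩ := exists_germOf_eq (k : SelfGerm ((0, c) : ℂ × ℂ))
    refine ⟨fun p => baseChart κ₀ κ₁ κₜ κ x (p.1, K.1 p.2), ?_⟩
    filter_upwards [hk, hf.continuousAt.eventually (eventually_mem_baseDomain κ₀ κ₁ κₜ κ hx)]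
      with a k1 k2
    rw [k1]
    exact (baseGerm_spec κ₀ κ₁ κₜ κ k2).mul hK
  · intro h a₀
    obtain ⟨φ, hφ⟩ := h a₀
    have hx := mem_baseDomain κ₀ κ₁ κₜ κ (f a₀)
    refine ⟨f a₀, g a₀, hx, ?_⟩
    have k1 := (baseChart_spec κ₀ κ₁ κₜ κ (f a₀)).eventually_inv_mul hφ.self_of_nhds
      (f a₀).2.1 (f a₀).2.2.1 (f a₀).2.2.2
    filter_upwards [(continuous_subtype_val.comp hf).continuousAt.eventually k1, hφ,
      hf.continuousAt.eventually (eventually_mem_baseDomain κ₀ κ₁ κₜ κ hx)] with a k2 k3 k4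
    have := k2 _ _ (baseGerm_spec κ₀ κ₁ κₜ κ k4) k3
    rw [inv_one, one_mul, inv_mul_eq_iff_eq_mul] at this
    exact this

end

section

variable {κ₀ κ₁ κₜ κ c : ℂ}

/-! ### Lifts of paths and the holonomy representation -/

theorem IsLift.continuous {a b : Leaf c} {γ : Path a b} {y : unitInterval → ℂ × ℂ}
    (h : IsLift κ₀ κ₁ κₜ κ γ y) : Continuous y := by
  refine continuous_iff_continuousAt.2 fun s => ?_
  obtain ⟨-, -, -, φ, hφ, hy⟩ := h s
  have hγ : ContinuousAt (fun s => (γ s : ℂ)) s :=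
    (continuous_subtype_val.comp γ.continuous).continuousAt
  exact (ContinuousAt.comp (g := φ) (f := fun s => (γ s : ℂ)) hφ.self_of_nhds.continuousAt
    hγ).congr (EventuallyEq.symm hy)

/-- The set of agreement is closed by continuity, open by local uniqueness for the slope equation,
and contains `0`. -/
theorem IsLift.eq_of_apply_zero {a b : Leaf c} {γ : Path a b} {y y' : unitInterval → ℂ × ℂ}
    (h : IsLift κ₀ κ₁ κₜ κ γ y) (h' : IsLift κ₀ κ₁ κₜ κ γ y') (h0 : y 0 = y' 0) : y = y' := by
  have hclosed : IsClosed {s | y s = y' s} := isClosed_eq h.continuous h'.continuous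
  have hopen : IsOpen {s | y s = y' s} := by
    refine isOpen_iff_mem_nhds.2 fun s (hs : y s = y' s) => ?_
    obtain ⟨-, -, hQ, φ, hφ, hy⟩ := h s
    obtain ⟨-, -, -, φ', hφ', hy'⟩ := h' s
    have e : y s = φ (γ s) := hy.self_of_nhds
    have e' : y' s = φ' (γ s) := hy'.self_of_nhds
    have key : (fun p : ℂ × Unit => φ p.1) =ᶠ[𝓝 ((γ s : ℂ), ())] fun p => φ' p.1 := by
      have hfst : Tendsto (fun p : ℂ × Unit => p.1) (𝓝 ((γ s : ℂ), ())) (𝓝 (γ s : ℂ)) :=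
        continuous_fst.tendsto _
      refine eventually_eq_of_hasDerivAt (F := slope κ₀ κ₁ κₜ κ) ?_
        (ContinuousAt.comp (g := φ) (f := fun p : ℂ × Unit => p.1)
          hφ.self_of_nhds.continuousAt hfst)
        (ContinuousAt.comp (g := φ') (f := fun p : ℂ × Unit => p.1)
          hφ'.self_of_nhds.continuousAt hfst)
        (hfst.eventually hφ) (hfst.eventually hφ') ?_
      · rw [e] at hQ
        exact analyticAt_slope _ _ _ _ hQ
      · exact Eventually.of_forall fun _ => by rw [← e, ← e', hs]
    have hγ : Tendsto (fun s => ((γ s : ℂ), ())) (𝓝 s) (𝓝 ((γ s : ℂ), ())) :=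
      ((continuous_subtype_val.comp γ.continuous).prodMk continuous_const).tendsto s
    filter_upwards [hy, hy', hγ.eventually key] with r k1 k2 k3
    exact k1.trans (k3.trans k2.symm)
  have huniv : {s | y s = y' s} = Set.univ := IsClopen.eq_univ ⟨hclosed, hopen⟩ ⟨0, h0⟩
  funext s
  exact (Set.eq_univ_iff_forall.1 huniv) s

/-- Finitely many charts cover the path by compactness. For `z` near `(0, c)` they avoid the
degenerate set and agree on overlaps, so their values at `z` glue to a lift. -/
theorem eventually_exists_lift (hc0 : c ≠ 0) (hc1 : c ≠ 1) {a b : Leaf c} {γ : Path a b}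
    {g : unitInterval → DiffGerm ((0, c) : ℂ × ℂ)} (hg : (foliation κ₀ κ₁ κₜ κ).IsParallel γ g)
    (hg0 : g 0 = 1) {f : LocalSelfMap ((0, c) : ℂ × ℂ)}
    (hf : germOf f = (g 1 : SelfGerm ((0, c) : ℂ × ℂ))) :
    ∀ᶠ z in 𝓝 ((0, c) : ℂ × ℂ), ∃ y : unitInterval → ℂ × ℂ,
      IsLift κ₀ κ₁ κₜ κ γ y ∧ y 0 = z ∧ y 1 = f.1 z := by
  have hγc : Continuous fun s => (γ s : ℂ) := continuous_subtype_val.comp γ.continuous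
  have hpar := (isParallel_foliation_iff γ.continuous).1 hg
  choose ψ hψ using hpar
  -- The parameter sets are closed, hence compact, so that a condition valid near each point of `K`
  -- holds for all `z` in one common neighbourhood.
  have hK : ∀ s, ∃ K ∈ 𝓝 s, IsClosed K ∧ ∀ s' ∈ K, IsChart κ₀ κ₁ κₜ κ (ψ s) (γ s') (g s') :=
    fun s => by
      obtain ⟨K, hK, hKc, hKs⟩ := exists_mem_nhds_isClosed_subset (hψ s)
      exact ⟨K, hK, hKc, fun s' hs' => hKs hs'⟩
  choose K hKn hKc hKψ using hK
  obtain ⟨F, hF⟩ := CompactSpace.elim_nhds_subcover (fun s => interior (K s))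
    fun s => interior_mem_nhds.2 (hKn s)
  have hcov : ∀ s, ∃ i ∈ F, s ∈ interior (K i) := fun s => by
    have : s ∈ (⊤ : Set unitInterval) := trivial
    rw [← hF] at this
    simpa using this
  choose idx hidxF hidx using hcov
  have hγz : ∀ s : unitInterval, Tendsto
      (fun x : (ℂ × ℂ) × unitInterval => ((γ x.2 : ℂ), x.1)) (𝓝 ((0, c), s))
      (𝓝 ((γ s : ℂ), (0, c))) := fun s =>
    ((hγc.comp continuous_snd).prodMk continuous_fst).tendsto _
  have hgood : ∀ i, ∀ᶠ z in 𝓝 ((0, c) : ℂ × ℂ), ∀ s ∈ K i,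
      (ψ i (γ s, z)).2 ≠ 0 ∧ (ψ i (γ s, z)).2 ≠ 1 ∧
      fieldQ κ₀ κ₁ κₜ (γ s : ℂ) (ψ i (γ s, z)).1 (ψ i (γ s, z)).2 ≠ 0 ∧
      ∀ᶠ q in 𝓝 (γ s : ℂ), HasDerivAt (fun q => ψ i (q, z))
        (slope κ₀ κ₁ κₜ κ q (ψ i (q, z))) q := by
    intro i
    refine (hKc i).isCompact.eventually_forall_of_forall_eventually fun s hs => ?_
    have hch := hKψ i s hs
    have hc := hch.1.continuousAt
    have hcomp : Tendsto (fun x : (ℂ × ℂ) × unitInterval => ψ i (γ x.2, x.1)) (𝓝 ((0, c), s))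
        (𝓝 (0, c)) := by
      have := hc.tendsto.comp (hγz s)
      rwa [hch.apply_base] at this
    have h2 : Tendsto (fun x : (ℂ × ℂ) × unitInterval => (ψ i (γ x.2, x.1)).2) (𝓝 ((0, c), s))
        (𝓝 c) := (continuous_snd.tendsto _).comp hcomp
    have hQc : Continuous fun x : ℂ × (ℂ × ℂ) => fieldQ κ₀ κ₁ κₜ x.1 x.2.1 x.2.2 := by
      unfold fieldQ polyE polyF
      fun_prop
    have h3 : Tendsto (fun x : (ℂ × ℂ) × unitInterval => fieldQ κ₀ κ₁ κₜ (γ x.2 : ℂ)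
        (ψ i (γ x.2, x.1)).1 (ψ i (γ x.2, x.1)).2) (𝓝 ((0, c), s))
        (𝓝 (fieldQ κ₀ κ₁ κₜ (γ s : ℂ) 0 c)) := by
      have ha : Tendsto (fun x : (ℂ × ℂ) × unitInterval => (γ x.2 : ℂ)) (𝓝 ((0, c), s))
          (𝓝 (γ s : ℂ)) := (hγc.comp continuous_snd).tendsto ((0, c), s)
      exact Tendsto.comp (f := fun x : (ℂ × ℂ) × unitInterval => ((γ x.2 : ℂ), ψ i (γ x.2, x.1)))
        (hQc.tendsto ((γ s : ℂ), (0, c))) (ha.prodMk_nhds hcomp)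
    have hq := (hγz s).eventually hch.2.1.eventually_nhds
    filter_upwards [h2.eventually_ne hc0, h2.eventually_ne hc1,
      h3.eventually_ne (fieldQ_ne_zero κ₀ κ₁ κₜ (γ s).2.1 (γ s).2.2.1 (γ s).2.2.2), hq]
      with x k1 k2 k3 k4
    exact ⟨k1, k2, k3, (Continuous.prodMk_left (X := ℂ) x.1).continuousAt.eventually k4⟩
  have hagree : ∀ i j, ∀ᶠ z in 𝓝 ((0, c) : ℂ × ℂ), ∀ s ∈ K i ∩ K j,
      ψ i (γ s, z) = ψ j (γ s, z) := by
    intro i j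
    refine ((hKc i).inter (hKc j)).isCompact.eventually_forall_of_forall_eventually
      fun s hs => ?_
    exact (hγz s).eventually ((hKψ i s hs.1).eventually_eq (hKψ j s hs.2)
      (γ s).2.1 (γ s).2.2.1 (γ s).2.2.2)
  have hstart : ∀ᶠ z in 𝓝 ((0, c) : ℂ × ℂ), ψ (idx 0) (γ 0, z) = z := by
    obtain ⟨-, -, f', hf', h⟩ := hKψ (idx 0) 0 (interior_subset (hidx 0))
    rw [hg0] at hf'
    have hid : f'.1 =ᶠ[𝓝 (0, c)] id := germOf_eq_iff (g := ⟨id, analyticAt_id, rfl⟩).1 hf'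
    filter_upwards [h, hid] with w k1 k2
    rw [k1, k2, id]
  have hend : ∀ᶠ z in 𝓝 ((0, c) : ℂ × ℂ), ψ (idx 1) (γ 1, z) = f.1 z := by
    obtain ⟨-, -, f', hf', h⟩ := hKψ (idx 1) 1 (interior_subset (hidx 1))
    filter_upwards [h, germOf_eq_iff.1 (hf'.trans hf.symm)] with w k1 k2
    rw [k1, k2]
  have hgood' := (eventually_all_finset F).2 fun i _ => hgood i
  have hagree' := (eventually_all_finset F).2 fun i _ =>
    (eventually_all_finset F).2 fun j _ => hagree i j
  filter_upwards [hgood', hagree', hstart, hend] with z k1 k2 k3 k4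
  refine ⟨fun s => ψ (idx s) (γ s, z), fun s => ?_, k3, k4⟩
  obtain ⟨a1, a2, a3, a4⟩ := k1 (idx s) (hidxF s) s (interior_subset (hidx s))
  refine ⟨a1, a2, a3, fun q => ψ (idx s) (q, z), a4, ?_⟩
  -- Nearby parameters may have selected another chart; the agreement on overlaps lets the chart of
  -- `s` serve for all of them.
  filter_upwards [isOpen_interior.mem_nhds (hidx s)] with r hr
  exact k2 _ (hidxF r) _ (hidxF s) r ⟨interior_subset (hidx r), interior_subset hr⟩

/-- Transport in the flat system produces lifts from every nearby point, and uniqueness of lifts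
forces any other holonomy germ to coincide with it. -/
theorem isHolonomy_iff (hc0 : c ≠ 0) (hc1 : c ≠ 1) {P : Leaf c} (γ : Path P P)
    (h : DiffGerm ((0, c) : ℂ × ℂ)) :
    IsHolonomy κ₀ κ₁ κₜ κ γ h ↔ h = (foliation κ₀ κ₁ κₜ κ).hol γ := by
  obtain ⟨g, hg, hg0⟩ :=
    (foliation κ₀ κ₁ κₜ κ).exists_isParallel (f := γ) γ.continuous 0 1
  have hol : (foliation κ₀ κ₁ κₜ κ).hol γ = g 1 := by
    rw [hg.hol_eq, hg0, inv_one, mul_one]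
  obtain ⟨f', hf'⟩ := exists_germOf_eq (g 1 : SelfGerm ((0, c) : ℂ × ℂ))
  have hlift := eventually_exists_lift hc0 hc1 hg hg0 hf'
  rw [hol]
  constructor
  · rintro ⟨f, hf, hy⟩
    refine Units.ext ?_
    rw [← hf, ← hf', germOf_eq_iff]
    filter_upwards [hy, hlift] with z k1 k2
    obtain ⟨y, hy, hy0, hy1⟩ := k1
    obtain ⟨y', hy', hy0', hy1'⟩ := k2
    rw [← hy1, ← hy1', hy.eq_of_apply_zero hy' (hy0.trans hy0'.symm)]
  · rintro rfl
    exact ⟨f', hf', hlift⟩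

theorem isHolonomyRepresentation_holHom (hc0 : c ≠ 0) (hc1 : c ≠ 1) (P : Leaf c) :
    IsHolonomyRepresentation κ₀ κ₁ κₜ κ ((foliation κ₀ κ₁ κₜ κ).holHom P) :=
  fun γ h => isHolonomy_iff hc0 hc1 γ h

end

section

variable {κ₀ κ₁ κₜ κ c : ℂ}

/-! ### Families of solutions along a curve in the leaf at infinity -/

/-- At `ε = 0` the Jacobian is triangular with diagonal entries `μ` and `1`. Thus `(ε, t)` are
genuine transverse parameters, even when `m = ε μ` and `μ ≠ 1`. -/
theorem exists_hasFDerivAt_equiv {μ θ : ℂ × ℂ → ℂ} (hμ : DifferentiableAt ℂ μ (0, c))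
    (hθ : DifferentiableAt ℂ θ (0, c)) (hμ0 : μ (0, c) ≠ 0)
    (hθ0 : ∀ᶠ t in 𝓝 c, θ (0, t) = t) :
    ∃ e : (ℂ × ℂ) ≃L[ℂ] (ℂ × ℂ), HasFDerivAt (fun w : ℂ × ℂ => (w.1 * μ w, θ w))
      (e : (ℂ × ℂ) →L[ℂ] (ℂ × ℂ)) (0, c) := by
  have hm := HasFDerivAt.mul (𝕜 := ℂ) (x := ((0, c) : ℂ × ℂ)) (c := fun w : ℂ × ℂ => w.1)
    hasFDerivAt_fst hμ.hasFDerivAt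
  have hD := hm.prodMk hθ.hasFDerivAt
  set D' := fderiv ℂ θ (0, c)
  have hD'1 : D' (0, 1) = 1 := by
    have k1 : HasDerivAt (fun t : ℂ => ((0 : ℂ), t)) (0, 1) c :=
      (hasDerivAt_const c _).prodMk (hasDerivAt_id c)
    exact (HasFDerivAt.comp_hasDerivAt (l := θ) (f := fun t : ℂ => ((0 : ℂ), t)) c
      hθ.hasFDerivAt k1).unique ((hasDerivAt_id c).congr_of_eventuallyEq hθ0)
  set D := ((0, c) : ℂ × ℂ).1 • fderiv ℂ μ (0, c) + μ (0, c) • ContinuousLinearMap.fst ℂ ℂ ℂ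
  have hinj : Function.Injective (D.prod D' : (ℂ × ℂ) →ₗ[ℂ] ℂ × ℂ) := by
    refine (injective_iff_map_eq_zero _).2 fun x hx => ?_
    have h1 : D x = 0 := congrArg Prod.fst hx
    have h2 : D' x = 0 := congrArg Prod.snd hx
    have h1' : x.1 = 0 := by simpa [D, hμ0] using h1
    have ex : x = x.2 • ((0, 1) : ℂ × ℂ) := Prod.ext (by simpa using h1') (by simp)
    rw [ex, map_smul, hD'1, smul_eq_mul, mul_one] at h2
    exact Prod.ext h1' h2
  exact ⟨(LinearEquiv.ofInjectiveEndo _ hinj).toContinuousLinearEquiv,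
    hD.congr_fderiv (ContinuousLinearMap.ext fun _ => rfl)⟩

/-- `(Q, ε μ, Θ)` is, near `T` and for parameters `(ε, t)` near `(0, c)`, an analytic family of
reparametrised integral curves of the foliation, through the point `Q` of the leaf at infinity. -/
structure IsSolutionFamily (κ₀ κ₁ κₜ κ c : ℂ) (Q μ Θ : ℂ × (ℂ × ℂ) → ℂ) (T : ℂ) : Prop where
  analyticAt_Q : AnalyticAt ℂ Q (T, (0, c))
  analyticAt_μ : AnalyticAt ℂ μ (T, (0, c))
  analyticAt_Θ : AnalyticAt ℂ Θ (T, (0, c))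
  Q_ne_zero : Q (T, (0, c)) ≠ 0
  Q_ne_one : Q (T, (0, c)) ≠ 1
  Q_ne_c : Q (T, (0, c)) ≠ c
  μ_ne_zero : μ (T, (0, c)) ≠ 0
  Θ_eq : ∀ᶠ t in 𝓝 c, Θ (T, (0, t)) = t
  hasDerivAt : ∃ lam : ℂ × (ℂ × ℂ) → ℂ, ∀ᶠ p in 𝓝 (T, ((0, c) : ℂ × ℂ)), lam p ≠ 0 ∧
    HasDerivAt (fun τ => Q (τ, p.2))
      (lam p * fieldQ κ₀ κ₁ κₜ (Q p) (p.2.1 * μ p) (Θ p)) p.1 ∧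
    HasDerivAt (fun τ => p.2.1 * μ (τ, p.2))
      (lam p * fieldM κ₀ κ₁ κₜ κ (Q p) (p.2.1 * μ p) (Θ p)) p.1 ∧
    HasDerivAt (fun τ => Θ (τ, p.2)) (lam p * fieldT (p.2.1 * μ p) (Θ p)) p.1

theorem IsSolutionFamily.exists_isChart {Q μ Θ : ℂ × (ℂ × ℂ) → ℂ} {T : ℂ}
    (h : IsSolutionFamily κ₀ κ₁ κₜ κ c Q μ Θ T) :
    ∃ φ g, IsChart (c := c) κ₀ κ₁ κₜ κ φ (Q (T, (0, c))) g ∧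
      (∀ᶠ p in 𝓝 (T, ((0, c) : ℂ × ℂ)), φ (Q p, p.2) = (p.2.1 * μ p, Θ p)) ∧
      Filter.map (fun p => (Q p, p.2)) (𝓝 (T, ((0, c) : ℂ × ℂ))) =
        𝓝 (Q (T, (0, c)), (0, c)) := by
  have hinc : AnalyticAt ℂ (fun w : ℂ × ℂ => (T, w)) (0, c) := analyticAt_const.prod analyticAt_id
  have hμ : DifferentiableAt ℂ (fun w => μ (T, w)) (0, c) :=
    (AnalyticAt.comp (g := μ) h.analyticAt_μ hinc).differentiableAt
  have hΘ : DifferentiableAt ℂ (fun w => Θ (T, w)) (0, c) :=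
    (AnalyticAt.comp (g := Θ) h.analyticAt_Θ hinc).differentiableAt
  obtain ⟨e, he⟩ := exists_hasFDerivAt_equiv hμ hΘ h.μ_ne_zero h.Θ_eq
  obtain ⟨lam, hlam⟩ := h.hasDerivAt
  have hε : AnalyticAt ℂ (fun p : ℂ × (ℂ × ℂ) => p.2.1) (T, (0, c)) :=
    analyticAt_fst.comp analyticAt_snd
  exact PainleveVI.exists_isChart (Y := fun p => (Q p, (p.2.1 * μ p, Θ p))) (lam := lam)
    (h.analyticAt_Q.prod ((hε.mul h.analyticAt_μ).prod h.analyticAt_Θ)) h.Q_ne_zero h.Q_ne_one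
    h.Q_ne_c (by simp [h.Θ_eq.self_of_nhds])
    (hlam.mono fun p hp => ⟨hp.1, hp.2.1.prodMk (hp.2.2.1.prodMk hp.2.2.2)⟩) he

/-- The germs are functions of `T` alone, even where `Q` takes the same value at several `T`. This
single-valuedness on the parameter curve is what produces the involution. -/
theorem exists_germs_along_curve {Q μ Θ : ℂ × (ℂ × ℂ) → ℂ} {Ω : Set ℂ} (hΩ : IsOpen Ω)
    (h : ∀ T ∈ Ω, IsSolutionFamily κ₀ κ₁ κₜ κ c Q μ Θ T) :
    ∃ S : ℂ → DiffGerm ((0, c) : ℂ × ℂ), ∀ T ∈ Ω, ∃ φ, ∀ᶠ T' in 𝓝 T,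
      IsChart κ₀ κ₁ κₜ κ φ (Q (T', (0, c))) (S T') := by
  classical
  choose φ g hφ hrel hmap using fun T (hT : T ∈ Ω) => (h T hT).exists_isChart
  refine ⟨fun T => if hT : T ∈ Ω then g T hT else 1, fun T hT => ⟨φ T hT, ?_⟩⟩
  have hl : Tendsto (fun q : ℂ => (q, ((0, c) : ℂ × ℂ))) (𝓝 T) (𝓝 (T, (0, c))) :=
    (Continuous.prodMk_left (X := ℂ) ((0, c) : ℂ × ℂ)).tendsto T
  filter_upwards [hΩ.mem_nhds hT, hl.eventually (hrel T hT).eventually_nhds] with T' hT' k1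
  rw [dif_pos hT']
  refine (hφ T' hT').congr ?_
  rw [Filter.EventuallyEq, ← hmap T' hT', eventually_map]
  filter_upwards [hrel T' hT', k1] with p k2 k3
  rw [k2, k3]

/-! ### Resolved vector fields near the singular points -/

/-- Analytic solutions of the regular system which resolves the foliation near a singular point of
the leaf at infinity, near `T` and with parameters
`(ε, t)` near `(0, c)`. -/
structure IsResolved (c k : ℂ) (a a' b b' C' : ℂ → ℂ → ℂ) (X Z G Θ : ℂ × (ℂ × ℂ) → ℂ)
    (T : ℂ) : Prop where
  analyticAt_X : AnalyticAt ℂ X (T, (0, c))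
  analyticAt_Z : AnalyticAt ℂ Z (T, (0, c))
  analyticAt_G : AnalyticAt ℂ G (T, (0, c))
  analyticAt_Θ : AnalyticAt ℂ Θ (T, (0, c))
  Θ_eq : ∀ᶠ p in 𝓝 (T, c), Θ (p.1, (0, p.2)) = p.2
  deriv_X : ∀ᶠ p in 𝓝 (T, ((0, c) : ℂ × ℂ)), HasDerivAt (fun τ => X (τ, p.2))
    (a (X p) (Θ p) * (2 * Z p + k * p.2.1) + b (X p) (Θ p) * X p * p.2.1) p.1
  deriv_Z : ∀ᶠ p in 𝓝 (T, ((0, c) : ℂ × ℂ)), HasDerivAt (fun τ => Z (τ, p.2))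
    (a (X p) (Θ p) * G p - X p * a' (X p) (Θ p) * G p - p.2.1 * X p * b' (X p) (Θ p) * Z p
      - p.2.1 ^ 2 * X p * C' (X p) (Θ p)) p.1
  deriv_Θ : ∀ᶠ p in 𝓝 (T, ((0, c) : ℂ × ℂ)), HasDerivAt (fun τ => Θ (τ, p.2))
    (p.2.1 * (Θ p * (Θ p - 1))) p.1
  rel : ∀ᶠ p in 𝓝 (T, ((0, c) : ℂ × ℂ)), Z p ^ 2 + k * p.2.1 * Z p = X p * G p

theorem eventually_eq_of_hasDerivAt_zero {Z E : Type*} [TopologicalSpace Z]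
    [NormedAddCommGroup E] [NormedSpace ℂ E] {h : ℂ × Z → E} {b : ℂ} {z₀ : Z}
    (hc : ContinuousAt h (b, z₀))
    (hd : ∀ᶠ p in 𝓝 (b, z₀), HasDerivAt (fun q => h (q, p.2)) 0 p.1) :
    ∀ᶠ p in 𝓝 (b, z₀), h p = h (b, p.2) := by
  have ht : Tendsto (fun p : ℂ × Z => (b, p.2)) (𝓝 (b, z₀)) (𝓝 (b, z₀)) :=
    (continuous_const.prodMk continuous_snd).tendsto _
  exact eventually_eq_of_hasDerivAt (F := fun _ _ => (0 : E)) (φ := h)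
    (ψ := fun p => h (b, p.2)) analyticAt_const hc (ContinuousAt.comp (g := h) hc ht) hd
    (Eventually.of_forall fun p => hasDerivAt_const p.1 (h (b, p.2))) (Eventually.of_forall fun _ => rfl)

/-- A function of the first and fourth of five variables is given by a polynomial. -/
def IsPoly (a : ℂ → ℂ → ℂ) : Prop :=
  ∃ P : MvPolynomial (Fin 5) ℂ, ∀ f : Fin 5 → ℂ, MvPolynomial.eval f P = a (f 0) (f 3)

/-- The polynomial system is started at `x = Z = 0`, `G = 1`. The defect `Z² + kεZ - xG` has
derivative zero and vanishes initially, so the relation persists. -/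
theorem exists_isResolved (c k : ℂ) {a a' b b' C' : ℂ → ℂ → ℂ} (ha : IsPoly a)
    (ha' : IsPoly a') (hb : IsPoly b) (hb' : IsPoly b') (hC' : IsPoly C') :
    ∃ X Z G Θ, IsResolved c k a a' b b' C' X Z G Θ 0 ∧
      X (0, (0, c)) = 0 ∧ Z (0, (0, c)) = 0 ∧ G (0, (0, c)) = 1 := by
  obtain ⟨Pa, hPa⟩ := ha
  obtain ⟨Pa', hPa'⟩ := ha'
  obtain ⟨Pb, hPb⟩ := hb
  obtain ⟨Pb', hPb'⟩ := hb'
  obtain ⟨PC, hPC⟩ := hC'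
  let x : MvPolynomial (Fin 5) ℂ := MvPolynomial.X 0
  let z : MvPolynomial (Fin 5) ℂ := MvPolynomial.X 1
  let g : MvPolynomial (Fin 5) ℂ := MvPolynomial.X 2
  let t : MvPolynomial (Fin 5) ℂ := MvPolynomial.X 3
  let e : MvPolynomial (Fin 5) ℂ := MvPolynomial.X 4
  let K : ℂ → MvPolynomial (Fin 5) ℂ := fun r => MvPolynomial.C r
  let V : Fin 5 → MvPolynomial (Fin 5) ℂ :=
    ![Pa * (K 2 * z + K k * e) + Pb * x * e,
      Pa * g - x * Pa' * g - e * x * Pb' * z - e ^ 2 * x * PC,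
      -- The equation for `G` is forced by the relation: differentiating `Z² + kεZ = xG` leaves a
      -- multiple of `x`, and division by `x` gives a polynomial.
      -(K 2 * z + K k * e) * (Pa' * g + e * Pb' * z + e ^ 2 * PC) - e * Pb * g,
      -- The parameter `ε` is a fifth unknown with zero derivative, so that dependence on it is
      -- dependence on initial values.
      e * (t * (t - K 1)), 0]
  obtain ⟨fl, hfl, hfl0, hfl'⟩ := exists_polynomial_flow V ![0, 0, 1, c, 0]
  let st : ℂ × (ℂ × ℂ) → (Fin 5 → ℂ) × ℂ := fun p => (![0, 0, 1, p.2.2, p.2.1], p.1)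
  have hst : ∀ p, AnalyticAt ℂ st p := fun p => by
    refine AnalyticAt.prod (analyticAt_pi_iff.2 fun i => ?_) analyticAt_fst
    fin_cases i
    · exact analyticAt_const
    · exact analyticAt_const
    · exact analyticAt_const
    · exact analyticAt_snd.comp analyticAt_snd
    · exact analyticAt_fst.comp analyticAt_snd
  let Y : ℂ × (ℂ × ℂ) → Fin 5 → ℂ := fun p => fl (st p)
  have hY : AnalyticAt ℂ Y (0, (0, c)) := AnalyticAt.comp (g := fl) (f := st) hfl (hst _)
  have hYi : ∀ i, AnalyticAt ℂ (fun p => Y p i) (0, (0, c)) := analyticAt_pi_iff.1 hY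
  have hst0 : Tendsto st (𝓝 (0, ((0, c) : ℂ × ℂ))) (𝓝 (![0, 0, 1, c, 0], 0)) :=
    (hst _).continuousAt
  have hY' : ∀ᶠ p in 𝓝 ((0 : ℂ), ((0, c) : ℂ × ℂ)), ∀ i,
      HasDerivAt (fun τ => Y (τ, p.2) i) (MvPolynomial.eval (Y p) (V i)) p.1 := by
    filter_upwards [hst0.eventually hfl'] with p hp
    exact hasDerivAt_pi.1 hp
  have hstart : ∀ᶠ w in 𝓝 ((0, c) : ℂ × ℂ), Y (0, w) = ![0, 0, 1, w.2, w.1] := by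
    have hc : Continuous fun w : ℂ × ℂ => ![0, 0, 1, w.2, w.1] := by fun_prop
    filter_upwards [(hc.tendsto (0, c)).eventually hfl0] with w hw
    exact hw
  have hstart' : ∀ᶠ p in 𝓝 ((0 : ℂ), ((0, c) : ℂ × ℂ)),
      Y (0, p.2) = ![0, 0, 1, p.2.2, p.2.1] :=
    (continuous_snd.tendsto ((0 : ℂ), ((0, c) : ℂ × ℂ))).eventually hstart
  have h4 : ∀ᶠ p in 𝓝 ((0 : ℂ), ((0, c) : ℂ × ℂ)), Y p 4 = p.2.1 := by
    have := eventually_eq_of_hasDerivAt_zero (h := fun p => Y p 4) (hYi 4).continuousAt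
      (hY'.mono fun p hp => (hp 4).congr_deriv (by simp [V]))
    filter_upwards [this, hstart'] with p k1 k2
    rw [k1, k2]
    rfl
  have h3 : ∀ᶠ p in 𝓝 ((0 : ℂ), ((0, c) : ℂ × ℂ)), HasDerivAt (fun τ => Y (τ, p.2) 3)
      (p.2.1 * (Y p 3 * (Y p 3 - 1))) p.1 := by
    filter_upwards [hY', h4] with p k1 k2
    exact (k1 3).congr_deriv (by simp [V, e, t, K, k2])
  have hs := hstart.self_of_nhds
  refine ⟨fun p => Y p 0, fun p => Y p 1, fun p => Y p 2, fun p => Y p 3,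
    ⟨hYi 0, hYi 1, hYi 2, hYi 3, ?_, ?_, ?_, h3, ?_⟩, congrFun hs 0, congrFun hs 1, congrFun hs 2⟩
  -- For `ε = 0` the derivative of `Θ` vanishes, so `t` stays constant along the leaf at infinity.
  · have hinc : Tendsto (fun p : ℂ × ℂ => (p.1, ((0 : ℂ), p.2))) (𝓝 (0, c))
        (𝓝 (0, (0, c))) := Continuous.tendsto (by fun_prop) _
    have := eventually_eq_of_hasDerivAt_zero (h := fun p : ℂ × ℂ => Y (p.1, (0, p.2)) 3)
      (b := 0) (z₀ := c) (ContinuousAt.comp (g := fun p => Y p 3) (hYi 3).continuousAt hinc)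
      ((hinc.eventually h3).mono fun p hp => hp.congr_deriv (by simp))
    filter_upwards [this, hinc.eventually hstart'] with p k1 k2
    rw [k1, k2]
    rfl
  · filter_upwards [hY', h4] with p k1 k2
    exact (k1 0).congr_deriv (by simp [V, e, z, x, K, k2, hPa, hPb])
  · filter_upwards [hY', h4] with p k1 k2
    exact (k1 1).congr_deriv (by simp [V, e, z, x, g, k2, hPa, hPa', hPb', hPC])
  · have hder : ∀ᶠ p in 𝓝 ((0 : ℂ), ((0, c) : ℂ × ℂ)), HasDerivAt
        (fun τ => Y (τ, p.2) 1 ^ 2 + k * p.2.1 * Y (τ, p.2) 1 - Y (τ, p.2) 0 * Y (τ, p.2) 2)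
        0 p.1 := by
      filter_upwards [hY', h4] with p k1 k2
      refine (((k1 1).pow 2).add ((k1 1).const_mul (k * p.2.1))
        |>.sub ((k1 0).mul (k1 2))).congr_deriv ?_
      simp [V, e, z, x, g, K, k2, hPa, hPa', hPb, hPb', hPC]
      ring
    have hε : ContinuousAt (fun p : ℂ × (ℂ × ℂ) => p.2.1) (0, (0, c)) := by fun_prop
    have := eventually_eq_of_hasDerivAt_zero
      (h := fun p => Y p 1 ^ 2 + k * p.2.1 * Y p 1 - Y p 0 * Y p 2)
      ((((hYi 1).continuousAt.pow 2).add ((continuousAt_const.mul hε).mul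
        (hYi 1).continuousAt)).sub ((hYi 0).continuousAt.mul (hYi 2).continuousAt)) hder
    filter_upwards [this, hstart'] with p k1 k2
    rw [k2] at k1
    simp at k1
    exact sub_eq_zero.1 k1

end

/-! ### From the resolved system back to the foliation. -/

section

variable {κ₀ κ₁ κₜ κ c k : ℂ} {a a' b b' C' : ℂ → ℂ → ℂ} {X Z G Θ : ℂ × (ℂ × ℂ) → ℂ} {T : ℂ}

theorem IsResolved.eventually (h : IsResolved c k a a' b b' C' X Z G Θ T) :
    ∀ᶠ T' in 𝓝 T, IsResolved c k a a' b b' C' X Z G Θ T' := by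
  have hl : Tendsto (fun q : ℂ => (q, ((0, c) : ℂ × ℂ))) (𝓝 T) (𝓝 (T, (0, c))) :=
    (Continuous.prodMk_left (X := ℂ) ((0, c) : ℂ × ℂ)).tendsto T
  have hl' : Tendsto (fun q : ℂ => (q, c)) (𝓝 T) (𝓝 (T, c)) :=
    (Continuous.prodMk_left (X := ℂ) c).tendsto T
  filter_upwards [hl.eventually h.analyticAt_X.eventually_analyticAt,
    hl.eventually h.analyticAt_Z.eventually_analyticAt,
    hl.eventually h.analyticAt_G.eventually_analyticAt,
    hl.eventually h.analyticAt_Θ.eventually_analyticAt, hl'.eventually h.Θ_eq.eventually_nhds,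
    hl.eventually h.deriv_X.eventually_nhds, hl.eventually h.deriv_Z.eventually_nhds,
    hl.eventually h.deriv_Θ.eventually_nhds, hl.eventually h.rel.eventually_nhds]
    with T' h1 h2 h3 h4 h5 h6 h7 h8 h9
  exact ⟨h1, h2, h3, h4, h5, h6, h7, h8, h9⟩

/-- At `ε = 0` the relation reads `Z² = X G`. Since `Z` has a simple zero with derivative `a 0 c`
and `G` is non-zero, `X` has a double zero: the curve is a double cover of the punctured
neighbourhood, ramified over the puncture. -/
theorem IsResolved.exists_radius (h : IsResolved c k a a' b b' C' X Z G Θ 0)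
    (hX : X (0, (0, c)) = 0) (hZ : Z (0, (0, c)) = 0) (hG : G (0, (0, c)) = 1)
    (ha : a 0 c ≠ 0) {δ : ℝ} (hδ : 0 < δ) :
    ∃ r > 0, ∃ u : ℂ → ℂ, ContinuousOn u (Metric.ball 0 r) ∧ ∀ T ∈ Metric.ball (0 : ℂ) r,
      IsResolved c k a a' b b' C' X Z G Θ T ∧ u T ≠ 0 ∧ X (T, (0, c)) = T ^ 2 * u T ∧
      ‖X (T, (0, c))‖ < δ ∧ (T ≠ 0 → Z (T, (0, c)) ≠ 0) := by
  have hl : Tendsto (fun q : ℂ => (q, ((0, c) : ℂ × ℂ))) (𝓝 0) (𝓝 (0, (0, c))) :=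
    (Continuous.prodMk_left (X := ℂ) ((0, c) : ℂ × ℂ)).tendsto 0
  have hΘ0 : Θ (0, (0, c)) = c := h.Θ_eq.self_of_nhds
  have hd : HasDerivAt (fun T => Z (T, (0, c))) (a 0 c) 0 :=
    h.deriv_Z.self_of_nhds.congr_deriv (by simp [hX, hΘ0, hG])
  let v : ℂ → ℂ := dslope (fun T => Z (T, (0, c))) 0
  have hv0 : v 0 = a 0 c := by rw [← hd.deriv, ← dslope_same]
  have hvT : ∀ T, Z (T, (0, c)) = T * v T := fun T => by
    have := sub_smul_dslope (fun T => Z (T, (0, c))) 0 T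
    simp only [hZ, sub_zero, smul_eq_mul] at this
    exact this.symm
  have hvc : ContinuousAt v 0 := continuousAt_dslope_same.2 hd.differentiableAt
  have hXn : ∀ᶠ T in 𝓝 (0 : ℂ), ‖X (T, (0, c))‖ < δ := by
    have := (h.analyticAt_X.continuousAt.tendsto.comp hl).norm
    rw [hX, norm_zero] at this
    exact this.eventually_lt_const hδ
  have hGn : ∀ᶠ T in 𝓝 (0 : ℂ), G (T, (0, c)) ≠ 0 := by
    have := h.analyticAt_G.continuousAt.tendsto.comp hl
    rw [hG] at this
    exact this.eventually_ne one_ne_zero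
  obtain ⟨r, hr, hball⟩ := Metric.eventually_nhds_iff_ball.1 (h.eventually.and
    ((hvc.eventually_ne (by rw [hv0]; exact ha)).and (hXn.and hGn)))
  have hcG : ∀ T ∈ Metric.ball (0 : ℂ) r, ContinuousAt (fun T => G (T, (0, c))) T := fun T hT =>
    ContinuousAt.comp (g := G) (f := fun q : ℂ => (q, ((0, c) : ℂ × ℂ)))
      (hball T hT).1.analyticAt_G.continuousAt
      (Continuous.prodMk_left (X := ℂ) ((0, c) : ℂ × ℂ)).continuousAt
  have hcZ : ∀ T ∈ Metric.ball (0 : ℂ) r, ContinuousAt (fun T => Z (T, (0, c))) T := fun T hT =>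
    ContinuousAt.comp (g := Z) (f := fun q : ℂ => (q, ((0, c) : ℂ × ℂ)))
      (hball T hT).1.analyticAt_Z.continuousAt
      (Continuous.prodMk_left (X := ℂ) ((0, c) : ℂ × ℂ)).continuousAt
  have hvc' : ContinuousOn v (Metric.ball 0 r) :=
    (continuousOn_dslope (Metric.ball_mem_nhds 0 hr)).2
      ⟨fun T hT => (hcZ T hT).continuousWithinAt, hd.differentiableAt⟩
  refine ⟨r, hr, fun T => v T ^ 2 / G (T, (0, c)), (hvc'.pow 2).div
    (fun T hT => (hcG T hT).continuousWithinAt) fun T hT => (hball T hT).2.2.2, fun T hT => ?_⟩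
  obtain ⟨h1, h2, h3, h4⟩ := hball T hT
  refine ⟨h1, div_ne_zero (pow_ne_zero 2 h2) h4, ?_, h3, fun hT0 => ?_⟩
  · have := h1.rel.self_of_nhds
    simp only [mul_zero, zero_mul, add_zero] at this
    rw [mul_div_assoc', eq_div_iff h4, ← this, hvT]
    ring
  · rw [hvT]
    exact mul_ne_zero hT0 h2

/-- In the coordinates `q = X + s(t)`, `m = ε X / Z` the vector field, multiplied by `Z / X`,
becomes the resolved one. The relation is needed only to eliminate `G` in the equation for `m`; `s`
gives the position of the singular point and `s'` its motion with `t`. -/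
theorem IsResolved.isSolutionFamily (h : IsResolved c k a a' b b' C' X Z G Θ T)
    (hX : X (T, (0, c)) ≠ 0) (hZ : Z (T, (0, c)) ≠ 0) {s s' : ℂ → ℂ}
    (hs : ∀ t, HasDerivAt s (s' t) t) (hsa : AnalyticAt ℂ s c)
    (h0 : X (T, (0, c)) + s c ≠ 0) (h1 : X (T, (0, c)) + s c ≠ 1) (hc : X (T, (0, c)) + s c ≠ c)
    (hE : ∀ x t, polyE t (x + s t) = x * a x t)
    (hE' : ∀ x t, polyE' t (x + s t) = a x t + x * a' x t)
    (hF : ∀ x t, polyF κ₀ κ₁ κₜ t (x + s t) = k * a x t + x * b x t + s' t * (t * (t - 1)))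
    (hF' : ∀ x t, polyF' κ₀ κ₁ κₜ t (x + s t) = k * a' x t + b x t + x * b' x t)
    (hC' : ∀ x t, C' x t = κ) :
    IsSolutionFamily κ₀ κ₁ κₜ κ c (fun p => X p + s (Θ p)) (fun p => X p / Z p) Θ T := by
  have hl' : Tendsto (fun t : ℂ => (T, t)) (𝓝 c) (𝓝 (T, c)) :=
    (Continuous.prodMk_right (X := ℂ) T).tendsto c
  have hΘ := hl'.eventually h.Θ_eq
  have hΘc : Θ (T, (0, c)) = c := hΘ.self_of_nhds
  refine ⟨h.analyticAt_X.add (AnalyticAt.comp (g := s) (by rw [hΘc]; exact hsa) h.analyticAt_Θ),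
    h.analyticAt_X.div h.analyticAt_Z hZ, h.analyticAt_Θ, by simpa only [hΘc] using h0,
    by simpa only [hΘc] using h1, by simpa only [hΘc] using hc, div_ne_zero hX hZ, hΘ,
    fun p => Z p / X p, ?_⟩
  filter_upwards [h.deriv_X, h.deriv_Z, h.deriv_Θ, h.rel,
    h.analyticAt_X.continuousAt.eventually_ne hX, h.analyticAt_Z.continuousAt.eventually_ne hZ]
    with p hpX hpZ hpΘ hrel hX0 hZ0
  refine ⟨div_ne_zero hZ0 hX0, ?_, ?_, ?_⟩
  · refine (hpX.add ((hs (Θ p)).comp p.1 hpΘ)).congr_deriv ?_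
    rw [fieldQ, hE, hF]
    field_simp
    ring
  · refine ((hpX.div hpZ hZ0).const_mul p.2.1).congr_deriv ?_
    rw [fieldM, hE', hF', hC']
    field_simp
    linear_combination (p.2.1 * (a (X p) (Θ p) - X p * a' (X p) (Θ p))) * hrel
  · refine hpΘ.congr_deriv ?_
    rw [fieldT]
    field_simp

/-- With `x = 1/q`, `S = κ₀ + κ₁ + κₜ + 1` and `N = -ε q / m`, the natural quadratic expression is
`N² - SεN + κε²`. Taking for `z₀` a root of `z² - S z + κ` and `Z = N - z₀ε` removes the constant
term and restores the form `Z² + kεZ` with `k = 2z₀ - S`. -/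
theorem IsResolved.isSolutionFamily_infinity {z₀ : ℂ}
    (h : IsResolved c (2 * z₀ - (κ₀ + κ₁ + κₜ + 1)) a a' b b' C' X Z G Θ T)
    (hX : X (T, (0, c)) ≠ 0) (hZ : Z (T, (0, c)) ≠ 0)
    (hz₀ : z₀ ^ 2 - (κ₀ + κ₁ + κₜ + 1) * z₀ + κ = 0)
    (h1 : (X (T, (0, c)))⁻¹ ≠ 1) (hc : (X (T, (0, c)))⁻¹ ≠ c)
    (ha : ∀ x t, a x t = (1 - x) * (1 - t * x)) (ha' : ∀ x t, a' x t = -(1 + t) + 2 * t * x)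
    (hb : ∀ x t, b x t = -(κ₁ * (1 - t * x) + (κₜ + 1) * t * (1 - x)))
    (hb' : ∀ x t, b' x t = (κ₁ + κₜ + 1) * t) (hC' : ∀ x t, C' x t = -κ * t + z₀ * b' x t) :
    IsSolutionFamily κ₀ κ₁ κₜ κ c (fun p => (X p)⁻¹)
      (fun p => -(X p * (Z p + z₀ * p.2.1))⁻¹) Θ T := by
  have hl' : Tendsto (fun t : ℂ => (T, t)) (𝓝 c) (𝓝 (T, c)) :=
    (Continuous.prodMk_right (X := ℂ) T).tendsto c
  have hΘ := hl'.eventually h.Θ_eq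
  have hε : AnalyticAt ℂ (fun p : ℂ × (ℂ × ℂ) => p.2.1) (T, (0, c)) :=
    analyticAt_fst.comp analyticAt_snd
  have hN := h.analyticAt_Z.add (analyticAt_const (v := z₀).mul hε)
  have hN0 : Z (T, (0, c)) + z₀ * 0 ≠ 0 := by simpa using hZ
  have hXN := h.analyticAt_X.mul hN
  refine ⟨h.analyticAt_X.inv hX, (hXN.inv (mul_ne_zero hX hN0)).neg, h.analyticAt_Θ,
    inv_ne_zero hX, h1, hc, neg_ne_zero.2 (inv_ne_zero (mul_ne_zero hX hN0)), hΘ,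
    fun p => -(X p * (Z p + z₀ * p.2.1)), ?_⟩
  filter_upwards [h.deriv_X, h.deriv_Z, h.deriv_Θ, h.rel,
    h.analyticAt_X.continuousAt.eventually_ne hX, hN.continuousAt.eventually_ne hN0]
    with p hpX hpZ hpΘ hrel hX0 hN0
  obtain ⟨N, hN⟩ : ∃ N, N = Z p + z₀ * p.2.1 := ⟨_, rfl⟩
  have hN0' : N ≠ 0 := by rw [hN]; exact hN0
  have hZN : Z p = N - z₀ * p.2.1 := by rw [hN]; ring
  refine ⟨neg_ne_zero.2 (mul_ne_zero hX0 hN0), ?_, ?_, ?_⟩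
  · refine (hpX.inv hX0).congr_deriv ?_
    simp only [← hN]
    rw [fieldQ, polyE, polyF, ha, hb, hZN]
    field_simp
    ring
  · refine (((hpX.mul (hpZ.add_const (z₀ * p.2.1))).inv (mul_ne_zero hX0 hN0)).neg.const_mul
      p.2.1).congr_deriv ?_
    simp only [Pi.mul_apply, ← hN]
    rw [fieldM, polyE', polyF', ha, ha', hb, hC', hb']
    rw [hZN] at hrel ⊢
    field_simp
    linear_combination (-p.2.1 * ((1 - X p) * (1 - X p * Θ p) - X p * (-(1 + Θ p) + X p * Θ p * 2)))
      * hrel - (p.2.1 ^ 3 * ((1 - X p) * (1 - X p * Θ p) - X p * (-(1 + Θ p) + X p * Θ p * 2)))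
      * hz₀
  · refine hpΘ.congr_deriv ?_
    simp only [← hN]
    rw [fieldT]
    field_simp

end

section

variable {κ₀ κ₁ κₜ κ c : ℂ}

/-! ### The holonomy around each singular point is an involution -/

/-- Writing `T = exp w`, the logarithmic coordinate on the leaf is `σ(2w + log u(T))`, so `w ↦ w +
2πi` shifts it by `4πi` up to the sign `σ`. The germs depend on `T` only and hence take the same
value at both ends. The sign `σ` is `-1` at infinity, where `q = 1/X`. -/
theorem apply_add_eq_of_isSolutionFamily {D : Set ℂ} (hD : Convex ℝ D)
    (hadd : ∀ ζ ∈ D, ζ + 4 * Real.pi * Complex.I ∈ D) {m : D → Leaf c} (hm : Continuous m)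
    (hper : ∀ ζ ζ' : D, (ζ' : ℂ) = ζ + 4 * Real.pi * Complex.I → m ζ' = m ζ)
    {g : D → DiffGerm ((0, c) : ℂ × ℂ)} (hg : (foliation κ₀ κ₁ κₜ κ).IsParallel m g)
    {r : ℝ} (hr : 0 < r) {u : ℂ → ℂ} (hu : ContinuousOn u (Metric.ball 0 r))
    (hu0 : ∀ T ∈ Metric.ball (0 : ℂ) r, u T ≠ 0) {Q μ Θ : ℂ × (ℂ × ℂ) → ℂ}
    (hsol : ∀ T ∈ Metric.ball (0 : ℂ) r, T ≠ 0 → IsSolutionFamily κ₀ κ₁ κₜ κ c Q μ Θ T)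
    {σ : ℂ} (hσ : σ = 1 ∨ σ = -1)
    (hQ : ∀ T ∈ Metric.ball (0 : ℂ) r, T ≠ 0 → ∀ ζ : ℂ, Complex.exp (σ * ζ) = T ^ 2 * u T →
      ∃ h : ζ ∈ D, (m ⟨ζ, h⟩ : ℂ) = Q (T, (0, c))) (ζ ζ' : D)
    (hζ : (ζ' : ℂ) = ζ + 4 * Real.pi * Complex.I) : g ζ' = g ζ := by
  have hσσ : σ * σ = 1 := by rcases hσ with rfl | rfl <;> norm_num
  have hb0 : (0 : ℂ) ∈ Metric.ball (0 : ℂ) r := Metric.mem_ball_self hr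
  -- Near `T = 0` the quotient `u(T) / u(0)` is close to one, so the principal logarithm is
  -- continuous there and single-valued in `T`.
  have hu1 : ∀ᶠ T in 𝓝 (0 : ℂ), u T / u 0 ∈ Complex.slitPlane := by
    have hc : ContinuousAt (fun T => u T / u 0) 0 :=
      (hu.continuousAt (Metric.ball_mem_nhds 0 hr)).div_const _
    refine hc.eventually (Complex.isOpen_slitPlane.mem_nhds ?_)
    change u 0 / u 0 ∈ Complex.slitPlane
    rw [div_self (hu0 0 hb0)]
    exact Complex.one_mem_slitPlane
  obtain ⟨r', hr', hball⟩ := Metric.eventually_nhds_iff_ball.1 (hu1.and (Metric.ball_mem_nhds 0 hr))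
  let H : Set ℂ := {w | w.re < Real.log r'}
  have hHc : Convex ℝ H := convex_halfSpace_re_lt _
  have hexp : ∀ w ∈ H, Complex.exp w ∈ Metric.ball (0 : ℂ) r' := fun w hw => by
    rw [mem_ball_zero_iff, Complex.norm_exp]
    exact (Real.lt_log_iff_exp_lt hr').1 hw
  let Λ : ℂ → ℂ := fun w => σ * (2 * w + (Complex.log (u 0) +
    Complex.log (u (Complex.exp w) / u 0)))
  have hΛexp : ∀ w ∈ H, Complex.exp (σ * Λ w) = Complex.exp w ^ 2 * u (Complex.exp w) := by
    intro w hw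
    have h1 := hball _ (hexp w hw)
    have h2 := hu0 _ h1.2
    simp only [Λ]
    rw [← mul_assoc, hσσ, one_mul, Complex.exp_add, Complex.exp_add, Complex.exp_log (hu0 0 hb0),
      Complex.exp_log (div_ne_zero h2 (hu0 0 hb0)), mul_div_cancel₀ _ (hu0 0 hb0), two_mul,
      Complex.exp_add, sq]
  have hΛQ : ∀ w ∈ H, ∃ h : Λ w ∈ D, (m ⟨Λ w, h⟩ : ℂ) = Q (Complex.exp w, (0, c)) :=
    fun w hw => hQ _ (hball _ (hexp w hw)).2 (Complex.exp_ne_zero w) _ (hΛexp w hw)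
  let L : H → D := fun w => ⟨Λ w, (hΛQ w w.2).1⟩
  have hL : Continuous L := by
    refine Continuous.subtype_mk (continuous_iff_continuousAt.2 fun w => ?_) _
    have hT := hball _ (hexp w w.2)
    have hue : ContinuousAt (fun w : H => u (Complex.exp w)) w :=
      ContinuousAt.comp (g := u) (f := fun w : H => Complex.exp w)
        (hu.continuousAt (Metric.isOpen_ball.mem_nhds hT.2)) (by fun_prop)
    have hlog := (hue.div_const (u 0)).clog hT.1
    have h2w : ContinuousAt (fun w : H => 2 * (w : ℂ)) w := by fun_prop
    exact continuousAt_const.mul (h2w.add (continuousAt_const.add hlog))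
  have hpD : PreconnectedSpace D := Subtype.preconnectedSpace hD.isPreconnected
  have hpH : PreconnectedSpace H := Subtype.preconnectedSpace hHc.isPreconnected
  obtain ⟨S, hS⟩ := exists_germs_along_curve (Ω := Metric.ball (0 : ℂ) r \ {0})
    (Metric.isOpen_ball.sdiff isClosed_singleton) fun T hT => hsol T hT.1 hT.2
  have hSpar : (foliation κ₀ κ₁ κₜ κ).IsParallel (m ∘ L) (fun w : H => S (Complex.exp w)) := by
    refine (isParallel_foliation_iff (hm.comp hL)).2 fun w => ?_
    obtain ⟨φ, hφ⟩ := hS (Complex.exp w) ⟨(hball _ (hexp w w.2)).2, Complex.exp_ne_zero _⟩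
    have hc : Continuous fun w : H => Complex.exp w := by fun_prop
    refine ⟨φ, (hc.continuousAt.eventually hφ).mono fun w' hw' => ?_⟩
    have e : ((m ∘ L) w' : ℂ) = Q (Complex.exp w', (0, c)) := (hΛQ w' w'.2).2
    rw [e]
    exact hw'
  let shift : D → D := fun ζ => ⟨ζ + 4 * Real.pi * Complex.I, hadd ζ ζ.2⟩
  have hshift : Continuous shift := by fun_prop
  have hmshift : m ∘ shift = m := funext fun ζ => hper ζ (shift ζ) rfl
  have hg' := hg.comp hshift
  rw [hmshift] at hg'
  let w₀ : H := ⟨((Real.log r' - 1 : ℝ) : ℂ), by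
    change (((Real.log r' - 1 : ℝ) : ℂ)).re < Real.log r'
    rw [Complex.ofReal_re]
    linarith⟩
  -- The factor `σ` makes the resulting shift `+4πi` in both cases, as `σ² = 1`.
  let w₁ : H := ⟨w₀ + σ * (2 * Real.pi * Complex.I), by
    change ((w₀ : ℂ) + σ * (2 * Real.pi * Complex.I)).re < Real.log r'
    have h1 : (σ * (2 * Real.pi * Complex.I)).re = 0 := by
      rcases hσ with rfl | rfl <;> simp
    rw [Complex.add_re, h1, add_zero]
    exact w₀.2⟩
  have hexp1 : Complex.exp (w₁ : ℂ) = Complex.exp (w₀ : ℂ) := by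
    change Complex.exp ((w₀ : ℂ) + σ * (2 * Real.pi * Complex.I)) = _
    rcases hσ with rfl | rfl
    · rw [one_mul, Complex.exp_add, Complex.exp_two_pi_mul_I, mul_one]
    · rw [neg_one_mul, Complex.exp_add, Complex.exp_neg, Complex.exp_two_pi_mul_I, inv_one, mul_one]
  have hL1 : L w₁ = shift (L w₀) := by
    refine Subtype.ext ?_
    change σ * (2 * (w₁ : ℂ) + (Complex.log (u 0) +
      Complex.log (u (Complex.exp w₁) / u 0))) = σ * (2 * (w₀ : ℂ) + (Complex.log (u 0) +
      Complex.log (u (Complex.exp w₀) / u 0))) + 4 * Real.pi * Complex.I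
    rw [hexp1]
    change σ * (2 * ((w₀ : ℂ) + σ * (2 * Real.pi * Complex.I)) + _) = _
    linear_combination (4 * Real.pi * Complex.I) * hσσ
  have k1 := (hg.comp hL).inv_mul_eq (hm.comp hL) hSpar w₀ w₁
  simp only [hexp1, mul_left_inj, inv_inj, Function.comp_apply, hL1] at k1
  -- The quotient of `g` and its translate is constant on `D`, so equality at `L w₀` is enough.
  have k2 := hg.inv_mul_eq hm hg' ζ (L w₀)
  simp only [Function.comp_apply] at k2
  rw [← k1, inv_mul_cancel, inv_mul_eq_one] at k2
  have e : ζ' = shift ζ := Subtype.ext hζ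
  rw [e, ← k2]

end

/-! ### The resolutions at `0`, `1`, `c` and infinity. -/

section

variable {κ₀ κ₁ κₜ κ c : ℂ}

theorem exists_pos_le_dist (c p : ℂ) :
    ∃ δ > 0, ∀ x ∈ ({0, 1, c} : Set ℂ), x ≠ p → δ ≤ dist x p := by
  have hfin : (({0, 1, c} : Set ℂ) \ {p}).Finite := (Set.toFinite _).sdiff
  have hp : (({0, 1, c} : Set ℂ) \ {p})ᶜ ∈ 𝓝 p :=
    hfin.isClosed.isOpen_compl.mem_nhds fun h => h.2 rfl
  obtain ⟨δ, hδ, hball⟩ := Metric.mem_nhds_iff.1 hp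
  exact ⟨δ, hδ, fun x hx hxp => not_lt.1 fun h => hball h ⟨hx, hxp⟩⟩

theorem discInvolutive_of_isPoly {p k : ℂ} (hp : p ∈ ({0, 1, c} : Set ℂ))
    {a a' b b' C' : ℂ → ℂ → ℂ} (ha : IsPoly a) (ha' : IsPoly a') (hb : IsPoly b)
    (hb' : IsPoly b') (hC : IsPoly C') (ha0 : a 0 c ≠ 0) {s s' : ℂ → ℂ}
    (hs : ∀ t, HasDerivAt s (s' t) t) (hsa : AnalyticAt ℂ s c) (hsc : s c = p)
    (hE : ∀ x t, polyE t (x + s t) = x * a x t)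
    (hE' : ∀ x t, polyE' t (x + s t) = a x t + x * a' x t)
    (hF : ∀ x t, polyF κ₀ κ₁ κₜ t (x + s t) = k * a x t + x * b x t + s' t * (t * (t - 1)))
    (hF' : ∀ x t, polyF' κ₀ κ₁ κₜ t (x + s t) = k * a' x t + b x t + x * b' x t)
    (hC' : ∀ x t, C' x t = κ) : DiscInvolutive (foliation κ₀ κ₁ κₜ κ) hp := by
  intro g hg
  obtain ⟨δ, hδ, hδd⟩ := exists_pos_le_dist c p
  obtain ⟨X, Z, G, Θ, h, hX0, hZ0, hG0⟩ := exists_isResolved c k ha ha' hb hb' hC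
  obtain ⟨r, hr, u, hu, hT⟩ := h.exists_radius hX0 hZ0 hG0 ha0 hδ
  have hXne : ∀ T ∈ Metric.ball (0 : ℂ) r, T ≠ 0 → X (T, (0, c)) ≠ 0 := fun T hT1 hT0 => by
    rw [(hT T hT1).2.2.1]
    exact mul_ne_zero (pow_ne_zero 2 hT0) (hT T hT1).2.1
  have hne : ∀ T ∈ Metric.ball (0 : ℂ) r, T ≠ 0 → ∀ x ∈ ({0, 1, c} : Set ℂ),
      X (T, (0, c)) + s c ≠ x := by
    intro T hT1 hT0 x hx hxe
    rw [hsc] at hxe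
    by_cases hxp : x = p
    · rw [hxp, add_eq_right] at hxe
      exact hXne T hT1 hT0 hxe
    · have h1 := hδd x hx hxp
      rw [← hxe, dist_eq_norm, add_sub_cancel_right] at h1
      exact absurd (hT T hT1).2.2.2.1 (not_lt.2 h1)
  refine apply_add_eq_of_isSolutionFamily (convex_discDomain c p)
    (fun ζ hζ => ?_) (continuous_discMap hp) (fun ζ ζ' e => ?_) hg hr hu
    (fun T hT1 => (hT T hT1).2.1) (fun T hT1 hT0 => (hT T hT1).1.isSolutionFamily
      (hXne T hT1 hT0) ((hT T hT1).2.2.2.2 hT0) hs hsa (hne T hT1 hT0 0 (by simp))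
      (hne T hT1 hT0 1 (by simp)) (hne T hT1 hT0 c (by simp)) hE hE' hF hF' hC')
    (σ := 1) (Or.inl rfl) fun T hT1 hT0 ζ hζ => ?_
  · have := discDomain_add (c := c) (p := p) 2 ζ hζ
    push_cast at this
    rwa [← mul_assoc, ← mul_assoc, show (2 : ℂ) * 2 = 4 by norm_num] at this
  · refine Subtype.ext ?_
    have h4 : (4 : ℂ) * Real.pi * Complex.I = 2 * Real.pi * Complex.I + 2 * Real.pi * Complex.I := by
      ring
    simp only [discMap, e, h4, Complex.exp_add, Complex.exp_two_pi_mul_I, mul_one]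
  · rw [one_mul, ← (hT T hT1).2.2.1] at hζ
    refine ⟨fun x hx hxp => ?_, ?_⟩
    · rw [← Complex.norm_exp, hζ]
      exact (hT T hT1).2.2.2.1.trans_le (hδd x hx hxp)
    · have hΘ : Θ (T, (0, c)) = c := (hT T hT1).1.Θ_eq.self_of_nhds
      change p + Complex.exp ζ = X (T, (0, c)) + s (Θ (T, (0, c)))
      rw [hζ, hΘ, hsc, add_comm]

theorem discInvolutive_foliation (hc0 : c ≠ 0) (hc1 : c ≠ 1) {p : ℂ}
    (hp : p ∈ ({0, 1, c} : Set ℂ)) : DiscInvolutive (foliation κ₀ κ₁ κₜ κ) hp := by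
  have hκ : IsPoly fun _ _ => κ := ⟨MvPolynomial.C κ, fun f => by simp⟩
  have hcases := hp
  simp only [Set.mem_insert_iff, Set.mem_singleton_iff] at hcases
  rcases hcases with h | h | h
  · refine discInvolutive_of_isPoly (k := κ₀) hp (a := fun x t => (x - 1) * (x - t))
      (a' := fun x t => (x - t) + (x - 1)) (b := fun x t => κ₁ * (x - t) + (κₜ + 1) * (x - 1))
      (b' := fun _ _ => κ₁ + κₜ + 1) (C' := fun _ _ => κ)
      ⟨(.X 0 - .C 1) * (.X 0 - .X 3), fun f => by simp⟩
      ⟨(.X 0 - .X 3) + (.X 0 - .C 1), fun f => by simp⟩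
      ⟨.C κ₁ * (.X 0 - .X 3) + .C (κₜ + 1) * (.X 0 - .C 1), fun f => by simp⟩
      ⟨.C (κ₁ + κₜ + 1), fun f => by simp⟩ hκ (by simpa using hc0)
      (s := fun _ => 0) (s' := fun _ => 0) (fun t => hasDerivAt_const t 0) analyticAt_const h.symm
      ?_ ?_ ?_ ?_ fun _ _ => rfl <;> intro x t
    · simp only [polyE]; ring
    · simp only [polyE']; ring
    · simp only [polyF]; ring
    · simp only [polyF']; ring
  · refine discInvolutive_of_isPoly (k := κ₁) hp (a := fun x t => (x + 1) * (x + 1 - t))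
      (a' := fun x t => (x + 1 - t) + (x + 1))
      (b := fun x t => κ₀ * (x + 1 - t) + (κₜ + 1) * (x + 1))
      (b' := fun _ _ => κ₀ + κₜ + 1) (C' := fun _ _ => κ)
      ⟨(.X 0 + .C 1) * (.X 0 + .C 1 - .X 3), fun f => by simp⟩
      ⟨(.X 0 + .C 1 - .X 3) + (.X 0 + .C 1), fun f => by simp⟩
      ⟨.C κ₀ * (.X 0 + .C 1 - .X 3) + .C (κₜ + 1) * (.X 0 + .C 1), fun f => by simp⟩
      ⟨.C (κ₀ + κₜ + 1), fun f => by simp⟩ hκ (by simpa [sub_eq_zero] using hc1.symm)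
      (s := fun _ => 1) (s' := fun _ => 0) (fun t => hasDerivAt_const t 1) analyticAt_const h.symm
      ?_ ?_ ?_ ?_ fun _ _ => rfl <;> intro x t
    · simp only [polyE]; ring
    · simp only [polyE']; ring
    · simp only [polyF]; ring
    · simp only [polyF']; ring
  -- This singular point moves with `t`: `s' = 1` contributes `t (t - 1)`, which accounts for the
  -- `1` in `κₜ + 1`, so that the exponent is `κₜ`. The rest of that term goes into `b`.
  · refine discInvolutive_of_isPoly (k := κₜ) hp (a := fun x t => (x + t) * (x + t - 1))
      (a' := fun x t => (x + t - 1) + (x + t))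
      (b := fun x t => κ₀ * (x + t - 1) + κ₁ * (x + t) + (x + t + t - 1))
      (b' := fun _ _ => κ₀ + κ₁ + 1) (C' := fun _ _ => κ)
      ⟨(.X 0 + .X 3) * (.X 0 + .X 3 - .C 1), fun f => by simp⟩
      ⟨(.X 0 + .X 3 - .C 1) + (.X 0 + .X 3), fun f => by simp⟩
      ⟨.C κ₀ * (.X 0 + .X 3 - .C 1) + .C κ₁ * (.X 0 + .X 3) + (.X 0 + .X 3 + .X 3 - .C 1),
        fun f => by simp⟩
      ⟨.C (κ₀ + κ₁ + 1), fun f => by simp⟩ hκ (by simpa [sub_eq_zero] using ⟨hc0, hc1⟩)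
      (s := fun t => t) (s' := fun _ => 1) (fun t => hasDerivAt_id t) analyticAt_id h.symm
      ?_ ?_ ?_ ?_ fun _ _ => rfl <;> intro x t
    · simp only [polyE]; ring
    · simp only [polyE']; ring
    · simp only [polyF]; ring
    · simp only [polyF']; ring

theorem outerInvolutive_foliation : OuterInvolutive (foliation (c := c) κ₀ κ₁ κₜ κ) := by
  intro g hg
  obtain ⟨z₀, hz₀⟩ : ∃ z₀ : ℂ, z₀ ^ 2 - (κ₀ + κ₁ + κₜ + 1) * z₀ + κ = 0 := by
    obtain ⟨s, hs⟩ := IsAlgClosed.exists_pow_nat_eq ((κ₀ + κ₁ + κₜ + 1) ^ 2 - 4 * κ) two_pos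
    exact ⟨(κ₀ + κ₁ + κₜ + 1 + s) / 2, by linear_combination hs / 4⟩
  -- With `‖X‖` below this bound, `1 / X` lies beyond `1 + ‖c‖`, inside the image of the outer
  -- domain.
  have hδ : 0 < (1 + ‖c‖)⁻¹ := by positivity
  let b : ℂ → ℂ → ℂ := fun x t => -(κ₁ * (1 - t * x) + (κₜ + 1) * t * (1 - x))
  let b' : ℂ → ℂ → ℂ := fun _ t => (κ₁ + κₜ + 1) * t
  obtain ⟨X, Z, G, Θ, h, hX0, hZ0, hG0⟩ := exists_isResolved c (2 * z₀ - (κ₀ + κ₁ + κₜ + 1))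
    (a := fun x t => (1 - x) * (1 - t * x)) (a' := fun x t => -(1 + t) + 2 * t * x)
    (b := b) (b' := b') (C' := fun x t => -κ * t + z₀ * b' x t)
    ⟨(.C 1 - .X 0) * (.C 1 - .X 3 * .X 0), fun f => by simp⟩
    ⟨-(.C 1 + .X 3) + .C 2 * .X 3 * .X 0, fun f => by simp⟩
    ⟨-(.C κ₁ * (.C 1 - .X 3 * .X 0) + .C (κₜ + 1) * .X 3 * (.C 1 - .X 0)), fun f => by simp [b]⟩
    ⟨.C (κ₁ + κₜ + 1) * .X 3, fun f => by simp [b']⟩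
    ⟨-.C κ * .X 3 + .C z₀ * (.C (κ₁ + κₜ + 1) * .X 3), fun f => by simp [b']⟩
  obtain ⟨r, hr, u, hu, hT⟩ := h.exists_radius hX0 hZ0 hG0 (by simp) hδ
  have hXne : ∀ T ∈ Metric.ball (0 : ℂ) r, T ≠ 0 → X (T, (0, c)) ≠ 0 := fun T hT1 hT0 => by
    rw [(hT T hT1).2.2.1]
    exact mul_ne_zero (pow_ne_zero 2 hT0) (hT T hT1).2.1
  have hlarge : ∀ T ∈ Metric.ball (0 : ℂ) r, T ≠ 0 → 1 + ‖c‖ < ‖(X (T, (0, c)))⁻¹‖ :=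
    fun T hT1 hT0 => by
      rw [norm_inv]
      exact (lt_inv_comm₀ (by positivity) (norm_pos_iff.2 (hXne T hT1 hT0))).2
        (hT T hT1).2.2.2.1
  refine apply_add_eq_of_isSolutionFamily (convex_outerDomain c)
    (fun ζ hζ => ?_) continuous_outerMap (fun ζ ζ' e => ?_) hg hr hu
    (fun T hT1 => (hT T hT1).2.1) (fun T hT1 hT0 => (hT T hT1).1.isSolutionFamily_infinity
      (hXne T hT1 hT0) ((hT T hT1).2.2.2.2 hT0) hz₀ (fun e => ?_) (fun e => ?_)
      (fun _ _ => rfl) (fun _ _ => rfl) (fun _ _ => rfl) (fun _ _ => rfl) fun _ _ => rfl)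
    (σ := -1) (Or.inr rfl) fun T hT1 hT0 ζ hζ => ?_
  · have := outerDomain_add (c := c) 2 ζ hζ
    push_cast at this
    rwa [← mul_assoc, ← mul_assoc, show (2 : ℂ) * 2 = 4 by norm_num] at this
  · refine Subtype.ext ?_
    have h4 : (4 : ℂ) * Real.pi * Complex.I = 2 * Real.pi * Complex.I + 2 * Real.pi * Complex.I := by
      ring
    simp only [outerMap, e, h4, Complex.exp_add, Complex.exp_two_pi_mul_I, mul_one]
  · have := hlarge T hT1 hT0
    rw [e, norm_one] at this
    linarith [norm_nonneg c]
  · have := hlarge T hT1 hT0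
    rw [e] at this
    linarith
  · rw [neg_one_mul, Complex.exp_neg, ← (hT T hT1).2.2.1, inv_eq_iff_eq_inv] at hζ
    refine ⟨?_, hζ⟩
    change 1 + ‖c‖ < Real.exp ζ.re
    rw [← Complex.norm_exp, hζ]
    exact hlarge T hT1 hT0

end

end PainleveVI

end

theorem theorem1 (κ₀ κ₁ κₜ κ c : ℂ) (hc0 : c ≠ 0) (hc1 : c ≠ 1) (P : PainleveVI.Leaf c) :
    ∃ ρ : FundamentalGroup (PainleveVI.Leaf c) P →*
        PainleveVI.DiffGerm ((0, c) : ℂ × ℂ),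
      PainleveVI.IsHolonomyRepresentation κ₀ κ₁ κₜ κ ρ ∧
      PainleveVI.VirtuallyCommutative ρ.range ∧
      (∃ g₀ g₁ g_c : FundamentalGroup (PainleveVI.Leaf c) P,
        PainleveVI.IsSimpleTurn 0 g₀ ∧ PainleveVI.IsSimpleTurn 1 g₁ ∧
          PainleveVI.IsSimpleTurn c g_c ∧
          Subgroup.closure {ρ g₀, ρ g₁, ρ g_c} = ρ.range) ∧
      ∀ g₀ g₁ g_c : FundamentalGroup (PainleveVI.Leaf c) P,
        PainleveVI.IsSimpleTurn 0 g₀ → PainleveVI.IsSimpleTurn 1 g₁ →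
        PainleveVI.IsSimpleTurn c g_c →
        Subgroup.closure {ρ g₀, ρ g₁, ρ g_c} = ρ.range →
        ∃ N : Subgroup ρ.range,
          (∀ g : ρ.range, g ∈ N ↔
            PainleveVI.IsEvenWord ![ρ g₀, ρ g₁, ρ g_c] (g : PainleveVI.DiffGerm _)) ∧
          N.Normal ∧ (∀ a ∈ N, ∀ b ∈ N, a * b = b * a) ∧ N.index ≠ 0 ∧ N.index ≤ 2 := by
  have hd : ∀ p (hp : p ∈ ({0, 1, c} : Set ℂ)),
      PainleveVI.DiscInvolutive (PainleveVI.foliation κ₀ κ₁ κₜ κ) hp :=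
    fun p hp => PainleveVI.discInvolutive_foliation hc0 hc1 hp
  exact ⟨(PainleveVI.foliation κ₀ κ₁ κₜ κ).holHom P,
    PainleveVI.isHolonomyRepresentation_holHom hc0 hc1 P,
    PainleveVI.FlatSystem.holonomy_virtuallyCommutative hc0 hc1 P _ hd
      PainleveVI.outerInvolutive_foliation⟩
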